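/- \textbf{Conventions.} $\langle x\rangle=(1+x^2)^{1/2}$, $\mathbb R_+=(0,\infty)$, $\mathbb R_-=(-\infty,0)$, $\|\cdot\|$ is the norm of $L^2(\mathbb R)$, powers of complex numbers are principal branches, and a formula with $\pm$ stands for two separate statements, one at $+\infty$ (upper signs) and one at $-\infty$ (lower signs). For $V\in L^2_{\rm loc}(\mathbb R;\mathbb C)$ let $H_Vf=-f''+Vf$ (in the sense of distributions) on $\mathrm{Dom}(H_V)=\{f\in L^2(\mathbb R): -f''+Vf\in L^2(\mathbb R)\}$. \textbf{Assumption.} Let $N\ge 1$ be an integer, $\nu_\pm\in\mathbb R$, $\varepsilon_1>0$, and let $V\in W^{N,\infty}_{\rm loc}(\mathbb R;\mathbb C)$ (continuous representative) satisfy: (a) $\limsup_{x\to-\infty}\operatorname{Im}V(x)<0$ and $\liminf_{x\to+\infty}\operatorname{Im}V(x)>0$; (b) for all $1\le m\le N$, $|\operatorname{Im}V^{(m)}(x)|=O(|\operatorname{Im}V(x)|\langle x\rangle^{m\nu_\pm})$ and $|V^{(m)}(x)|=O(|V(x)|\langle x\rangle^{m\nu_\pm})$ as $x\to\pm\infty$;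 (c) if $V$ is unbounded at $\pm\infty$, then $\langle x\rangle^{4(\nu_\pm+\varepsilon_1)+2}\bigl(\langle x\rangle^{4\nu_\pm+2}+|\operatorname{Re}V(x)|\bigr)=O(|\operatorname{Im}V(x)|^2)$ as $x\to\pm\infty$; if $V$ is bounded at $\pm\infty$, then $\nu_\pm<1$. \textbf{Pseudomode.} Let $n:=N-1$ and let $\varepsilon_2$ satisfy $0<\varepsilon_2<1-\nu_\pm$ at each end at which $V$ is bounded. For $\lambda>0$ put $$\delta_\pm=\inf\Bigl\{\delta\ge0:\frac{|\operatorname{Im}V(\pm\delta)|^2}{\langle\delta\rangle^{4\nu_\pm+2\varepsilon_1+2}}=\lambda\Bigr\},\quad \Delta_\pm=\tfrac14\delta_\pm^{-\nu_\pm}\quad\text{if $V$ is unbounded at $\pm\infty$},$$ $$\delta_\pm=\lambda^{\frac{1+\varepsilon_2}2},\quad \Delta_\pm=\tfrac14\delta_\pm\quad\text{if $V$ is bounded at $\pm\infty$},$$ and $\mathcal J_\pm=\{x\in\mathbb R_\pm:|x|<\delta_\pm\}$. Let $\psi_{-1}'=i\lambda^{-1/2}(\lambda-V)^{1/2}$,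 $$\psi_{k+1}'=\frac1{2\psi_{-1}'}\Bigl(\psi_k''-\sum_{\alpha+\beta=k,\ \alpha,\beta\ge0}\psi_\alpha'\psi_\beta'\Bigr),\quad -1\le k\le n-2,$$ $\psi_k(0)=0$, and $g=\exp\bigl(-\sum_{k=-1}^{n-1}\lambda^{-k/2}\psi_k\bigr)$. For all sufficiently large $\lambda$ let $\xi=\xi_\lambda\in C_0^\infty(\mathbb R)$ satisfy $0\le\xi\le1$, $\xi=1$ on $(-\delta_-+\Delta_-,\delta_+-\Delta_+)$, $\xi=0$ outside $(-\delta_-,\delta_+)$ and $\|\xi^{(j)}\|_{L^\infty(\mathbb R_\pm)}\le C\Delta_\pm^{-j}$, $j=1,2$, with $C$ independent of $\lambda$. Put $f:=\xi g$ and $$\kappa(\lambda):=\frac{\|\xi''g\|+\|\xi'g'\|}{\|\xi g\|}.$$ \textbf{Theorem.} As $\lambda\to+\infty$, $\delta_\pm\to+\infty$. For all sufficiently large $\lambda$, $0\neq f\in\mathrm{Dom}(H_V)$ and $$\frac{\|(H_V-\lambda)f\|}{\|f\|}=\kappa(\lambda)+\sigma^{(n)}(\lambda),\qquad \kappa=\kappa_-+\kappa_+,\quad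 \sigma^{(n)}=\sigma_-^{(n)}+\sigma_+^{(n)},$$ where $\kappa(\lambda)\to0$ and, as $\lambda\to+\infty$, with some $c>0$: (i) if $V$ is unbounded at $\pm\infty$, then $\kappa_\pm=O\bigl(\exp(-c\,\delta_\pm^{\nu_\pm+1+\varepsilon_1})\bigr)$ and $$\sigma_\pm^{(n)}=\begin{cases}O\bigl(\lambda^{-\frac{n+1}2}\sup_{x\in\mathcal J_\pm}|V(x)|\langle x\rangle^{(n+1)\nu_\pm}\bigr),&\nu_\pm<0,\\ O\bigl(\delta_\pm^{(n+1)\nu_\pm}\lambda^{\frac{1-n}2}\bigr),&\nu_\pm\ge0;\end{cases}$$ (ii) if $V$ is bounded at $\pm\infty$, then $\kappa_\pm=O\bigl(\exp(-c\,\lambda^{\varepsilon_2/2})\bigr)$ and $$\sigma_\pm^{(n)}=\begin{cases}O\bigl(\lambda^{-\frac{n+1}2}\bigr),&\nu_\pm<0,\\ O\bigl(\lambda^{-\frac{n+1}2(1-(1+\varepsilon_2)\nu_\pm)}\bigr),&\nu_\pm\ge0.\end{cases}$$ -/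

import Mathlib

open Set Filter Topology MeasureTheory Asymptotics
open scoped ContDiff

namespace JWKB

/-! ### Weak derivatives, Sobolev spaces, the Schrödinger operator -/

/-- `v` is an `m`-th weak (distributional) derivative of `u` on `ℝ`. -/
def IsWeakDeriv (m : ℕ) (u v : ℝ → ℂ) : Prop :=
  LocallyIntegrable u volume ∧ LocallyIntegrable v volume ∧
    ∀ φ : ℝ → ℝ, ContDiff ℝ ∞ φ → HasCompactSupport φ →
      ∫ x, iteratedDeriv m φ x • u x = (-1 : ℂ) ^ m * ∫ x, φ x • v x

/-- Weak derivatives are unique up to null sets. -/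
theorem IsWeakDeriv.ae_eq {m : ℕ} {u v w : ℝ → ℂ} (hv : IsWeakDeriv m u v)
    (hw : IsWeakDeriv m u w) : v =ᵐ[volume] w := by
  refine ae_eq_of_integral_contDiff_smul_eq hv.2.1 hw.2.1 fun φ hφ hc => ?_
  have h := (hv.2.2 φ hφ hc).symm.trans (hw.2.2 φ hφ hc)
  exact mul_left_cancel₀ (pow_ne_zero m (by norm_num)) h

open Classical in
/-- The `m`-th weak derivative of `u` (a representative of it; `0` if there is none). -/
noncomputable def weakDeriv (m : ℕ) (u : ℝ → ℂ) : ℝ → ℂ :=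
  if h : ∃ v, IsWeakDeriv m u v then h.choose else 0

/-- `u ∈ W^{N,∞}_loc(ℝ)`: the weak derivatives of orders `0, …, N` exist and are essentially
bounded on every compact set. -/
def MemSobolevInftyLoc (N : ℕ) (u : ℝ → ℂ) : Prop :=
  ∀ m ≤ N, ∃ v, IsWeakDeriv m u v ∧ ∀ K : Set ℝ, IsCompact K → MemLp v ⊤ (volume.restrict K)

/-- The action `-f'' + V f`, with `f''` the weak second derivative. -/
noncomputable def schrodinger (V f : ℝ → ℂ) (x : ℝ) : ℂ :=
  -weakDeriv 2 f x + V x * f x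

/-- `f ∈ Dom(H_V)`, the maximal domain `{f ∈ L² : -f'' + V f ∈ L²}`. -/
def MemDomain (V f : ℝ → ℂ) : Prop :=
  MemLp f 2 volume ∧ (∃ v, IsWeakDeriv 2 f v) ∧ MemLp (schrodinger V f) 2 volume

/-- The norm of `L²(ℝ)`. -/
noncomputable def l2norm (u : ℝ → ℂ) : ℝ := (eLpNorm u 2 volume).toReal

/-- `⟨x⟩ = (1 + x²)^{1/2}`. -/
noncomputable def jap (x : ℝ) : ℝ := Real.sqrt (1 + x ^ 2)

/-! ### The two ends of the line -/

/-- The two ends `-∞` and `+∞` of the real line; quantities with an index `±` are functions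
on this type. -/
inductive Side
  | minus
  | plus

/-- The sign `±1`. -/
def Side.sgn : Side → ℝ
  | .minus => -1
  | .plus => 1

/-- The filter of neighbourhoods of `±∞`. -/
def Side.atInfty : Side → Filter ℝ
  | .minus => atBot
  | .plus => atTop

/-- `ℝ₋ = (-∞, 0)` and `ℝ₊ = (0, ∞)`. -/
def Side.halfLine : Side → Set ℝ
  | .minus => Iio 0
  | .plus => Ioi 0

/-- `V` is bounded at `±∞`. -/
def BoundedAt (s : Side) (V : ℝ → ℂ) : Prop :=
  ∃ C : ℝ, ∀ᶠ x in s.atInfty, ‖V x‖ ≤ C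

/-! ### The admissible potentials -/

/-- The admissible potentials of regularity `N`, with exponents `ν₋, ν₊` and `ε₁ > 0`.
`V` is the continuous representative of its class in `W^{N,∞}_loc(ℝ)`. -/
structure Admissible (N : ℕ) (V : ℝ → ℂ) (ν : Side → ℝ) (ε₁ : ℝ) : Prop where
  continuous : Continuous V
  sobolev : MemSobolevInftyLoc N V
  im_minus : limsup (fun x => (((V x).im : ℝ) : EReal)) atBot < 0
  im_plus : 0 < liminf (fun x => (((V x).im : ℝ) : EReal)) atTop
  im_deriv : ∀ s : Side, ∀ m ∈ Finset.Icc 1 N,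
    (fun x => (weakDeriv m V x).im) =O[ae volume ⊓ s.atInfty]
      fun x => |(V x).im| * jap x ^ (m * ν s)
  norm_deriv : ∀ s : Side, ∀ m ∈ Finset.Icc 1 N,
    (fun x => weakDeriv m V x) =O[ae volume ⊓ s.atInfty]
      fun x => ‖V x‖ * jap x ^ (m * ν s)
  eps_pos : 0 < ε₁
  im_large : ∀ s : Side, ¬ BoundedAt s V →
    (fun x => jap x ^ (4 * (ν s + ε₁) + 2) * (jap x ^ (4 * ν s + 2) + |(V x).re|))
      =O[s.atInfty] fun x => |(V x).im| ^ 2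
  nu_lt_one : ∀ s : Side, BoundedAt s V → ν s < 1

/-! ### The JWKB ansatz -/

/-- `psiD V lam j` is `ψ'_{j-1}` (the index is shifted by one: `j = 0` is the leading term
`ψ'_{-1} = i lam^{-1/2} (lam - V)^{1/2}`, principal branch). With `k = j - 1`, the second
equation is `ψ'_{k+1} = (2 ψ'_{-1})⁻¹ (ψ''_k - ∑_{α + β = k; α, β ≥ 0} ψ'_α ψ'_β)`. -/
noncomputable def psiD (V : ℝ → ℂ) (lam : ℝ) : ℕ → ℝ → ℂ
  | 0 => fun x =>
      Complex.I * ((lam ^ (-(1 / 2) : ℝ) : ℝ) : ℂ) * ((lam : ℂ) - V x) ^ (1 / 2 : ℂ)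
  | j + 1 => fun x =>
      1 / (2 * psiD V lam 0 x) *
        (deriv (psiD V lam j) x
          - ∑ i : Fin j, psiD V lam (i + 1) x * psiD V lam (j - i) x)
termination_by j => j
decreasing_by all_goals omega

/-- `g = exp(-∑_{k=-1}^{n-1} lam^{-k/2} ψ_k)` with `ψ_k(0) = 0`; here `j = k + 1`. -/
noncomputable def ansatz (V : ℝ → ℂ) (n : ℕ) (lam x : ℝ) : ℂ :=
  Complex.exp (-∑ j ∈ Finset.range (n + 1),
    ((lam ^ ((1 - (j : ℝ)) / 2) : ℝ) : ℂ) * ∫ t in (0 : ℝ)..x, psiD V lam j t)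

/-! ### The cut-off -/

open Classical in
/-- The numbers `δ_±(lam)`. -/
noncomputable def delta (V : ℝ → ℂ) (ν : Side → ℝ) (ε₁ ε₂ : ℝ) (lam : ℝ) (s : Side) : ℝ :=
  if BoundedAt s V then lam ^ ((1 + ε₂) / 2)
  else sInf {d : ℝ | 0 ≤ d ∧
    |(V (s.sgn * d)).im| ^ 2 / jap d ^ (4 * ν s + 2 * ε₁ + 2) = lam}

open Classical in
/-- The numbers `Δ_±(lam)`. -/
noncomputable def width (V : ℝ → ℂ) (ν : Side → ℝ) (ε₁ ε₂ : ℝ) (lam : ℝ) (s : Side) : ℝ :=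
  if BoundedAt s V then delta V ν ε₁ ε₂ lam s / 4
  else delta V ν ε₁ ε₂ lam s ^ (-ν s) / 4

/-- `η` is a smooth cut-off that is `1` on `(-δ₋ + Δ₋, δ₊ - Δ₊)` and `0` outside
`(-δ₋, δ₊)`, whose derivatives satisfy `|η^{(j)}| ≤ C Δ_±^{-j}` on `ℝ_±`, `j = 1, 2`. -/
structure IsCutoff (C : ℝ) (δ Δ : Side → ℝ) (η : ℝ → ℝ) : Prop where
  smooth : ContDiff ℝ ∞ η
  compact : HasCompactSupport η
  mem_Icc : ∀ x, η x ∈ Icc (0 : ℝ) 1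
  eq_one : ∀ x ∈ Ioo (-δ .minus + Δ .minus) (δ .plus - Δ .plus), η x = 1
  eq_zero : ∀ x ∉ Ioo (-δ .minus) (δ .plus), η x = 0
  deriv_le : ∀ s : Side, ∀ j ∈ Finset.Icc 1 2, ∀ x ∈ s.halfLine,
    |iteratedDeriv j η x| ≤ C / Δ s ^ j

/-- The pseudomode `f = ξ g`. -/
noncomputable def pseudomode (V : ℝ → ℂ) (n : ℕ) (ξ : ℝ → ℝ → ℝ) (lam x : ℝ) : ℂ :=
  (ξ lam x : ℂ) * ansatz V n lam x

/-- The cut-off error `κ = (‖ξ'' g‖ + ‖ξ' g'‖) / ‖ξ g‖`. -/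
noncomputable def cutoffError (V : ℝ → ℂ) (n : ℕ) (ξ : ℝ → ℝ → ℝ) (lam : ℝ) : ℝ :=
  (l2norm (fun x => ((iteratedDeriv 2 (ξ lam) x : ℝ) : ℂ) * ansatz V n lam x)
    + l2norm (fun x => ((deriv (ξ lam) x : ℝ) : ℂ) * deriv (ansatz V n lam) x))
    / l2norm (pseudomode V n ξ lam)

/-- `‖(H_V - lam) f‖ / ‖f‖`. -/
noncomputable def quotient (V f : ℝ → ℂ) (lam : ℝ) : ℝ :=
  l2norm (fun x => schrodinger V f x - (lam : ℂ) * f x) / l2norm f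

/-- `sup_{x ∈ J_±} |V(x)| ⟨x⟩^p`, where `J_± = {x ∈ ℝ_± : |x| < d}`. -/
noncomputable def supWeighted (V : ℝ → ℂ) (s : Side) (d p : ℝ) : ℝ :=
  sSup ((fun x => ‖V x‖ * jap x ^ p) '' {x | x ∈ s.halfLine ∧ |x| < d})

end JWKB

/-! Write z = (λ - V)^{1/2} and Ψ = -g'/g. Where λ - V avoids the cut, the functions U_m = V^{(m)}
z^{-(m+2)} satisfy z⁻¹ U_m' = U_{m+1} + ((m+2)/2) U_m U_1. The recursion for ψ_k is therefore solved
by universal polynomials: Ψ = z ∑_{j≤n} Q_j(U), with Q_0 = i and Q_j homogeneous of weight j for j ≥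
1 (`symQ_isSym`, `psiD_eq`). The recursion cancels every term of weight at most n in Ψ' - Ψ² + V -
λ. What survives is z² R_n(U) with all terms of weight at least n + 1 (`symR_eq`,
`hasDerivAt_logDer`). Since U_m is of order (1+|V|) λ⁻¹ (⟨x⟩^ν λ^{-1/2})^m, this remainder is
O((1+|V|) ⟨x⟩^{(n+1)ν} λ^{-(n+1)/2}), which is the source of σ (`exists_logDer_bounds`).

The modulus of g is governed by Re Ψ, whose leading part is Re(iz) = Im V / (2 Re z), comparable to
Im V / √λ. The sign condition on Im V makes g decay at both ends. By the time the transition region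
is reached, ∫|Im V| exceeds a multiple of √λ times the rate E, so |g| ≤ A exp(-cE) there. This beats
the factors 1/Δ, √δ and √λ, while |g| stays bounded below on [0,1] (`SideControl.norm_ansatz`,
`SideControl.transition`).

At an unbounded end, δ is the first point at which F = |Im V|² ⟨x⟩^{-(4ν+2ε₁+2)} reaches λ.
Condition (c) says that F dominates ⟨x⟩^{4ν+2ε₁+2} and |Re V| ⟨x⟩^{2ε₁}, so F ≤ λ yields |V| = O(λ),
Re V ≤ λ/2 and ⟨x⟩^ν = O(λ^{1/4}). Gronwall's inequality for Im V on a window of length comparable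
to δ^{-ν} gives the lower bound on ∫|Im V|. At a bounded end all parameters are explicit. Both cases
feed the same list of estimates, `SideControl`, and the rest of the argument does not distinguish
them.

Finally (H_V - λ) f = -ξ''g - 2ξ'g' + z² R_n(U) f. The quotient thus lies between 0 and 2κ plus the
size of the remainder, and κ, being exponentially small, is absorbed by the bound for σ
(`pseudomode_estimate`).

Only n derivatives of V are classical and the last is merely locally Lipschitz. Hence Ψ' exists
almost everywhere, and pointwise identities become weak ones through the fundamental theorem of
calculus for Lipschitz functions. -/

namespace JWKB

/-! ### Pointwise Lipschitz functions and the fundamental theorem of calculus -/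

/-- `F` is Lipschitz in a neighbourhood of `x`. -/
def LipAt (F : ℝ → ℂ) (x : ℝ) : Prop :=
  (fun p : ℝ × ℝ => F p.1 - F p.2) =O[𝓝 (x, x)] fun p => p.1 - p.2

namespace LipAt

variable {F G : ℝ → ℂ} {x : ℝ}

theorem continuousAt (h : LipAt F x) : ContinuousAt F x := by
  have h1 : Tendsto (fun y : ℝ => (y, x)) (𝓝 x) (𝓝 (x, x)) :=
    (continuous_id.prodMk continuous_const).tendsto x
  have h2 := h.comp_tendsto h1
  have h3 : Tendsto (fun y : ℝ => y - x) (𝓝 x) (𝓝 0) := by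
    have := (continuous_id.sub continuous_const).tendsto (f := fun y : ℝ => y - x) x
    simpa using this
  have h4 := IsBigO.trans_tendsto h2 h3
  have h5 := h4.add_const (F x)
  simpa [Function.comp_def, ContinuousAt] using h5

theorem const (c : ℂ) (x : ℝ) : LipAt (fun _ => c) x := by
  simpa [LipAt] using isBigO_zero _ _

theorem add (hF : LipAt F x) (hG : LipAt G x) : LipAt (fun y => F y + G y) x := by
  refine (IsBigO.add hF hG).congr_left fun p => ?_
  ring

theorem neg (hF : LipAt F x) : LipAt (fun y => -F y) x := by
  refine (IsBigO.neg_left hF).congr_left fun p => ?_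
  ring

theorem mul (hF : LipAt F x) (hG : LipAt G x) : LipAt (fun y => F y * G y) x := by
  have h1 : (fun p : ℝ × ℝ => F p.1) =O[𝓝 (x, x)] fun _ => (1 : ℝ) :=
    (Tendsto.comp hF.continuousAt (continuous_fst.tendsto (x, x))).isBigO_one ℝ
  have h2 : (fun p : ℝ × ℝ => G p.2) =O[𝓝 (x, x)] fun _ => (1 : ℝ) :=
    (Tendsto.comp hG.continuousAt (continuous_snd.tendsto (x, x))).isBigO_one ℝ
  have h3 := IsBigO.add (IsBigO.congr_right (IsBigO.mul hF h2) fun p => mul_one (p.1 - p.2))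
    (IsBigO.congr_right (IsBigO.mul h1 hG) fun p => one_mul (p.1 - p.2))
  refine IsBigO.congr_left h3 fun p => ?_
  ring

theorem congr (hF : LipAt F x) (h : F =ᶠ[𝓝 x] G) : LipAt G x := by
  refine IsBigO.congr' hF ?_ EventuallyEq.rfl
  have h1 := (continuous_fst.tendsto (x, x)).eventually h
  have h2 := (continuous_snd.tendsto (x, x)).eventually h
  filter_upwards [h1, h2] with p hp hq
  rw [hp, hq]

/-- Strict differentiability is exactly the two-point estimate needed here; ordinary
differentiability at one point would not suffice. -/
theorem comp_strict {φ : ℂ → ℂ} {φ' : ℂ} (hφ : HasStrictDerivAt φ φ' (F x)) (hF : LipAt F x) :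
    LipAt (fun y => φ (F y)) x := by
  have h1 : Tendsto (fun p : ℝ × ℝ => (F p.1, F p.2)) (𝓝 (x, x)) (𝓝 (F x, F x)) :=
    (Tendsto.comp hF.continuousAt (continuous_fst.tendsto (x, x))).prodMk_nhds
      (Tendsto.comp hF.continuousAt (continuous_snd.tendsto (x, x)))
  exact (hφ.hasStrictFDerivAt.isBigO_sub.comp_tendsto h1).trans hF

theorem of_contDiffAt (h : ContDiffAt ℝ 1 F x) : LipAt F x :=
  (h.hasStrictFDerivAt (by simp)).isBigO_sub

theorem exists_lipschitzOnWith (h : LipAt F x) :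
    ∃ K, ∃ t ∈ 𝓝 x, LipschitzOnWith K F t := by
  obtain ⟨K, hK⟩ := IsBigO.exists_pos h
  obtain ⟨hK0, hK⟩ := hK
  rw [IsBigOWith, nhds_prod_eq] at hK
  obtain ⟨t, ht, hsub⟩ := (mem_prod_same_iff).1 hK
  refine ⟨K.toNNReal, t, ht, LipschitzOnWith.of_dist_le_mul fun y hy w hw => ?_⟩
  have := hsub (mk_mem_prod hy hw)
  simp only [mem_ofPred_eq] at this
  rwa [dist_eq_norm, dist_eq_norm, Real.coe_toNNReal _ hK0.le]

end LipAt

/-- `u` is locally Lipschitz with almost everywhere derivative `v`. -/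
structure HasLipDeriv (u v : ℝ → ℂ) : Prop where
  lip : ∀ x, LipAt u x
  ae_deriv : ∀ᵐ x, HasDerivAt u (v x) x

namespace HasLipDeriv

variable {u v : ℝ → ℂ}

theorem continuous (h : HasLipDeriv u v) : Continuous u :=
  continuous_iff_continuousAt.2 fun x => (h.lip x).continuousAt

theorem exists_lipschitzOnWith (h : HasLipDeriv u v) (a b : ℝ) :
    ∃ K, LipschitzOnWith K u (uIcc a b) := by
  refine LocallyLipschitzOn.exists_lipschitzOnWith_of_compact isCompact_uIcc fun x _ => ?_
  obtain ⟨K, t, ht, hK⟩ := (h.lip x).exists_lipschitzOnWith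
  exact ⟨K, t, mem_nhdsWithin_of_mem_nhds ht, hK⟩

/-- Lipschitz functions on compact intervals are absolutely continuous, so the real and imaginary
parts are integrals of their almost everywhere derivatives. -/
theorem intervalIntegrable_and_integral (h : HasLipDeriv u v) (a b : ℝ) :
    IntervalIntegrable v volume a b ∧ ∫ x in a..b, v x = u b - u a := by
  obtain ⟨K, hK⟩ := h.exists_lipschitzOnWith a b
  have hre : AbsolutelyContinuousOnInterval (fun x => (u x).re) a b := by
    refine LipschitzOnWith.absolutelyContinuousOnInterval (K := K) ?_
    intro x hx y hy
    refine le_trans ?_ (hK hx hy)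
    rw [edist_dist, edist_dist]
    refine ENNReal.ofReal_le_ofReal ?_
    rw [Real.dist_eq, Complex.dist_eq, ← Complex.sub_re]
    exact Complex.abs_re_le_norm _
  have him : AbsolutelyContinuousOnInterval (fun x => (u x).im) a b := by
    refine LipschitzOnWith.absolutelyContinuousOnInterval (K := K) ?_
    intro x hx y hy
    refine le_trans ?_ (hK hx hy)
    rw [edist_dist, edist_dist]
    refine ENNReal.ofReal_le_ofReal ?_
    rw [Real.dist_eq, Complex.dist_eq, ← Complex.sub_im]
    exact Complex.abs_im_le_norm _
  have e : v =ᵐ[volume] fun x => ((deriv (fun x => (u x).re) x : ℝ) : ℂ)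
      + ((deriv (fun x => (u x).im) x : ℝ) : ℂ) * Complex.I := by
    filter_upwards [h.ae_deriv] with x hx
    have h1 : HasDerivAt (fun x => (u x).re) (v x).re x :=
      Complex.reCLM.hasFDerivAt.comp_hasDerivAt x hx
    have h2 : HasDerivAt (fun x => (u x).im) (v x).im x :=
      Complex.imCLM.hasFDerivAt.comp_hasDerivAt x hx
    rw [h1.deriv, h2.deriv, Complex.re_add_im]
  have i1 := hre.intervalIntegrable_deriv
  have i2 := him.intervalIntegrable_deriv
  have j1 : IntervalIntegrable (fun x => ((deriv (fun x => (u x).re) x : ℝ) : ℂ)) volume a b :=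
    ⟨i1.1.ofReal, i1.2.ofReal⟩
  have j2 : IntervalIntegrable (fun x => ((deriv (fun x => (u x).im) x : ℝ) : ℂ)) volume a b :=
    ⟨i2.1.ofReal, i2.2.ofReal⟩
  have j3 := j2.mul_const Complex.I
  refine ⟨(j1.add j3).congr_ae (ae_restrict_of_ae (e.mono fun x hx => ?_)), ?_⟩
  · exact hx.symm
  · rw [intervalIntegral.integral_congr_ae (e.mono fun x hx _ => hx),
      intervalIntegral.integral_add j1 j3, intervalIntegral.integral_mul_const,
      intervalIntegral.integral_ofReal, intervalIntegral.integral_ofReal,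
      hre.integral_deriv_eq_sub, him.integral_deriv_eq_sub]
    apply Complex.ext <;> simp

theorem locallyIntegrable (h : HasLipDeriv u v) : LocallyIntegrable v volume := by
  refine (locallyIntegrable_iff).2 fun K hK => ?_
  obtain ⟨a, b, hab⟩ : ∃ a b, K ⊆ Icc a b := ⟨_, _, hK.isBounded.subset_Icc_sInf_sSup⟩
  by_cases hle : a ≤ b
  · exact ((intervalIntegrable_iff_integrableOn_Icc_of_le hle).1
      (h.intervalIntegrable_and_integral a b).1).mono_set hab
  · rw [Icc_eq_empty hle] at hab
    rw [subset_empty_iff.1 hab]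
    exact integrableOn_empty

theorem mul {u' v' : ℝ → ℂ} (h : HasLipDeriv u v) (h' : HasLipDeriv u' v') :
    HasLipDeriv (fun x => u x * u' x) (fun x => v x * u' x + u x * v' x) where
  lip x := (h.lip x).mul (h'.lip x)
  ae_deriv := by
    filter_upwards [h.ae_deriv, h'.ae_deriv] with x hx hx' using hx.mul hx'

theorem of_contDiff (h : ContDiff ℝ 1 u) : HasLipDeriv u (deriv u) where
  lip x := LipAt.of_contDiffAt h.contDiffAt
  ae_deriv := ae_of_all _ fun x => ((h.differentiable (by simp)) x).hasDerivAt

/-- The almost everywhere derivative of a locally Lipschitz function is its weak derivative. -/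
theorem isWeakDeriv (h : HasLipDeriv u v) : IsWeakDeriv 1 u v := by
  refine ⟨h.continuous.locallyIntegrable, h.locallyIntegrable, fun φ hφ hc => ?_⟩
  have hφc : ContDiff ℝ 1 (fun x => (φ x : ℂ)) :=
    Complex.ofRealCLM.contDiff.comp (hφ.of_le (by simp))
  have hd : ∀ x, deriv (fun x => (φ x : ℂ)) x = ((deriv φ x : ℝ) : ℂ) := fun x =>
    (((hφ.differentiable (by simp)) x).hasDerivAt.ofReal_comp).deriv
  -- Integration by parts is the fundamental theorem applied to the product φu, with vanishing
  -- boundary values.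
  have hp := (of_contDiff hφc).mul h
  obtain ⟨a, b, hab⟩ : ∃ a b, tsupport φ ⊆ Ioo a b := by
    obtain ⟨r, hr⟩ := hc.isCompact.isBounded.subset_ball 0
    exact ⟨0 - r, 0 + r, by rwa [← Real.ball_eq_Ioo]⟩
  have hz : ∀ x, x ∉ Ioo a b → φ x = 0 := fun x hx =>
    image_eq_zero_of_notMem_tsupport fun h => hx (hab h)
  have hz' : ∀ x, x ∉ Ioo a b → deriv φ x = 0 := fun x hx => by
    by_contra hne
    exact hx (hab (support_deriv_subset hne))
  have hI := (hp.intervalIntegrable_and_integral a b)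
  simp only [iteratedDeriv_one, pow_one, neg_mul, one_mul, Complex.real_smul]
  by_cases hle : a ≤ b
  · have e0 : ∀ F : ℝ → ℂ, (∀ x ∉ Ioo a b, F x = 0) → ∫ x, F x = ∫ x in a..b, F x := by
      intro F hF
      rw [intervalIntegral.integral_of_le hle, setIntegral_eq_integral_of_forall_compl_eq_zero]
      intro x hx
      exact hF x fun h => hx ⟨h.1, h.2.le⟩
    rw [e0 _ (fun x hx => by simp [hz' x hx]), e0 _ (fun x hx => by simp [hz x hx])]
    have i1 : IntervalIntegrable (fun x => ((deriv φ x : ℝ) : ℂ) * u x) volume a b := by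
      refine Continuous.intervalIntegrable ?_ _ _
      exact (Complex.continuous_ofReal.comp (hφ.continuous_deriv (by simp))).mul h.continuous
    have i2 : IntervalIntegrable (fun x => (φ x : ℂ) * v x) volume a b :=
      (h.intervalIntegrable_and_integral a b).1.continuousOn_mul
        (Complex.continuous_ofReal.comp hφ.continuous).continuousOn
    have := hI.2
    simp only [hd] at this
    rw [intervalIntegral.integral_add i1 i2] at this
    simp only [hz b (by simp), hz a (by simp)] at this
    simpa using eq_neg_of_add_eq_zero_left (by simpa using this)
  · have h0 : ∀ x, φ x = 0 := fun x => hz x (by simp [Ioo_eq_empty (fun h => hle h.le)])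
    have h1 : ∀ x, deriv φ x = 0 := fun x => hz' x (by simp [Ioo_eq_empty (fun h => hle h.le)])
    simp [h0, h1]

end HasLipDeriv

/-! ### Regularity of functions with locally bounded weak derivatives -/

/-- `v` is essentially bounded on compact sets. -/
def LocBdd (v : ℝ → ℂ) : Prop :=
  ∀ K : Set ℝ, IsCompact K → MemLp v ⊤ (volume.restrict K)

theorem LocBdd.locallyIntegrable {v : ℝ → ℂ} (h : LocBdd v) : LocallyIntegrable v volume := by
  refine (locallyIntegrable_iff).2 fun K hK => ?_
  have : IsFiniteMeasure (volume.restrict K) := ⟨by simpa using hK.measure_lt_top⟩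
  exact (h K hK).integrable (by simp)

/-- Lebesgue differentiation supplies the derivative, and the essential bound of `v` near a point is
a Lipschitz constant for the primitive there. -/
theorem LocBdd.hasLipDeriv_integral {v : ℝ → ℂ} (h : LocBdd v) (c : ℂ) :
    HasLipDeriv (fun x => c + ∫ t in (0 : ℝ)..x, v t) v where
  ae_deriv := by
    filter_upwards [_root_.LocallyIntegrable.ae_hasDerivAt_integral h.locallyIntegrable] with x hx using (hx 0).const_add c
  lip x := by
    refine (LipAt.const c x).add ?_
    have hi : ∀ a b, IntervalIntegrable v volume a b := fun a b =>
      (h.locallyIntegrable.integrableOn_isCompact isCompact_uIcc).intervalIntegrable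
    have hb := h (Icc (x - 1) (x + 1)) isCompact_Icc
    obtain ⟨M, hM⟩ : ∃ M : ℝ, ∀ᵐ t, t ∈ Icc (x - 1) (x + 1) → ‖v t‖ ≤ M := by
      refine ⟨(eLpNorm v ⊤ (volume.restrict (Icc (x - 1) (x + 1)))).toReal, ?_⟩
      rw [← ae_restrict_iff' measurableSet_Icc]
      have h1 := ae_le_eLpNormEssSup (f := v) (μ := volume.restrict (Icc (x - 1) (x + 1)))
      filter_upwards [h1] with t ht
      rw [← eLpNorm_exponent_top] at ht
      rw [← toReal_enorm]
      exact ENNReal.toReal_mono hb.2.ne ht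
    refine IsBigO.of_bound M ?_
    have hn : Icc (x - 1) (x + 1) ∈ 𝓝 x := Icc_mem_nhds (by linarith) (by linarith)
    have hn2 : Icc (x - 1) (x + 1) ×ˢ Icc (x - 1) (x + 1) ∈ 𝓝 (x, x) := prod_mem_nhds hn hn
    filter_upwards [hn2] with p hp
    rw [intervalIntegral.integral_interval_sub_left (hi _ _) (hi _ _)]
    have := intervalIntegral.norm_integral_le_of_norm_le_const_ae (f := v) (a := p.2) (b := p.1)
      (C := M) (by
        filter_upwards [hM] with t ht hmem
        exact ht (uIcc_subset_Icc hp.2 hp.1 (uIoc_subset_uIcc hmem)))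
    simpa using this

/-- A smooth compactly supported function with vanishing integral has a compactly supported
primitive. -/
theorem exists_primitive_hasCompactSupport {θ : ℝ → ℝ} (hθ : ContDiff ℝ ∞ θ)
    (hc : HasCompactSupport θ) (h0 : ∫ x, θ x = 0) :
    ∃ Φ : ℝ → ℝ, ContDiff ℝ ∞ Φ ∧ HasCompactSupport Φ ∧ deriv Φ = θ := by
  obtain ⟨r, hr⟩ := hc.isCompact.isBounded.subset_closedBall 0
  have hz : ∀ x, |r| + 1 ≤ |x| → θ x = 0 := fun x hx => image_eq_zero_of_notMem_tsupport fun h => by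
    have := hr h
    rw [mem_closedBall_zero_iff, Real.norm_eq_abs] at this
    linarith [le_abs_self r]
  set R := |r| + 1
  have hd : ∀ x, HasDerivAt (fun x => ∫ t in (-R)..x, θ t) (θ x) x := fun x =>
    (hθ.continuous.integral_hasStrictDerivAt _ _).hasDerivAt
  have hderiv : deriv (fun x => ∫ t in (-R)..x, θ t) = θ := funext fun x => (hd x).deriv
  refine ⟨fun x => ∫ t in (-R)..x, θ t,
    contDiff_infty_iff_deriv.2 ⟨fun x => (hd x).differentiableAt, by rwa [hderiv]⟩, ?_, hderiv⟩
  refine HasCompactSupport.intro (K := Icc (-R) R) isCompact_Icc fun x hx => ?_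
  rcases lt_or_ge x (-R) with h | h
  · refine intervalIntegral.integral_zero_ae (ae_of_all _ fun t ht => hz t ?_)
    rw [uIoc_of_ge h.le] at ht
    exact le_abs.2 (Or.inr (by linarith [ht.2]))
  · have hx' : R < x := not_le.1 fun h' => hx ⟨h, h'⟩
    rw [intervalIntegral.integral_of_le h, ← h0]
    refine setIntegral_eq_integral_of_forall_compl_eq_zero fun t ht => hz t ?_
    by_cases h1 : -R < t
    · exact le_abs.2 (Or.inl (hx'.le.trans (not_le.1 fun h2 => ht ⟨h1, h2⟩).le))
    · exact le_abs.2 (Or.inr (by linarith))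

/-- The du Bois-Reymond argument: φ minus its integral times a normalised bump ρ has integral zero,
so it is the derivative of a test function and pairs to zero with z. The constant is therefore the
pairing of ρ with z. -/
theorem IsWeakDeriv.ae_eq_const {z : ℝ → ℂ} (hz : IsWeakDeriv 1 z 0) :
    ∃ c : ℂ, z =ᵐ[volume] fun _ => c := by
  let b : ContDiffBump (0 : ℝ) := default
  have hb1 := b.contDiff_normed (μ := volume) (n := ⊤)
  have hb2 := b.hasCompactSupport_normed (μ := volume)
  have hb3 := b.integral_normed (μ := volume)
  set ρ := b.normed volume with hρ
  refine ⟨∫ x, ρ x • z x, ae_eq_of_integral_contDiff_smul_eq hz.1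
    (continuous_const.locallyIntegrable) fun φ hφ hc => ?_⟩
  have iφ : Integrable φ := hφ.continuous.integrable_of_hasCompactSupport hc
  have iρ : Integrable ρ := hb1.continuous.integrable_of_hasCompactSupport hb2
  have jφ : Integrable fun x => φ x • z x :=
    hz.1.integrable_smul_left_of_hasCompactSupport hφ.continuous hc
  have jρ : Integrable fun x => ρ x • z x :=
    hz.1.integrable_smul_left_of_hasCompactSupport hb1.continuous hb2
  obtain ⟨Φ, h1, h2, h3⟩ := exists_primitive_hasCompactSupport
    (θ := fun x => φ x - (∫ t, φ t) * ρ x) (hφ.sub (contDiff_const.mul hb1))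
    (hc.sub (hb2.mul_left)) (by
      rw [integral_sub iφ (iρ.const_mul _), integral_const_mul, hb3]; ring)
  have h4 := hz.2.2 Φ h1 h2
  rw [iteratedDeriv_one, h3] at h4
  have e : ∀ x, (φ x - (∫ t, φ t) * ρ x) • z x = φ x • z x - (∫ t, φ t) • (ρ x • z x) := fun x => by
    rw [sub_smul, mul_smul]
  simp only [e, Pi.zero_apply, smul_zero, integral_zero, mul_zero] at h4
  have jρ' : Integrable fun x => (∫ t, φ t) • (ρ x • z x) := jρ.smul (∫ t, φ t)
  rw [integral_sub jφ jρ', integral_smul, sub_eq_zero] at h4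
  rw [h4, integral_smul_const]

/-- The difference of `u` and the primitive of `v` has weak derivative zero. -/
theorem IsWeakDeriv.ae_eq_integral {u v : ℝ → ℂ} (h : IsWeakDeriv 1 u v) (hv : LocBdd v) :
    ∃ c : ℂ, u =ᵐ[volume] fun x => c + ∫ t in (0 : ℝ)..x, v t := by
  have hP := (hv.hasLipDeriv_integral 0).isWeakDeriv
  have hz : IsWeakDeriv 1 (fun x => u x - (0 + ∫ t in (0 : ℝ)..x, v t)) 0 := by
    refine ⟨h.1.sub hP.1, continuous_const.locallyIntegrable, fun φ hφ hc => ?_⟩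
    have hφ' : Continuous (iteratedDeriv 1 φ) := hφ.continuous_iteratedDeriv 1 (by simp)
    have hc' : HasCompactSupport (iteratedDeriv 1 φ) := by
      rw [iteratedDeriv_one]; exact hc.deriv
    simp only [smul_sub]
    rw [integral_sub (h.1.integrable_smul_left_of_hasCompactSupport hφ' hc')
      (hP.1.integrable_smul_left_of_hasCompactSupport hφ' hc'), h.2.2 φ hφ hc, hP.2.2 φ hφ hc]
    simp
  obtain ⟨c, hc⟩ := hz.ae_eq_const
  refine ⟨c, ?_⟩
  filter_upwards [hc] with x hx
  rw [← hx]; ring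

/-- Induction on the order. The weak derivative `v 1` has a continuous representative, namely a
primitive of `v 2`, and `u` is a primitive of that representative, hence classically differentiable.
Continuity of `u` upgrades almost everywhere equality to equality. The last function of the chain
survives only as the derivative of a Lipschitz function. -/
theorem sobolev_regularity (n : ℕ) : ∀ (u : ℝ → ℂ) (v : ℕ → ℝ → ℂ), Continuous u →
    u =ᵐ[volume] v 0 → (∀ m ≤ n, IsWeakDeriv 1 (v m) (v (m + 1))) →
    (∀ m ≤ n, LocBdd (v (m + 1))) →
    ContDiff ℝ n u ∧ (∀ m ≤ n, iteratedDeriv m u =ᵐ[volume] v m) ∧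
      HasLipDeriv (iteratedDeriv n u) (v (n + 1)) := by
  induction n with
  | zero =>
    intro u v hu h0 hw hb
    obtain ⟨c, hc⟩ := (hw 0 le_rfl).ae_eq_integral (hb 0 le_rfl)
    have hL := (hb 0 le_rfl).hasLipDeriv_integral c
    have e : u = fun x => c + ∫ t in (0 : ℝ)..x, v 1 t :=
      (Continuous.ae_eq_iff_eq volume hu hL.continuous).1 (h0.trans hc)
    refine ⟨by simpa using (contDiff_zero (𝕜 := ℝ)).2 hu, ?_, ?_⟩
    · intro m hm
      obtain rfl : m = 0 := by omega
      simpa using h0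
    · rw [iteratedDeriv_zero, e]; exact hL
  | succ n ih =>
    intro u v hu h0 hw hb
    obtain ⟨c, hc⟩ := (hw 0 (by omega)).ae_eq_integral (hb 0 (by omega))
    have hL := (hb 0 (by omega)).hasLipDeriv_integral c
    have e : u = fun x => c + ∫ t in (0 : ℝ)..x, v 1 t :=
      (Continuous.ae_eq_iff_eq volume hu hL.continuous).1 (h0.trans hc)
    obtain ⟨c', hc'⟩ := (hw 1 (by omega)).ae_eq_integral (hb 1 (by omega))
    have hL' := (hb 1 (by omega)).hasLipDeriv_integral c'
    set w : ℝ → ℂ := fun x => c' + ∫ t in (0 : ℝ)..x, v 2 t with hwdef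
    obtain ⟨i1, i2, i3⟩ := ih w (fun m => v (m + 1)) hL'.continuous hc'.symm
      (fun m hm => hw (m + 1) (by omega)) (fun m hm => hb (m + 1) (by omega))
    have e2 : u = fun x => c + ∫ t in (0 : ℝ)..x, w t := by
      rw [e]
      funext x
      rw [intervalIntegral.integral_congr_ae (g := w)]
      filter_upwards [hc'] with t ht _ using ht
    have hd : ∀ x, HasDerivAt u (w x) x := fun x => by
      rw [e2]
      exact (hL'.continuous.integral_hasStrictDerivAt 0 x).hasDerivAt.const_add c
    have hd' : deriv u = w := funext fun x => (hd x).deriv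
    refine ⟨?_, ?_, ?_⟩
    · push_cast
      refine contDiff_succ_iff_deriv.2 ⟨fun x => (hd x).differentiableAt, by simp, ?_⟩
      rw [hd']; exact i1
    · intro m hm
      rcases m with _ | m
      · simpa using h0
      · rw [iteratedDeriv_succ', hd']
        exact i2 m (by omega)
    · rw [iteratedDeriv_succ', hd']; exact i3

theorem isWeakDeriv_weakDeriv {m : ℕ} {u : ℝ → ℂ} (h : ∃ v, IsWeakDeriv m u v) :
    IsWeakDeriv m u (weakDeriv m u) := by
  rw [weakDeriv, dif_pos h]
  exact h.choose_spec

/-- Test the order m identity with φ' and cancel (-1)^m. -/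
theorem IsWeakDeriv.succ_of {m : ℕ} {u v w : ℝ → ℂ} (hv : IsWeakDeriv m u v)
    (hw : IsWeakDeriv (m + 1) u w) : IsWeakDeriv 1 v w := by
  refine ⟨hv.2.1, hw.2.1, fun φ hφ hc => ?_⟩
  have h1 := hv.2.2 (deriv φ) (contDiff_infty_iff_deriv.1 hφ).2 hc.deriv
  have h2 := hw.2.2 φ hφ hc
  rw [iteratedDeriv_succ', h1, pow_succ, mul_assoc] at h2
  rw [iteratedDeriv_one, pow_one]
  exact mul_left_cancel₀ (pow_ne_zero m (by norm_num)) h2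

theorem IsWeakDeriv.trans {u v w : ℝ → ℂ} (hv : IsWeakDeriv 1 u v)
    (hw : IsWeakDeriv 1 v w) : IsWeakDeriv 2 u w := by
  refine ⟨hv.1, hw.2.1, fun φ hφ hc => ?_⟩
  have h1 := hv.2.2 (deriv φ) (contDiff_infty_iff_deriv.1 hφ).2 hc.deriv
  have h2 := hw.2.2 φ hφ hc
  rw [iteratedDeriv_succ', h1, ← iteratedDeriv_one (f := φ), h2]
  ring

/-- Regularity of a continuous function in `W^{n+1,∞}_loc`. -/
theorem MemSobolevInftyLoc.regularity {n : ℕ} {V : ℝ → ℂ} (hc : Continuous V)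
    (hV : MemSobolevInftyLoc (n + 1) V) :
    ContDiff ℝ n V ∧ (∀ m ≤ n + 1, iteratedDeriv m V =ᵐ[volume] weakDeriv m V) ∧
      HasLipDeriv (iteratedDeriv n V) (iteratedDeriv (n + 1) V) ∧
      ∀ m ≤ n + 1, LocBdd (weakDeriv m V) := by
  have hb : ∀ m ≤ n + 1, LocBdd (weakDeriv m V) := fun m hm K hK => by
    obtain ⟨v, hv, hvb⟩ := hV m hm
    exact (hvb K hK).ae_eq (ae_restrict_of_ae (hv.ae_eq (isWeakDeriv_weakDeriv ⟨v, hv⟩)))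
  have hw : ∀ m ≤ n + 1, IsWeakDeriv m V (weakDeriv m V) := fun m hm =>
    isWeakDeriv_weakDeriv ⟨_, (hV m hm).choose_spec.1⟩
  have h0 : V =ᵐ[volume] weakDeriv 0 V := by
    refine IsWeakDeriv.ae_eq (m := 0) (u := V)
      ⟨hc.locallyIntegrable, hc.locallyIntegrable, fun φ _ _ => by simp⟩ (hw 0 (by omega))
  obtain ⟨r1, r2, r3⟩ := sobolev_regularity n V (fun m => weakDeriv m V) hc h0
    (fun m hm => (hw m (by omega)).succ_of (hw (m + 1) (by omega))) (fun m hm => hb _ (by omega))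
  -- At order n + 1 the classical derivative takes the default value zero where it does not exist,
  -- but this is a null set, so it represents the weak derivative.
  have e : iteratedDeriv (n + 1) V =ᵐ[volume] weakDeriv (n + 1) V := by
    filter_upwards [r3.ae_deriv] with x hx
    rw [iteratedDeriv_succ, hx.deriv]
  refine ⟨r1, fun m hm => ?_, ⟨r3.lip, ?_⟩, hb⟩
  · rcases Nat.lt_or_ge n m with h | h
    · obtain rfl : m = n + 1 := by omega
      exact e
    · exact r2 m h
  · filter_upwards [r3.ae_deriv, e] with x hx hx'
    rwa [hx']


/-! ### The differential polynomials of the expansion -/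

open MvPolynomial in
/-- The derivation with `X_m ↦ X_{m+1} + ((m+2)/2) X_m X_1`: the action of `z⁻¹ d/dx` on
`U_m = V^{(m)} z^{-(m+2)}`, where `z = (lam - V)^{1/2}`. -/
noncomputable def symD : Derivation ℂ (MvPolynomial ℕ ℂ) (MvPolynomial ℕ ℂ) :=
  mkDerivation ℂ fun m => X (m + 1) + C (((m : ℂ) + 2) / 2) * (X m * X 1)

theorem symD_C (c : ℂ) : symD (MvPolynomial.C c) = 0 := MvPolynomial.derivation_C _ c

open MvPolynomial in
/-- The polynomials `Q_j` with `lam^{(1-j)/2} ψ'_{j-1} = z Q_j(U)`. -/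
noncomputable def symQ : ℕ → MvPolynomial ℕ ℂ
  | 0 => C Complex.I
  | j + 1 => C (1 / (2 * Complex.I)) *
      (symD (symQ j) - C (1 / 2) * (X 1 * symQ j) - ∑ i : Fin j, symQ (i + 1) * symQ (j - i))
termination_by j => j
decreasing_by all_goals omega

/-- Polynomials without constant term in `X_1, X_2, …` that are homogeneous of weight `j`, where
`X_m` has weight `m`. -/
inductive IsSym : ℕ → MvPolynomial ℕ ℂ → Prop
  | var (m : ℕ) : IsSym (m + 1) (MvPolynomial.X (m + 1))
  | zero (j : ℕ) : IsSym j 0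
  | add {j : ℕ} {P Q : MvPolynomial ℕ ℂ} : IsSym j P → IsSym j Q → IsSym j (P + Q)
  | const_mul {j : ℕ} (c : ℂ) {P : MvPolynomial ℕ ℂ} :
      IsSym j P → IsSym j (MvPolynomial.C c * P)
  | mul {i j : ℕ} {P Q : MvPolynomial ℕ ℂ} : IsSym i P → IsSym j Q → IsSym (i + j) (P * Q)

namespace IsSym

variable {i j : ℕ} {P Q : MvPolynomial ℕ ℂ}

theorem mul' {k : ℕ} (h : i + j = k) (hP : IsSym i P) (hQ : IsSym j Q) : IsSym k (P * Q) :=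
  h ▸ hP.mul hQ

theorem sub (hP : IsSym j P) (hQ : IsSym j Q) : IsSym j (P - Q) := by
  have := hP.add (hQ.const_mul (-1))
  rwa [map_neg, map_one, neg_one_mul, ← sub_eq_add_neg] at this

theorem sum {ι : Type*} (s : Finset ι) {P : ι → MvPolynomial ℕ ℂ}
    (h : ∀ i ∈ s, IsSym j (P i)) : IsSym j (∑ i ∈ s, P i) :=
  Finset.sum_induction P (IsSym j) (fun _ _ => IsSym.add) (IsSym.zero j) h

theorem symD (h : IsSym j P) : IsSym (j + 1) (symD P) := by
  induction h with
  | var m =>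
    rw [JWKB.symD, MvPolynomial.mkDerivation_X]
    exact (var (m + 1)).add ((mul (var m) (var 0)).const_mul _)
  | zero j => rw [map_zero]; exact zero _
  | add _ _ h1 h2 => rw [map_add]; exact h1.add h2
  | const_mul c _ h => rw [Derivation.leibniz]; simpa [symD_C, MvPolynomial.C_eq_smul_one] using h.const_mul c
  | mul hP hQ h1 h2 =>
    rw [Derivation.leibniz, smul_eq_mul, smul_eq_mul]
    exact (hP.mul' (by omega) h2).add (hQ.mul' (by omega) h1)

end IsSym

/-- Every term of the recursion raises the weight by one: the derivation and the factor X_1 do so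
directly, and the products have weight (i + 1) + (j - i). The constant Q_0 has weight zero and lies
outside `IsSym`, which forces the shifted index and the separate treatment of j = 0. -/
theorem symQ_isSym (j : ℕ) : IsSym (j + 1) (symQ (j + 1)) := by
  induction j using Nat.strong_induction_on with
  | _ j ih =>
    rw [symQ]
    refine IsSym.const_mul _ (IsSym.sub (IsSym.sub ?_ (IsSym.const_mul _ ?_)) ?_)
    · rcases j with _ | j
      · rw [symQ, symD_C]; exact IsSym.zero _
      · exact (ih j (by omega)).symD
    · rcases j with _ | j
      · rw [symQ, mul_comm]; exact (IsSym.var 0).const_mul _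
      · exact (IsSym.var 0).mul' (by omega) (ih j (by omega))
    · refine IsSym.sum _ fun i _ => ?_
      obtain ⟨k, hk⟩ : ∃ k, j - i = k + 1 := ⟨j - i - 1, by omega⟩
      rw [hk]
      exact (ih i (by omega)).mul' (by omega) (ih k (by omega))

/-! ### Size of weighted polynomials -/

/-- `P(U) = O(e t^j)` whenever `U_m = O(e t^m)` for `1 ≤ m ≤ M`, uniformly for bounded `e, t`. -/
def SymBound (M j : ℕ) (P : MvPolynomial ℕ ℂ) : Prop :=
  ∀ C : ℝ, ∃ C' : ℝ, 0 ≤ C' ∧ ∀ (U : ℕ → ℂ) (e t : ℝ), 0 ≤ e → e ≤ C → 0 ≤ t → t ≤ C →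
    (∀ m, 1 ≤ m → m ≤ M → ‖U m‖ ≤ C * e * t ^ m) →
    ‖MvPolynomial.eval U P‖ ≤ C' * e * t ^ j

namespace SymBound

variable {M i j : ℕ} {P Q : MvPolynomial ℕ ℂ}

theorem zero : SymBound M j 0 := fun C => ⟨0, le_rfl, fun U e t _ _ _ _ _ => by simp⟩

theorem add (hP : SymBound M j P) (hQ : SymBound M j Q) : SymBound M j (P + Q) := fun C => by
  obtain ⟨A, hA, h1⟩ := hP C
  obtain ⟨B, hB, h2⟩ := hQ C
  refine ⟨A + B, add_nonneg hA hB, fun U e t a b c d h => ?_⟩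
  rw [map_add]
  refine (norm_add_le _ _).trans ((add_le_add (h1 U e t a b c d h) (h2 U e t a b c d h)).trans ?_)
  exact le_of_eq (by ring)

theorem const_mul (a : ℂ) (hP : SymBound M j P) : SymBound M j (MvPolynomial.C a * P) := fun C => by
  obtain ⟨A, hA, h1⟩ := hP C
  refine ⟨‖a‖ * A, by positivity, fun U e t a1 b c d h => ?_⟩
  rw [map_mul, MvPolynomial.eval_C, norm_mul]
  refine (mul_le_mul_of_nonneg_left (h1 U e t a1 b c d h) (norm_nonneg _)).trans ?_
  exact le_of_eq (by ring)

theorem sub (hP : SymBound M j P) (hQ : SymBound M j Q) : SymBound M j (P - Q) := by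
  have := hP.add (hQ.const_mul (-1))
  rwa [map_neg, map_one, neg_one_mul, ← sub_eq_add_neg] at this

/-- The product carries e²; the bound e ≤ C trades one factor for a constant, since only the first
power is needed later. -/
theorem mul (hP : SymBound M i P) (hQ : SymBound M j Q) : SymBound M (i + j) (P * Q) := fun C => by
  obtain ⟨A, hA, h1⟩ := hP C
  obtain ⟨B, hB, h2⟩ := hQ C
  refine ⟨A * B * |C|, by positivity, fun U e t a b c d h => ?_⟩
  rw [map_mul, norm_mul]
  refine (mul_le_mul (h1 U e t a b c d h) (h2 U e t a b c d h) (norm_nonneg _)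
    (by positivity)).trans ?_
  have : A * B * e * t ^ (i + j) * e ≤ A * B * e * t ^ (i + j) * |C| :=
    mul_le_mul_of_nonneg_left (b.trans (le_abs_self C)) (by positivity)
  calc A * e * t ^ i * (B * e * t ^ j) = A * B * e * t ^ (i + j) * e := by ring
    _ ≤ _ := this
    _ = _ := by ring

/-- Surplus powers of t are absorbed by t ≤ C. -/
theorem mono (h : i ≤ j) (hP : SymBound M j P) : SymBound M i P := fun C => by
  obtain ⟨A, hA, h1⟩ := hP C
  refine ⟨A * |C| ^ (j - i), by positivity, fun U e t a b c d h' => ?_⟩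
  refine (h1 U e t a b c d h').trans ?_
  have : t ^ (j - i) ≤ |C| ^ (j - i) := pow_le_pow_left₀ c (d.trans (le_abs_self C)) _
  calc A * e * t ^ j = A * e * t ^ i * t ^ (j - i) := by
        rw [mul_assoc (A * e), ← pow_add]; congr 2; omega
    _ ≤ A * e * t ^ i * |C| ^ (j - i) := mul_le_mul_of_nonneg_left this (by positivity)
    _ = _ := by ring

theorem sum {ι : Type*} (s : Finset ι) {P : ι → MvPolynomial ℕ ℂ}
    (h : ∀ i ∈ s, SymBound M j (P i)) : SymBound M j (∑ i ∈ s, P i) :=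
  Finset.sum_induction P (SymBound M j) (fun _ _ => SymBound.add) SymBound.zero h

end SymBound

theorem IsSym.symBound {M j : ℕ} {P : MvPolynomial ℕ ℂ} (h : IsSym j P) (hj : j ≤ M) :
    SymBound M j P := by
  induction h with
  | var m =>
    exact fun C => ⟨|C|, abs_nonneg _, fun U e t a _ c _ h => by
      rw [MvPolynomial.eval_X]
      exact (h (m + 1) (by omega) hj).trans (by gcongr; exact le_abs_self C)⟩
  | zero j => exact SymBound.zero
  | add _ _ h1 h2 => exact (h1 hj).add (h2 hj)
  | const_mul c _ h => exact (h hj).const_mul c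
  | mul _ _ h1 h2 => exact (h1 (by omega)).mul (h2 (by omega))

theorem IsSym.lipAt {M j : ℕ} {P : MvPolynomial ℕ ℂ} {U : ℕ → ℝ → ℂ} {x : ℝ} (h : IsSym j P)
    (hj : j ≤ M) (hU : ∀ m, 1 ≤ m → m ≤ M → LipAt (U m) x) :
    LipAt (fun y => MvPolynomial.eval (fun m => U m y) P) x := by
  induction h with
  | var m => simpa using hU (m + 1) (by omega) hj
  | zero j => simpa using LipAt.const 0 x
  | add _ _ h1 h2 => simpa using (h1 hj).add (h2 hj)
  | const_mul c _ h => simpa using (LipAt.const c x).mul (h hj)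
  | mul _ _ h1 h2 => simpa using (h1 (by omega)).mul (h2 (by omega))

/-- The hypothesis on U is the defining rule of `symD` on the generators, multiplied by z. Both
operations obey the Leibniz rule, so the identity propagates by induction. -/
theorem IsSym.hasDerivAt {M j : ℕ} {P : MvPolynomial ℕ ℂ} {U : ℕ → ℝ → ℂ} {x : ℝ} {z : ℂ}
    (h : IsSym j P) (hj : j ≤ M)
    (hU : ∀ m, 1 ≤ m → m ≤ M →
      HasDerivAt (U m) (z * (U (m + 1) x + ((m : ℂ) + 2) / 2 * (U m x * U 1 x))) x) :
    HasDerivAt (fun y => MvPolynomial.eval (fun m => U m y) P)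
      (z * MvPolynomial.eval (fun m => U m x) (JWKB.symD P)) x := by
  induction h with
  | var m => simpa [JWKB.symD, MvPolynomial.mkDerivation_X] using hU (m + 1) (by omega) hj
  | zero j => simpa using hasDerivAt_const x (0 : ℂ)
  | add _ _ h1 h2 => simpa [mul_add] using (h1 hj).fun_add (h2 hj)
  | const_mul c _ h =>
    have := (h hj).const_mul c
    rw [Derivation.leibniz, symD_C]
    simp only [map_mul, MvPolynomial.eval_C, smul_eq_mul, mul_zero, add_zero] at this ⊢
    rwa [mul_left_comm] at this
  | mul _ _ h1 h2 =>
    have := (h1 (by omega)).fun_mul (h2 (by omega))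
    rw [Derivation.leibniz]
    simp only [map_mul, map_add, smul_eq_mul] at this ⊢
    refine this.congr_deriv ?_
    ring

/-! ### Cancellation in the remainder polynomial -/

/-- The remainder of the expansion: `Ψ' - Ψ² + V - lam = z² symR_n(U)`. -/
noncomputable def symR (n : ℕ) : MvPolynomial ℕ ℂ :=
  ∑ j ∈ Finset.range (n + 1),
    (symD (symQ j) - MvPolynomial.C (1 / 2) * (MvPolynomial.X 1 * symQ j))
    - (∑ j ∈ Finset.range (n + 1), symQ j) ^ 2 - 1

/-- With b + 1 = j - i, the iterated sum runs over the pairs with (a + 1) + (b + 1) ≤ n. Only the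
pairs of total index at least n + 1 are left of the square. -/
theorem sum_range_mul_sum_range {R : Type*} [CommRing R] (q : ℕ → R) (n : ℕ) :
    (∑ i ∈ Finset.range n, q (i + 1)) ^ 2
      - ∑ j ∈ Finset.range n, ∑ i ∈ Finset.range j, q (i + 1) * q (j - i)
    = ∑ a ∈ Finset.range n, ∑ b ∈ Finset.Ico (n - (a + 1)) n, q (a + 1) * q (b + 1) := by
  have h1 : ∑ j ∈ Finset.range n, ∑ i ∈ Finset.range j, q (i + 1) * q (j - i)
      = ∑ i ∈ Finset.range n, ∑ j ∈ Finset.Ico (i + 1) n, q (i + 1) * q (j - i) := by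
    refine Finset.sum_comm' fun x y => ?_
    simp only [Finset.mem_range, Finset.mem_Ico]
    omega
  have h2 : ∀ i, ∑ j ∈ Finset.Ico (i + 1) n, q (i + 1) * q (j - i)
      = ∑ b ∈ Finset.range (n - (i + 1)), q (i + 1) * q (b + 1) := fun i => by
    rw [Finset.sum_Ico_eq_sum_range]
    refine Finset.sum_congr rfl fun b _ => ?_
    congr 2; omega
  rw [h1, sq, Finset.sum_mul_sum, ← Finset.sum_sub_distrib]
  refine Finset.sum_congr rfl fun a _ => ?_
  rw [h2, Finset.sum_Ico_eq_sub _ (by omega)]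

/-- Split off Q_0 = i in the square: -i² cancels the -1, and the cross terms 2i Q_{j+1} with j < n
are precisely what the recursion prescribes. The derivative of the last coefficient and the
quadratic terms of high weight remain. -/
theorem symR_eq (n : ℕ) : symR n =
    symD (symQ n) - MvPolynomial.C (1 / 2) * (MvPolynomial.X 1 * symQ n)
    - ∑ a ∈ Finset.range n, ∑ b ∈ Finset.Ico (n - (a + 1)) n, symQ (a + 1) * symQ (b + 1) := by
  have h0 : (MvPolynomial.C Complex.I : MvPolynomial ℕ ℂ) ^ 2 = -1 := by
    rw [← map_pow, Complex.I_sq, map_neg, map_one]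
  have hrec : ∀ j, 2 * MvPolynomial.C Complex.I * symQ (j + 1) =
      symD (symQ j) - MvPolynomial.C (1 / 2) * (MvPolynomial.X 1 * symQ j)
        - ∑ i ∈ Finset.range j, symQ (i + 1) * symQ (j - i) := fun j => by
    rw [symQ, ← mul_assoc, Finset.sum_range fun i => symQ (i + 1) * symQ (j - i)]
    have : (2 * MvPolynomial.C Complex.I * MvPolynomial.C (1 / (2 * Complex.I))
        : MvPolynomial ℕ ℂ) = 1 := by
      rw [← map_ofNat (MvPolynomial.C (σ := ℕ) (R := ℂ)) 2, ← map_mul, ← map_mul, ← map_one MvPolynomial.C]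
      congr 1
      field_simp
    rw [this, one_mul]
  rw [symR, ← sum_range_mul_sum_range, Finset.sum_range_succ' symQ, Finset.sum_range_succ]
  have hs : 2 * MvPolynomial.C Complex.I * ∑ i ∈ Finset.range n, symQ (i + 1) =
      ∑ j ∈ Finset.range n,
        (symD (symQ j) - MvPolynomial.C (1 / 2) * (MvPolynomial.X 1 * symQ j))
      - ∑ j ∈ Finset.range n, ∑ i ∈ Finset.range j, symQ (i + 1) * symQ (j - i) := by
    rw [Finset.mul_sum, Finset.sum_congr rfl fun j _ => hrec j, Finset.sum_sub_distrib]
  have hq0 : symQ 0 = MvPolynomial.C Complex.I := by rw [symQ]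
  rw [hq0]
  linear_combination -hs - h0

theorem symR_bound (n : ℕ) : SymBound (n + 1) (n + 1) (symR n) := by
  rw [symR_eq]
  refine SymBound.sub (SymBound.sub ?_ (SymBound.const_mul _ ?_)) ?_
  · rcases n with _ | n
    · rw [symQ, symD_C]; exact SymBound.zero
    · exact (symQ_isSym n).symD.symBound le_rfl
  · rcases n with _ | n
    · rw [symQ, mul_comm]; exact ((IsSym.var 0).symBound le_rfl).const_mul _
    · exact ((IsSym.var 0).mul' (by omega) (symQ_isSym n)).symBound le_rfl
  · refine SymBound.sum _ fun a ha => SymBound.sum _ fun b hb => ?_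
    rw [Finset.mem_range] at ha
    rw [Finset.mem_Ico] at hb
    exact (((symQ_isSym a).symBound (by omega)).mul ((symQ_isSym b).symBound (by omega))).mono
      (by omega)


/-! ### The eikonal and transport functions -/

/-- `z = (lam - V)^{1/2}`. -/
noncomputable def root (V : ℝ → ℂ) (lam x : ℝ) : ℂ := ((lam : ℂ) - V x) ^ (1 / 2 : ℂ)

/-- `U_m = V^{(m)} z^{-(m+2)}`. -/
noncomputable def jet (V : ℝ → ℂ) (lam : ℝ) (m : ℕ) (x : ℝ) : ℂ :=
  iteratedDeriv m V x * (root V lam x)⁻¹ ^ (m + 2)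

/-- `Q_j(U)`. -/
noncomputable def coeff (V : ℝ → ℂ) (lam : ℝ) (j : ℕ) (x : ℝ) : ℂ :=
  MvPolynomial.eval (fun m => jet V lam m x) (symQ j)

/-- The logarithmic derivative of the ansatz, up to the sign. -/
noncomputable def logDer (V : ℝ → ℂ) (n : ℕ) (lam x : ℝ) : ℂ :=
  root V lam x * ∑ j ∈ Finset.range (n + 1), coeff V lam j x

variable {V : ℝ → ℂ} {lam x : ℝ} {n : ℕ}

theorem root_sq (V : ℝ → ℂ) (lam x : ℝ) : root V lam x ^ 2 = lam - V x := by
  simp [root]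

theorem root_ne_zero (h : (lam : ℂ) - V x ∈ Complex.slitPlane) : root V lam x ≠ 0 := fun h0 => by
  have := root_sq V lam x
  rw [h0] at this
  exact Complex.slitPlane_ne_zero h (by rw [← this]; simp)

theorem coeff_zero (V : ℝ → ℂ) (lam x : ℝ) : coeff V lam 0 x = Complex.I := by
  rw [coeff, symQ, MvPolynomial.eval_C]

theorem hasStrictDerivAt_cpow_half {w : ℂ} (hw : w ∈ Complex.slitPlane) :
    HasStrictDerivAt (fun w : ℂ => w ^ (1 / 2 : ℂ)) (1 / (2 * w ^ (1 / 2 : ℂ))) w := by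
  have := (hasStrictDerivAt_id w).cpow_const (c := 1 / 2) hw
  refine this.congr_deriv ?_
  have h0 := Complex.slitPlane_ne_zero hw
  rw [show (1 / 2 - 1 : ℂ) = -(1 / 2) by norm_num, id, Complex.cpow_neg]
  have : w ^ (1 / 2 : ℂ) ≠ 0 := by simp [Complex.cpow_eq_zero_iff, h0]
  field_simp

/-- From z² = λ - V one gets z' = -V'/(2z), rewritten through V' = U_1 z³. -/
theorem hasDerivAt_root (h : (lam : ℂ) - V x ∈ Complex.slitPlane)
    (hV : HasDerivAt V (iteratedDeriv 1 V x) x) :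
    HasDerivAt (root V lam) (-(1 / 2) * (root V lam x) ^ 2 * jet V lam 1 x) x := by
  have h1 : HasDerivAt (fun y => (lam : ℂ) - V y) (-iteratedDeriv 1 V x) x := hV.const_sub _
  have h2 := ((hasStrictDerivAt_cpow_half h).hasDerivAt.hasFDerivAt.restrictScalars
    ℝ).comp_hasDerivAt x h1
  have hz := root_ne_zero h
  refine HasDerivAt.congr_deriv h2 ?_
  rw [jet]
  change -iteratedDeriv 1 V x * (1 / (2 * root V lam x)) = _
  rw [inv_pow]
  field_simp

theorem lipAt_root (h : (lam : ℂ) - V x ∈ Complex.slitPlane) (hV : LipAt V x) :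
    LipAt (root V lam) x := by
  have h1 : LipAt (fun y => (lam : ℂ) - V y) x := by
    simpa [sub_eq_add_neg] using (LipAt.const (lam : ℂ) x).add hV.neg
  exact LipAt.comp_strict (F := fun y => (lam : ℂ) - V y) (hasStrictDerivAt_cpow_half h) h1

/-- As z' = -z² U_1 / 2, differentiating z^{-(m+2)} contributes (m+2)/2 · z U_1; this is the origin
of the coefficient in `symD`. -/
theorem hasDerivAt_jet {m : ℕ} (h : (lam : ℂ) - V x ∈ Complex.slitPlane)
    (hV : HasDerivAt V (iteratedDeriv 1 V x) x)
    (hm : HasDerivAt (iteratedDeriv m V) (iteratedDeriv (m + 1) V x) x) :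
    HasDerivAt (jet V lam m) (root V lam x *
      (jet V lam (m + 1) x + ((m : ℂ) + 2) / 2 * (jet V lam m x * jet V lam 1 x))) x := by
  have hz := root_ne_zero h
  have h1 := hm.fun_mul (((hasDerivAt_root h hV).fun_inv hz).fun_pow (m + 2))
  refine h1.congr_deriv ?_
  simp only [jet]
  push_cast
  simp only [pow_succ]
  field_simp

theorem lipAt_inv_root (h : (lam : ℂ) - V x ∈ Complex.slitPlane) (hV : LipAt V x) :
    LipAt (fun y => (root V lam y)⁻¹) x :=
  LipAt.comp_strict (F := root V lam) (hasStrictDerivAt_inv (root_ne_zero h)) (lipAt_root h hV)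

theorem LipAt.pow {F : ℝ → ℂ} (h : LipAt F x) (k : ℕ) : LipAt (fun y => F y ^ k) x := by
  induction k with
  | zero => simpa using LipAt.const 1 x
  | succ k ih => simpa [pow_succ] using ih.mul h

theorem lipAt_jet {m : ℕ} (h : (lam : ℂ) - V x ∈ Complex.slitPlane) (hV : LipAt V x)
    (hm : LipAt (iteratedDeriv m V) x) : LipAt (jet V lam m) x :=
  hm.mul ((lipAt_inv_root h hV).pow (m + 2))

theorem hasDerivAt_coeff {j : ℕ} (h : (lam : ℂ) - V x ∈ Complex.slitPlane)
    (hV : ∀ m ≤ j, HasDerivAt (iteratedDeriv m V) (iteratedDeriv (m + 1) V x) x) :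
    HasDerivAt (coeff V lam j) (root V lam x *
      MvPolynomial.eval (fun m => jet V lam m x) (symD (symQ j))) x := by
  rcases j with _ | j
  · have e : coeff V lam 0 = fun _ => Complex.I := funext fun y => coeff_zero V lam y
    rw [e, symQ, symD_C, map_zero, mul_zero]
    exact hasDerivAt_const x _
  · have h0 : HasDerivAt V (iteratedDeriv 1 V x) x := by simpa using hV 0 (by omega)
    exact (symQ_isSym j).hasDerivAt (U := jet V lam) le_rfl fun m _ hm =>
      hasDerivAt_jet h h0 (hV m hm)

theorem lipAt_coeff {j : ℕ} (h : (lam : ℂ) - V x ∈ Complex.slitPlane)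
    (hV : ∀ m ≤ j, LipAt (iteratedDeriv m V) x) : LipAt (coeff V lam j) x := by
  rcases j with _ | j
  · have e : coeff V lam 0 = fun _ => Complex.I := funext fun y => coeff_zero V lam y
    rw [e]
    exact LipAt.const _ x
  · have h0 : LipAt V x := by simpa using hV 0 (by omega)
    exact (symQ_isSym j).lipAt (U := jet V lam) le_rfl fun m _ hm => lipAt_jet h h0 (hV m hm)

theorem hasDerivAt_root_mul_coeff {j : ℕ} (h : (lam : ℂ) - V x ∈ Complex.slitPlane)
    (hV : ∀ m ≤ j, HasDerivAt (iteratedDeriv m V) (iteratedDeriv (m + 1) V x) x) :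
    HasDerivAt (fun y => root V lam y * coeff V lam j y) (root V lam x ^ 2 *
      MvPolynomial.eval (fun m => jet V lam m x)
        (symD (symQ j) - MvPolynomial.C (1 / 2) * (MvPolynomial.X 1 * symQ j))) x := by
  have h0 : HasDerivAt V (iteratedDeriv 1 V x) x := by simpa using hV 0 (by omega)
  refine ((hasDerivAt_root h h0).fun_mul (hasDerivAt_coeff h hV)).congr_deriv ?_
  simp only [map_sub, map_mul, MvPolynomial.eval_C, MvPolynomial.eval_X, coeff]
  ring

theorem lipAt_root_mul_coeff {j : ℕ} (h : (lam : ℂ) - V x ∈ Complex.slitPlane)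
    (hV : ∀ m ≤ j, LipAt (iteratedDeriv m V) x) :
    LipAt (fun y => root V lam y * coeff V lam j y) x :=
  (lipAt_root h (by simpa using hV 0 (by omega))).mul (lipAt_coeff h hV)

theorem coeff_succ (V : ℝ → ℂ) (lam : ℝ) (j : ℕ) (x : ℝ) :
    coeff V lam (j + 1) x = 1 / (2 * Complex.I) *
      (MvPolynomial.eval (fun m => jet V lam m x)
        (symD (symQ j) - MvPolynomial.C (1 / 2) * (MvPolynomial.X 1 * symQ j))
      - ∑ i : Fin j, coeff V lam (i + 1) x * coeff V lam (j - i) x) := by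
  simp only [coeff]
  rw [symQ, map_mul, MvPolynomial.eval_C, map_sub, map_sum]
  simp only [map_mul]

theorem isOpen_slitPlane_preimage (hV : Continuous V) (lam : ℝ) :
    IsOpen {x : ℝ | (lam : ℂ) - V x ∈ Complex.slitPlane} :=
  Complex.isOpen_slitPlane.preimage (continuous_const.sub hV)

/-- This links the recursive definition to the polynomials: ψ'_{j-1} = s^{j-1} z Q_j(U) with s = √λ,
by strong induction. The power is written s^j s⁻¹ to include j = 0, and j ≤ n ensures that only
classical derivatives of V occur. -/
theorem psiD_eq (hlam : 0 < lam) (hV : ContDiff ℝ n V) (j : ℕ) :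
    ∀ (x : ℝ), j ≤ n → (lam : ℂ) - V x ∈ Complex.slitPlane →
    psiD V lam j x = ((√lam : ℝ) : ℂ) ^ j * ((√lam : ℝ) : ℂ)⁻¹ * (root V lam x * coeff V lam j x) := by
  have hs : ((√lam : ℝ) : ℂ) ≠ 0 := by
    exact_mod_cast (Real.sqrt_pos.2 hlam).ne'
  have hp0 : ∀ x, psiD V lam 0 x = Complex.I * ((√lam : ℝ) : ℂ)⁻¹ * root V lam x := fun x => by
    rw [psiD, root, Real.rpow_neg hlam.le, ← Real.sqrt_eq_rpow]
    push_cast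
    rfl
  induction j using Nat.strong_induction_on with
  | _ j ih =>
    intro x hj hx
    rcases j with _ | j
    · rw [hp0, coeff_zero]; ring
    · have hz := root_ne_zero hx
      -- Avoiding the cut is an open condition, so the induction hypothesis holds near x and may be
      -- differentiated.
      have hev : psiD V lam j =ᶠ[𝓝 x] fun y => ((√lam : ℝ) : ℂ) ^ j * ((√lam : ℝ) : ℂ)⁻¹ *
          (root V lam y * coeff V lam j y) := by
        filter_upwards [(isOpen_slitPlane_preimage hV.continuous lam).mem_nhds hx] with y hy
        exact ih j (by omega) y (by omega) hy
      have hd := (hasDerivAt_root_mul_coeff (j := j) hx fun m hm => by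
        have := (hV.differentiable_iteratedDeriv m (by exact_mod_cast (by omega : m < n)))
        rw [iteratedDeriv_succ]
        exact (this x).hasDerivAt).const_mul (((√lam : ℝ) : ℂ) ^ j * ((√lam : ℝ) : ℂ)⁻¹)
      rw [psiD]
      beta_reduce
      rw [hev.deriv_eq, hd.deriv, hp0, coeff_succ]
      have hsum : ∑ i : Fin j, psiD V lam (i + 1) x * psiD V lam (j - i) x
          = ((√lam : ℝ) : ℂ) ^ j * ((√lam : ℝ) : ℂ)⁻¹ * root V lam x ^ 2 *
            ∑ i : Fin j, coeff V lam (i + 1) x * coeff V lam (j - i) x := by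
        rw [Finset.mul_sum]
        refine Finset.sum_congr rfl fun i _ => ?_
        have hi := i.2
        rw [ih (i + 1) (by omega) x (by omega) hx, ih (j - i) (by omega) x (by omega) hx]
        have : ((√lam : ℝ) : ℂ) ^ j = ((√lam : ℝ) : ℂ) ^ (i : ℕ) * ((√lam : ℝ) : ℂ) ^ (j - i) := by
          rw [← pow_add]; congr 1; omega
        rw [this, pow_succ]
        field_simp
      rw [hsum]
      have hI := Complex.I_ne_zero
      field_simp
      ring

theorem lipAt_logDer (h : (lam : ℂ) - V x ∈ Complex.slitPlane)
    (hV : ∀ m ≤ n, LipAt (iteratedDeriv m V) x) : LipAt (logDer V n lam) x := by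
  have h0 : LipAt V x := by simpa using hV 0 (by omega)
  have : LipAt (fun y => ∑ j ∈ Finset.range (n + 1), coeff V lam j y) x := by
    have : ∀ s : Finset ℕ, (∀ j ∈ s, j ≤ n) → LipAt (fun y => ∑ j ∈ s, coeff V lam j y) x := by
      intro s
      induction s using Finset.induction_on with
      | empty => intro _; simpa using LipAt.const 0 x
      | insert a s ha ih =>
        intro hs
        simp only [Finset.sum_insert ha]
        exact (lipAt_coeff h fun m hm => hV m (hm.trans (hs a (by simp)))).add
          (ih fun j hj => hs j (by simp [hj]))
    exact this _ fun j hj => by simpa [Nat.lt_succ_iff] using hj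
  exact (lipAt_root h h0).mul this

/-- This perturbed Riccati equation says that exp(-∫Ψ) solves the eigenvalue equation up to the
multiplier z² R_n(U). It is the sum of the derivatives of z Q_j(U), rearranged by the definition of
`symR`. -/
theorem hasDerivAt_logDer (h : (lam : ℂ) - V x ∈ Complex.slitPlane)
    (hV : ∀ m ≤ n, HasDerivAt (iteratedDeriv m V) (iteratedDeriv (m + 1) V x) x) :
    HasDerivAt (logDer V n lam) (logDer V n lam x ^ 2 + lam - V x + root V lam x ^ 2 *
      MvPolynomial.eval (fun m => jet V lam m x) (symR n)) x := by
  have e : logDer V n lam =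
      fun y => ∑ j ∈ Finset.range (n + 1), root V lam y * coeff V lam j y := by
    funext y
    rw [logDer, Finset.mul_sum]
  have h1 : HasDerivAt (fun y => ∑ j ∈ Finset.range (n + 1), root V lam y * coeff V lam j y)
      (∑ j ∈ Finset.range (n + 1), root V lam x ^ 2 *
      MvPolynomial.eval (fun m => jet V lam m x)
        (symD (symQ j) - MvPolynomial.C (1 / 2) * (MvPolynomial.X 1 * symQ j))) x :=
    HasDerivAt.fun_sum fun j hj => hasDerivAt_root_mul_coeff h fun m hm =>
      hV m (hm.trans (Nat.lt_succ_iff.1 (Finset.mem_range.1 hj)))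
  rw [← e] at h1
  refine h1.congr_deriv ?_
  rw [← Finset.mul_sum, ← map_sum, symR, map_sub, map_sub, map_pow, map_sum (MvPolynomial.eval _) symQ]
  rw [logDer, map_one, add_sub_assoc, ← root_sq V lam x]
  simp only [coeff]
  ring

/-- The ansatz as the exponential of a primitive of `logDer`. -/
theorem ansatz_eq (hlam : 0 < lam) (hV : ContDiff ℝ n V)
    (hL : ∀ m ≤ n, ∀ y, LipAt (iteratedDeriv m V) y)
    (hx : ∀ y ∈ uIcc 0 x, (lam : ℂ) - V y ∈ Complex.slitPlane) :
    ansatz V n lam x = Complex.exp (-∫ t in (0 : ℝ)..x, logDer V n lam t) := by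
  have hs : ((√lam : ℝ) : ℂ) ≠ 0 := by
    exact_mod_cast (Real.sqrt_pos.2 hlam).ne'
  have hint : ∀ j ∈ Finset.range (n + 1),
      IntervalIntegrable (fun t => root V lam t * coeff V lam j t) volume 0 x := fun j hj => by
    refine ContinuousOn.intervalIntegrable fun y hy => ?_
    exact (lipAt_root_mul_coeff (hx y hy) fun m hm =>
      hL m (hm.trans (Nat.lt_succ_iff.1 (Finset.mem_range.1 hj))) y).continuousAt.continuousWithinAt
  rw [ansatz]
  congr 2
  simp only [logDer, Finset.mul_sum]
  rw [intervalIntegral.integral_finsetSum hint]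
  refine Finset.sum_congr rfl fun j hj => ?_
  rw [← intervalIntegral.integral_const_mul]
  refine intervalIntegral.integral_congr fun t ht => ?_
  have hjn := Nat.lt_succ_iff.1 (Finset.mem_range.1 hj)
  rw [psiD_eq hlam hV j t hjn (hx t ht)]
  have : ((lam ^ ((1 - (j : ℝ)) / 2) : ℝ) : ℂ) = ((√lam : ℝ) : ℂ) * (((√lam : ℝ) : ℂ) ^ j)⁻¹ := by
    rw [← Complex.ofReal_pow, ← Complex.ofReal_inv, ← Complex.ofReal_mul]
    congr 1
    rw [Real.sqrt_eq_rpow, ← Real.rpow_natCast, ← Real.rpow_mul hlam.le, ← Real.rpow_neg hlam.le,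
      ← Real.rpow_add hlam]
    congr 1; ring
  rw [this]
  field_simp


/-! ### Elementary facts on the two ends of the line -/

theorem one_le_jap (x : ℝ) : 1 ≤ jap x := by
  rw [jap, Real.one_le_sqrt]
  nlinarith [sq_nonneg x]

theorem jap_pos (x : ℝ) : 0 < jap x := zero_lt_one.trans_le (one_le_jap x)

theorem le_jap (x : ℝ) : x ≤ jap x :=
  Real.le_sqrt_of_sq_le (by linarith)

theorem jap_le_two_mul {x : ℝ} (hx : 1 ≤ x) : jap x ≤ 2 * x := by
  rw [jap, Real.sqrt_le_left (by linarith)]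
  nlinarith

theorem continuous_jap : Continuous jap := by
  unfold jap; fun_prop

theorem jap_mono {x y : ℝ} (hx : 0 ≤ x) (h : x ≤ y) : jap x ≤ jap y :=
  Real.sqrt_le_sqrt (by nlinarith)

theorem continuous_jap_rpow (a : ℝ) : Continuous fun x => jap x ^ a :=
  continuous_jap.rpow_const fun x => Or.inl (jap_pos x).ne'

theorem Side.sgn_mul_sgn (s : Side) : s.sgn * s.sgn = 1 := by
  cases s <;> simp [Side.sgn]

theorem Side.abs_sgn (s : Side) : |s.sgn| = 1 := by
  cases s <;> simp [Side.sgn]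

theorem Side.sgn_ne_zero (s : Side) : s.sgn ≠ 0 := by
  cases s <;> simp [Side.sgn]

theorem Side.sgn_mul_cancel (s : Side) (x : ℝ) : s.sgn * (s.sgn * x) = x := by
  rw [← mul_assoc, s.sgn_mul_sgn, one_mul]

theorem jap_sgn_mul (s : Side) (t : ℝ) : jap (s.sgn * t) = jap t := by
  rw [jap, jap, mul_pow, ← sq_abs s.sgn, s.abs_sgn, one_pow, one_mul]

theorem Side.tendsto_sgn_mul (s : Side) : Tendsto (fun t => s.sgn * t) atTop s.atInfty := by
  cases s
  · simpa [Side.sgn, Side.atInfty] using tendsto_neg_atTop_atBot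
  · simp only [Side.sgn, Side.atInfty, one_mul]
    exact tendsto_id

theorem Side.mem_atInfty (s : Side) {S : Set ℝ} (h : S ∈ s.atInfty) :
    ∃ r : ℝ, 1 ≤ r ∧ ∀ x, r ≤ s.sgn * x → x ∈ S := by
  have h1 : ∀ᶠ t in atTop, s.sgn * t ∈ S := s.tendsto_sgn_mul h
  obtain ⟨r, hr⟩ := eventually_atTop.1 h1
  refine ⟨max r 1, le_max_right _ _, fun x hx => ?_⟩
  have := hr (s.sgn * x) ((le_max_left _ _).trans hx)
  rwa [s.sgn_mul_cancel] at this

theorem Side.mem_ae_inf_atInfty (s : Side) {p : ℝ → Prop}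
    (h : ∀ᶠ x in ae volume ⊓ s.atInfty, p x) :
    ∃ r : ℝ, 1 ≤ r ∧ ∀ᵐ x, r ≤ s.sgn * x → p x := by
  obtain ⟨A, hA, S, hS, hAS⟩ := mem_inf_iff_superset.1 h
  obtain ⟨r, hr, hrS⟩ := s.mem_atInfty hS
  refine ⟨r, hr, ?_⟩
  filter_upwards [hA] with x hx hx'
  exact hAS ⟨hx, hrS x hx'⟩

theorem Side.ae_comp_sgn_mul (s : Side) {p : ℝ → Prop} (h : ∀ᵐ x, p x) :
    ∀ᵐ t, p (s.sgn * t) := by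
  cases s
  · have := (Measure.measurePreserving_neg (volume : Measure ℝ)).quasiMeasurePreserving.ae h
    simpa [Side.sgn] using this
  · simpa [Side.sgn] using h

theorem Side.integral_comp (s : Side) {E : Type*} [NormedAddCommGroup E] [NormedSpace ℝ E]
    (f : ℝ → E) (a b : ℝ) :
    ∫ x in (s.sgn * a)..(s.sgn * b), f x = s.sgn • ∫ t in a..b, f (s.sgn * t) := by
  rw [intervalIntegral.integral_comp_mul_left (fun x => f x) s.sgn_ne_zero, smul_smul,
    mul_inv_cancel₀ s.sgn_ne_zero, one_smul]

/-! ### Gronwall's inequality -/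

/-- The majorant w on the right of `H` satisfies w' ≤ C p w, so w exp(-C∫p) is nonincreasing. -/
theorem gronwall_integral {h p : ℝ → ℝ} (hh : Continuous h) (hp : Continuous p) {C x y : ℝ}
    (hC : 0 ≤ C) (hp0 : ∀ t, 0 ≤ p t) (hxy : x ≤ y)
    (H : ∀ t ∈ Icc x y, h t ≤ h x + C * ∫ r in x..t, h r * p r) :
    h y ≤ h x * Real.exp (C * ∫ r in x..y, p r) := by
  set w : ℝ → ℝ := fun t => h x + C * ∫ r in x..t, h r * p r with hw
  have dw : ∀ t, HasDerivAt w (C * (h t * p t)) t := fun t =>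
    (((hh.mul hp).integral_hasStrictDerivAt x t).hasDerivAt.const_mul C).const_add _
  have dP : ∀ t, HasDerivAt (fun t => -(C * ∫ r in x..t, p r)) (-(C * p t)) t := fun t =>
    ((hp.integral_hasStrictDerivAt x t).hasDerivAt.const_mul C).neg
  have dG : ∀ t, HasDerivAt (fun t => w t * Real.exp (-(C * ∫ r in x..t, p r)))
      (C * (h t * p t) * Real.exp (-(C * ∫ r in x..t, p r))
        + w t * (Real.exp (-(C * ∫ r in x..t, p r)) * -(C * p t))) t := fun t =>
    (dw t).fun_mul (dP t).exp
  have anti : AntitoneOn (fun t => w t * Real.exp (-(C * ∫ r in x..t, p r))) (Icc x y) := by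
    refine antitoneOn_of_deriv_nonpos (convex_Icc x y)
      (fun t _ => (dG t).continuousAt.continuousWithinAt)
      (fun t _ => (dG t).differentiableAt.differentiableWithinAt) fun t ht => ?_
    rw [interior_Icc] at ht
    rw [(dG t).deriv]
    have h1 := H t ⟨ht.1.le, ht.2.le⟩
    have h2 : C * (h t * p t) * Real.exp (-(C * ∫ r in x..t, p r))
        + w t * (Real.exp (-(C * ∫ r in x..t, p r)) * -(C * p t))
        = -((C * p t * Real.exp (-(C * ∫ r in x..t, p r))) * (w t - h t)) := by ring
    rw [h2, neg_nonpos]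
    exact mul_nonneg (mul_nonneg (mul_nonneg hC (hp0 t)) (Real.exp_pos _).le) (by linarith)
  have h3 := anti (left_mem_Icc.2 hxy) (right_mem_Icc.2 hxy) hxy
  simp only [intervalIntegral.integral_same, mul_zero, neg_zero, Real.exp_zero, mul_one] at h3
  have h4 : w x = h x := by simp [hw]
  rw [h4, Real.exp_neg, ← div_eq_mul_inv, div_le_iff₀ (Real.exp_pos _)] at h3
  exact (H y (right_mem_Icc.2 hxy)).trans h3

/-! ### Consequences of admissibility at one end -/

section Admissible

variable {n : ℕ} {V : ℝ → ℂ} {ν : Side → ℝ} {ε₁ : ℝ}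

theorem Admissible.hasLipDeriv (hV : Admissible (n + 1) V ν ε₁) {m : ℕ} (hm : m ≤ n) :
    HasLipDeriv (iteratedDeriv m V) (iteratedDeriv (m + 1) V) := by
  obtain ⟨h1, -, h3, -⟩ := hV.sobolev.regularity hV.continuous
  rcases hm.lt_or_eq with h | rfl
  · have : ContDiff ℝ 1 (iteratedDeriv m V) := by
      rw [iteratedDeriv_eq_iterate]
      exact ContDiff.iterate_deriv' 1 m (h1.of_le (by exact_mod_cast (by omega : 1 + m ≤ n)))
    rw [iteratedDeriv_succ]
    exact HasLipDeriv.of_contDiff this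
  · exact h3

theorem Admissible.im_lower (hV : Admissible (n + 1) V ν ε₁) (s : Side) :
    ∃ c > 0, ∃ r ≥ (1 : ℝ), ∀ t ≥ r, c ≤ s.sgn * (V (s.sgn * t)).im := by
  have key : ∃ c : ℝ, 0 < c ∧ ∀ᶠ x in s.atInfty, c ≤ s.sgn * (V x).im := by
    cases s
    · obtain ⟨q, hq1, hq2⟩ := EReal.lt_iff_exists_real_btwn.1 hV.im_minus
      refine ⟨-q, by simpa using (by exact_mod_cast hq2 : q < 0), ?_⟩
      filter_upwards [eventually_lt_of_limsup_lt hq1] with x hx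
      have : (V x).im < q := by exact_mod_cast hx
      simp only [Side.sgn]; linarith
    · obtain ⟨q, hq1, hq2⟩ := EReal.lt_iff_exists_real_btwn.1 hV.im_plus
      refine ⟨q, by exact_mod_cast hq1, ?_⟩
      filter_upwards [eventually_lt_of_lt_liminf hq2] with x hx
      have : q < (V x).im := by exact_mod_cast hx
      simp only [Side.sgn]; linarith
  obtain ⟨c, hc, h⟩ := key
  obtain ⟨r, hr, hr'⟩ := s.mem_atInfty h
  refine ⟨c, hc, r, hr, fun t ht => hr' _ ?_⟩
  rwa [s.sgn_mul_cancel]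

/-- Condition (b) acts only near infinity, and V may vanish on a compact set, where its weak
derivatives are merely bounded. Replacing |V| by 1 + |V| lets one constant serve the whole half-line
and all orders. -/
theorem Admissible.norm_iteratedDeriv_le (hV : Admissible (n + 1) V ν ε₁) (s : Side) :
    ∃ C > 0, ∀ m ≤ n + 1, ∀ᵐ t, 0 ≤ t →
      ‖iteratedDeriv m V (s.sgn * t)‖ ≤ C * ((1 + ‖V (s.sgn * t)‖) * jap t ^ (m * ν s)) := by
  have each : ∀ m ≤ n + 1, ∃ C > 0, ∀ᵐ t, 0 ≤ t →
      ‖iteratedDeriv m V (s.sgn * t)‖ ≤ C * ((1 + ‖V (s.sgn * t)‖) * jap t ^ (m * ν s)) := by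
    intro m hm
    rcases Nat.eq_zero_or_pos m with rfl | hpos
    · refine ⟨1, one_pos, ae_of_all _ fun t _ => ?_⟩
      simp
    obtain ⟨-, h2, -, hb⟩ := hV.sobolev.regularity hV.continuous
    obtain ⟨C, hC⟩ := (hV.norm_deriv s m (Finset.mem_Icc.2 ⟨hpos, hm⟩)).bound
    obtain ⟨r, hr, hr'⟩ := s.mem_ae_inf_atInfty hC
    have hb := hb m hm (Icc (-r) r) isCompact_Icc
    obtain ⟨M, hM⟩ : ∃ M : ℝ, ∀ᵐ x, x ∈ Icc (-r) r → ‖weakDeriv m V x‖ ≤ M := by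
      refine ⟨(eLpNorm (weakDeriv m V) ⊤ (volume.restrict (Icc (-r) r))).toReal, ?_⟩
      rw [← ae_restrict_iff' measurableSet_Icc]
      have h1 := ae_le_eLpNormEssSup (f := weakDeriv m V) (μ := volume.restrict (Icc (-r) r))
      filter_upwards [h1] with t ht
      rw [← eLpNorm_exponent_top] at ht
      rw [← toReal_enorm]
      exact ENNReal.toReal_mono hb.2.ne ht
    -- Bounding the inverse weight on the compact part bounds the weight from below there.
    obtain ⟨K, hK⟩ := isCompact_Icc.exists_bound_of_continuousOn (s := Icc (-r) r)
      (continuous_jap_rpow (-(m * ν s))).continuousOn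
    refine ⟨|C| + |M| * |K| + 1, by positivity, ?_⟩
    have h4 := s.ae_comp_sgn_mul (hr'.and (hM.and (h2 m hm)))
    filter_upwards [h4] with t ht h0
    obtain ⟨ht1, ht2, ht3⟩ := ht
    rw [s.sgn_mul_cancel] at ht1
    rw [ht3]
    have hj : 0 < jap t ^ ((m : ℝ) * ν s) := Real.rpow_pos_of_pos (jap_pos t) _
    rcases le_total r t with h | h
    · have h5 := ht1 h
      rw [jap_sgn_mul, Real.norm_of_nonneg (mul_nonneg (norm_nonneg _) hj.le)] at h5
      refine h5.trans ?_
      have : C ≤ |C| + |M| * |K| + 1 := by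
        have := le_abs_self C
        have : 0 ≤ |M| * |K| := by positivity
        linarith
      have h6 : 0 ≤ ‖V (s.sgn * t)‖ * jap t ^ ((m : ℝ) * ν s) := by positivity
      have h7 : ‖V (s.sgn * t)‖ * jap t ^ ((m : ℝ) * ν s)
          ≤ (1 + ‖V (s.sgn * t)‖) * jap t ^ ((m : ℝ) * ν s) := by
        gcongr; linarith
      exact (mul_le_mul_of_nonneg_right this h6).trans
        (mul_le_mul_of_nonneg_left h7 (by positivity))
    · have hmem : s.sgn * t ∈ Icc (-r) r := by
        rw [mem_Icc, ← abs_le, abs_mul, s.abs_sgn, one_mul, abs_of_nonneg h0]; exact h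
      have h5 := hK t ⟨by linarith, h⟩
      rw [Real.rpow_neg (jap_pos t).le, norm_inv, Real.norm_of_nonneg hj.le] at h5
      have h6 : 1 ≤ |K| * jap t ^ ((m : ℝ) * ν s) := by
        have := (h5.trans (le_abs_self K))
        rwa [inv_le_iff_one_le_mul₀ hj] at this
      calc ‖weakDeriv m V (s.sgn * t)‖ ≤ |M| * 1 := by
            rw [mul_one]; exact (ht2 hmem).trans (le_abs_self M)
        _ ≤ |M| * (|K| * jap t ^ ((m : ℝ) * ν s)) := by gcongr
        _ = (|M| * |K|) * (1 * jap t ^ ((m : ℝ) * ν s)) := by ring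
        _ ≤ (|C| + |M| * |K| + 1) * ((1 + ‖V (s.sgn * t)‖) * jap t ^ ((m : ℝ) * ν s)) := by
            gcongr
            · have := abs_nonneg C; linarith
            · have := norm_nonneg (V (s.sgn * t)); linarith
  choose! C hC hCb using each
  refine ⟨∑ m ∈ Finset.range (n + 2), C m, ?_, fun m hm => ?_⟩
  · exact Finset.sum_pos (fun m hm => hC m (by simpa [Nat.lt_succ_iff] using hm)) ⟨0, by simp⟩
  · filter_upwards [hCb m hm] with t ht h0
    refine (ht h0).trans (mul_le_mul_of_nonneg_right ?_ ?_)
    · exact Finset.single_le_sum (f := C)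
        (fun m hm => (hC m (by simpa [Nat.lt_succ_iff] using hm)).le)
        (by simp; omega)
    · have := Real.rpow_pos_of_pos (jap_pos t) ((m : ℝ) * ν s)
      positivity

theorem Admissible.sub_eq_integral (hV : Admissible (n + 1) V ν ε₁) (s : Side) (x y : ℝ) :
    IntervalIntegrable (fun t => iteratedDeriv 1 V (s.sgn * t)) volume x y ∧
    V (s.sgn * y) - V (s.sgn * x) = s.sgn • ∫ t in x..y, iteratedDeriv 1 V (s.sgn * t) := by
  have h := (hV.hasLipDeriv (Nat.zero_le n))
  rw [iteratedDeriv_zero] at h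
  have h1 := h.intervalIntegrable_and_integral (s.sgn * x) (s.sgn * y)
  refine ⟨?_, ?_⟩
  · have := h1.1.comp_mul_left (c := s.sgn)
    rwa [mul_div_cancel_left₀ _ s.sgn_ne_zero, mul_div_cancel_left₀ _ s.sgn_ne_zero] at this
  · rw [← s.integral_comp, h1.2]

/-- Condition (b) with m = 1 is a linear differential inequality for |V|; its integral form makes
sense for the locally Lipschitz V. -/
theorem Admissible.norm_gronwall (hV : Admissible (n + 1) V ν ε₁) (s : Side) :
    ∃ C ≥ 0, ∃ r ≥ (1 : ℝ), ∀ x y, r ≤ x → x ≤ y →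
      ‖V (s.sgn * y)‖ ≤ ‖V (s.sgn * x)‖ * Real.exp (C * ∫ t in x..y, jap t ^ ν s) := by
  obtain ⟨-, h2, -, -⟩ := hV.sobolev.regularity hV.continuous
  obtain ⟨C, hC⟩ := (hV.norm_deriv s 1 (Finset.mem_Icc.2 ⟨le_rfl, by omega⟩)).bound
  obtain ⟨r, hr, hr'⟩ := s.mem_ae_inf_atInfty hC
  refine ⟨|C|, abs_nonneg _, r, hr, fun x y hx hxy => ?_⟩
  have hcont : Continuous fun t => ‖V (s.sgn * t)‖ :=
    (hV.continuous.comp (continuous_const.mul continuous_id)).norm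
  refine gronwall_integral hcont (continuous_jap_rpow (ν s)) (abs_nonneg _)
    (fun t => (Real.rpow_pos_of_pos (jap_pos t) _).le) hxy fun t ht => ?_
  obtain ⟨hi, he⟩ := hV.sub_eq_integral s x t
  have h3 : ‖V (s.sgn * t) - V (s.sgn * x)‖
      ≤ |C| * ∫ r in x..t, ‖V (s.sgn * r)‖ * jap r ^ ν s := by
    rw [he, norm_smul, Real.norm_eq_abs, s.abs_sgn, one_mul, ← intervalIntegral.integral_const_mul]
    refine intervalIntegral.norm_integral_le_of_norm_le ht.1 ?_
      (Continuous.intervalIntegrable (continuous_const.mul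
        (hcont.mul (continuous_jap_rpow (ν s)))) _ _)
    filter_upwards [s.ae_comp_sgn_mul (hr'.and (h2 1 (by omega)))] with a ha hmem
    have h4 := ha.1 (by rw [s.sgn_mul_cancel]; exact hx.trans hmem.1.le)
    rw [ha.2]
    rw [jap_sgn_mul, Nat.cast_one, one_mul, Real.norm_of_nonneg
      (mul_nonneg (norm_nonneg _) (Real.rpow_pos_of_pos (jap_pos a) _).le)] at h4
    refine h4.trans (mul_le_mul_of_nonneg_right (le_abs_self C)
      (mul_nonneg (norm_nonneg _) (Real.rpow_pos_of_pos (jap_pos a) _).le))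
  have h5 := norm_sub_norm_le (V (s.sgn * t)) (V (s.sgn * x))
  linarith

theorem Admissible.im_gronwall (hV : Admissible (n + 1) V ν ε₁) (s : Side) :
    ∃ C ≥ 0, ∃ r ≥ (1 : ℝ), ∀ x y, r ≤ x → x ≤ y →
      |(V (s.sgn * y)).im| ≤ |(V (s.sgn * x)).im| * Real.exp (C * ∫ t in x..y, jap t ^ ν s) := by
  obtain ⟨-, h2, -, -⟩ := hV.sobolev.regularity hV.continuous
  obtain ⟨C, hC⟩ := (hV.im_deriv s 1 (Finset.mem_Icc.2 ⟨le_rfl, by omega⟩)).bound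
  obtain ⟨r, hr, hr'⟩ := s.mem_ae_inf_atInfty hC
  refine ⟨|C|, abs_nonneg _, r, hr, fun x y hx hxy => ?_⟩
  have hcont : Continuous fun t => |(V (s.sgn * t)).im| :=
    (Complex.continuous_im.comp (hV.continuous.comp (continuous_const.mul continuous_id))).abs
  refine gronwall_integral hcont (continuous_jap_rpow (ν s)) (abs_nonneg _)
    (fun t => (Real.rpow_pos_of_pos (jap_pos t) _).le) hxy fun t ht => ?_
  obtain ⟨hi, he⟩ := hV.sub_eq_integral s x t
  have h3 : |(V (s.sgn * t)).im - (V (s.sgn * x)).im|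
      ≤ |C| * ∫ r in x..t, |(V (s.sgn * r)).im| * jap r ^ ν s := by
    have e := congrArg Complex.im he
    rw [Complex.sub_im, Complex.smul_im] at e
    have e2 : (∫ t in x..t, iteratedDeriv 1 V (s.sgn * t)).im
        = ∫ t in x..t, (iteratedDeriv 1 V (s.sgn * t)).im :=
      (Complex.imCLM.intervalIntegral_comp_comm hi).symm
    rw [e, e2, smul_eq_mul, abs_mul, s.abs_sgn, one_mul, ← intervalIntegral.integral_const_mul]
    rw [← Real.norm_eq_abs]
    refine intervalIntegral.norm_integral_le_of_norm_le ht.1 ?_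
      (Continuous.intervalIntegrable (continuous_const.mul
        (hcont.mul (continuous_jap_rpow (ν s)))) _ _)
    filter_upwards [s.ae_comp_sgn_mul (hr'.and (h2 1 (by omega)))] with a ha hmem
    have h4 := ha.1 (by rw [s.sgn_mul_cancel]; exact hx.trans hmem.1.le)
    rw [ha.2]
    rw [jap_sgn_mul, Nat.cast_one, one_mul, Real.norm_of_nonneg
      (mul_nonneg (abs_nonneg _) (Real.rpow_pos_of_pos (jap_pos a) _).le)] at h4
    refine h4.trans (mul_le_mul_of_nonneg_right (le_abs_self C)
      (mul_nonneg (abs_nonneg _) (Real.rpow_pos_of_pos (jap_pos a) _).le))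
  have h5 := abs_sub_abs_le_abs_sub (V (s.sgn * t)).im (V (s.sgn * x)).im
  linarith

end Admissible

/-! ### Control of the potential on `J_±` -/

open Classical in
/-- The exponent in the decay rate of the cut-off error. -/
noncomputable def rate (V : ℝ → ℂ) (ν : Side → ℝ) (ε₁ ε₂ : ℝ) (s : Side) (lam : ℝ) : ℝ :=
  if BoundedAt s V then lam ^ (ε₂ / 2) else delta V ν ε₁ ε₂ lam s ^ (ν s + 1 + ε₁)

open Classical in
/-- The bound for the contribution of the transport remainder at one end. -/
noncomputable def errBound (n : ℕ) (V : ℝ → ℂ) (ν : Side → ℝ) (ε₁ ε₂ : ℝ) (s : Side)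
    (lam : ℝ) : ℝ :=
  if BoundedAt s V then
    if ν s < 0 then lam ^ (-((n : ℝ) + 1) / 2)
    else lam ^ (-(((n : ℝ) + 1) / 2) * (1 - (1 + ε₂) * ν s))
  else
    if ν s < 0 then lam ^ (-((n : ℝ) + 1) / 2) *
      supWeighted V s (delta V ν ε₁ ε₂ lam s) (((n : ℝ) + 1) * ν s)
    else delta V ν ε₁ ε₂ lam s ^ (((n : ℝ) + 1) * ν s) * lam ^ ((1 - (n : ℝ)) / 2)

/-- Bounds at one end of the line that suffice for the construction of the pseudomode:
`W` is the potential as a function of the distance to the origin, `δ, Δ` are the parameters of the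
cut-off, `E` is the decay rate and `B` the bound of the remainder. -/
structure SideControl (n : ℕ) (W : ℝ → ℂ) (σ ν : ℝ) (δ Δ E B : ℝ → ℝ) : Prop where
  tendsto_delta : Tendsto δ atTop atTop
  tendsto_rate : Tendsto E atTop atTop
  width_pos : ∀ᶠ lam in atTop, 0 < Δ lam
  width_le : ∀ᶠ lam in atTop, Δ lam ≤ δ lam / 4
  bound : ∃ C > 0, ∃ θ ≥ 0, θ < 1 / 2 ∧ ∀ᶠ lam in atTop, ∀ t ∈ Icc 0 (δ lam),
    ‖W t‖ ≤ C * lam ∧ (W t).re ≤ lam / 2 ∧ jap t ^ ν ≤ C * lam ^ (θ : ℝ)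
  small : ∀ η > 0, ∃ r ≥ 0, ∀ᶠ lam in atTop, ∀ t ∈ Icc r (δ lam),
    (1 + ‖W t‖) * jap t ^ ν ≤ η * √lam * |(W t).im|
  im_pos : ∃ c > 0, ∃ r ≥ 0, ∀ t ≥ r, c ≤ σ * (W t).im
  rpow_le : ∀ η > 0, ∀ a : ℝ, ∀ᶠ lam in atTop, lam ^ a ≤ Real.exp (η * E lam)
  delta_le : ∀ η > 0, ∀ᶠ lam in atTop, δ lam ≤ Real.exp (η * E lam)
  width_inv_le : ∀ η > 0, ∀ᶠ lam in atTop, (Δ lam)⁻¹ ≤ Real.exp (η * E lam)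
  decay : ∃ c > 0, ∀ᶠ lam in atTop, ∀ t ∈ Icc (δ lam - Δ lam) (δ lam),
    c * E lam * √lam ≤ ∫ r in (0 : ℝ)..t, |(W r).im|
  err : ∃ C > 0, ∀ᶠ lam in atTop, ∀ t ∈ Ioo 0 (δ lam),
    lam ^ (-((n : ℝ) + 1) / 2) * ((1 + ‖W t‖) * jap t ^ (((n : ℝ) + 1) * ν)) ≤ C * B lam
  err_lower : ∃ C > 0, ∀ᶠ lam in atTop, lam ^ (-((n : ℝ) + 1) / 2) ≤ C * B lam

theorem eventually_rpow_le_exp (a : ℝ) {b η : ℝ} (hb : 0 < b) (hη : 0 < η) (K : ℝ) :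
    ∀ᶠ x : ℝ in atTop, K * x ^ a ≤ Real.exp (η * x ^ b) := by
  have h1 := (isLittleO_rpow_exp_pos_mul_atTop (a / b) hη).comp_tendsto (tendsto_rpow_atTop hb)
  have h2 := (h1.const_mul_left K).bound one_pos
  filter_upwards [h2, eventually_gt_atTop 0] with x hx hx0
  simp only [Function.comp_apply, one_mul, Real.norm_eq_abs, Real.abs_exp] at hx
  rw [← Real.rpow_mul hx0.le, mul_div_cancel₀ _ hb.ne'] at hx
  exact (le_abs_self _).trans hx

theorem eventually_mul_rpow_le {a b : ℝ} (hab : a < b) (K η : ℝ) (hη : 0 < η) :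
    ∀ᶠ x : ℝ in atTop, K * x ^ a ≤ η * x ^ b := by
  filter_upwards [(tendsto_rpow_atTop (sub_pos.2 hab)).eventually_ge_atTop (K / η),
    eventually_gt_atTop 0] with x hx hx0
  have e : x ^ b = x ^ (b - a) * x ^ a := by rw [← Real.rpow_add hx0]; congr 1; ring
  rw [div_le_iff₀' hη] at hx
  rw [e, ← mul_assoc]
  exact mul_le_mul_of_nonneg_right hx (Real.rpow_nonneg hx0.le a)

section

variable {n : ℕ} {V : ℝ → ℂ} {ν : Side → ℝ} {ε₁ ε₂ : ℝ}

theorem jap_rpow_le_delta {x δ ν : ℝ} (hδ : 1 ≤ δ) (h0 : 0 ≤ x) (hx : x ≤ δ) (hν : 0 ≤ ν) :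
    jap x ^ ν ≤ 2 ^ ν * δ ^ ν := by
  rw [← Real.mul_rpow (by norm_num) (by linarith)]
  exact Real.rpow_le_rpow (jap_pos x).le ((jap_mono h0 hx).trans (jap_le_two_mul hδ)) hν

theorem jap_rpow_le_one {x ν : ℝ} (hν : ν ≤ 0) : jap x ^ ν ≤ 1 :=
  Real.rpow_le_one_of_one_le_of_nonpos (one_le_jap x) hν

theorem BoundedAt.exists_bound {s : Side} (hV : Continuous V) (hb : BoundedAt s V) :
    ∃ M > 0, ∀ t ≥ 0, ‖V (s.sgn * t)‖ ≤ M := by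
  obtain ⟨C, hC⟩ := hb
  obtain ⟨r, hr, hrC⟩ := s.mem_atInfty hC
  obtain ⟨K, hK⟩ := isCompact_Icc.exists_bound_of_continuousOn (s := Icc 0 r)
    (f := fun t => V (s.sgn * t)) (hV.comp (continuous_const.mul continuous_id)).continuousOn
  refine ⟨|C| + |K| + 1, by positivity, fun t ht => ?_⟩
  rcases le_total t r with h | h
  · have := hK t ⟨ht, h⟩
    linarith [le_abs_self K, abs_nonneg C]
  · have := hrC (s.sgn * t) (by rwa [s.sgn_mul_cancel])
    simp only [mem_ofPred_eq] at this
    linarith [le_abs_self C, abs_nonneg K]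

theorem intervalIntegral_le_of_le {f : ℝ → ℝ} (hf : Continuous f) (h0 : ∀ x, 0 ≤ f x)
    {a b t c : ℝ} (ha : 0 ≤ a) (hab : a ≤ b) (hbt : b ≤ t) (hc : ∀ x ∈ Icc a b, c ≤ f x) :
    c * (b - a) ≤ ∫ x in (0 : ℝ)..t, f x := by
  have hi : ∀ a b, IntervalIntegrable f volume a b := fun a b => hf.intervalIntegrable a b
  have h1 : ∫ x in a..b, c ≤ ∫ x in a..b, f x :=
    intervalIntegral.integral_mono_on hab (by simp) (hi a b) hc
  have h2 : 0 ≤ ∫ x in (0 : ℝ)..a, f x := intervalIntegral.integral_nonneg ha fun x _ => h0 x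
  have h3 : 0 ≤ ∫ x in b..t, f x := intervalIntegral.integral_nonneg hbt fun x _ => h0 x
  rw [intervalIntegral.integral_const, smul_eq_mul] at h1
  rw [← intervalIntegral.integral_add_adjacent_intervals (hi 0 a) (hi a t),
    ← intervalIntegral.integral_add_adjacent_intervals (hi a b) (hi b t)]
  linarith

theorem Admissible.sideControl_of_bounded (hV : Admissible (n + 1) V ν ε₁) {s : Side}
    (hb : BoundedAt s V) (hε : 0 < ε₂ ∧ ε₂ < 1 - ν s) :
    SideControl n (fun t => V (s.sgn * t)) s.sgn (ν s)
      (fun lam => delta V ν ε₁ ε₂ lam s) (fun lam => width V ν ε₁ ε₂ lam s)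
      (rate V ν ε₁ ε₂ s) (errBound n V ν ε₁ ε₂ s) := by
  obtain ⟨hε0, hε1⟩ := hε
  have hδ : (fun lam => delta V ν ε₁ ε₂ lam s) = fun lam => lam ^ ((1 + ε₂) / 2) := by
    funext lam; rw [delta, if_pos hb]
  have hΔ : (fun lam => width V ν ε₁ ε₂ lam s) = fun lam => lam ^ ((1 + ε₂) / 2) / 4 := by
    funext lam; rw [width, if_pos hb, delta, if_pos hb]
  have hE : rate V ν ε₁ ε₂ s = fun lam => lam ^ (ε₂ / 2) := by
    funext lam; rw [rate, if_pos hb]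
  rw [hδ, hΔ, hE]
  obtain ⟨M, hM0, hM⟩ := hb.exists_bound hV.continuous
  obtain ⟨c, hc, r, hr, hcr⟩ := hV.im_lower s
  have him : ∀ t ≥ r, c ≤ |(V (s.sgn * t)).im| := fun t ht => by
    refine (hcr t ht).trans ((le_abs_self _).trans ?_)
    rw [abs_mul, s.abs_sgn, one_mul]
  have hpos : 0 < (1 + ε₂) / 2 := by linarith
  have hδt : Tendsto (fun lam : ℝ => lam ^ ((1 + ε₂) / 2)) atTop atTop := tendsto_rpow_atTop hpos
  -- growth of the weight
  obtain ⟨θ, hθ0, hθ1, hθ⟩ : ∃ θ ≥ 0, θ < 1 / 2 ∧ ∃ C > 0, ∀ᶠ lam : ℝ in atTop,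
      ∀ t ∈ Icc 0 (lam ^ ((1 + ε₂) / 2)), jap t ^ ν s ≤ C * lam ^ (θ : ℝ) := by
    rcases lt_or_ge (ν s) 0 with hν | hν
    · refine ⟨0, le_rfl, by norm_num, 1, one_pos, Eventually.of_forall fun lam t _ => ?_⟩
      rw [Real.rpow_zero, mul_one]
      exact jap_rpow_le_one hν.le
    -- Since ε₂ < 1 - ν, one has (1+ε₂)ν ≤ (2-ν)ν = 1 - (1-ν)², which is below 1 because ν < 1.
    · refine ⟨(1 + ε₂) / 2 * ν s, by positivity, by nlinarith [sq_nonneg (1 - ν s)], 2 ^ ν s,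
        by positivity, ?_⟩
      filter_upwards [hδt.eventually_ge_atTop 1, eventually_gt_atTop 0] with lam h1 h0 t ht
      rw [Real.rpow_mul h0.le]
      exact jap_rpow_le_delta h1 ht.1 ht.2 hν
  obtain ⟨C, hC, hθ⟩ := hθ
  have herr : ∃ K > 0, ∀ᶠ lam in atTop, ∀ t ∈ Ioo 0 (lam ^ ((1 + ε₂) / 2)),
      lam ^ (-((n : ℝ) + 1) / 2) * jap t ^ (((n : ℝ) + 1) * ν s)
        ≤ K * errBound n V ν ε₁ ε₂ s lam := by
    rcases lt_or_ge (ν s) 0 with hν | hν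
    · refine ⟨1, one_pos, ?_⟩
      filter_upwards [eventually_gt_atTop 0] with lam h0 t _
      rw [errBound, if_pos hb, if_pos hν, one_mul]
      exact mul_le_of_le_one_right (Real.rpow_nonneg h0.le _)
        (jap_rpow_le_one (mul_nonpos_of_nonneg_of_nonpos (by positivity) hν.le))
    · refine ⟨2 ^ (((n : ℝ) + 1) * ν s), by positivity, ?_⟩
      filter_upwards [hδt.eventually_ge_atTop 1, eventually_gt_atTop 0] with lam h1 h0 t ht
      rw [errBound, if_pos hb, if_neg hν.not_gt]
      have h2 := jap_rpow_le_delta h1 ht.1.le ht.2.le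
        (by positivity : 0 ≤ ((n : ℝ) + 1) * ν s)
      have h3 := mul_le_mul_of_nonneg_left h2 (Real.rpow_nonneg h0.le (-((n : ℝ) + 1) / 2))
      refine h3.trans (le_of_eq ?_)
      rw [← Real.rpow_mul h0.le, mul_left_comm, ← Real.rpow_add h0]
      congr 2; ring
  obtain ⟨K, hK, herr⟩ := herr
  have hcont : Continuous fun t => |(V (s.sgn * t)).im| :=
    (Complex.continuous_im.comp (hV.continuous.comp (continuous_const.mul continuous_id))).abs
  refine ⟨hδt, tendsto_rpow_atTop (by linarith), ?_, ?_, ?_, ?_, ⟨c, hc, r, by linarith, hcr⟩,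
    ?_, ?_, ?_, ?_, ?_, ?_⟩
  · filter_upwards [eventually_gt_atTop 0] with lam h0
    have := Real.rpow_pos_of_pos h0 ((1 + ε₂) / 2)
    positivity
  · exact Eventually.of_forall fun lam => le_rfl
  · refine ⟨max M C, lt_max_of_lt_right hC, θ, hθ0, hθ1, ?_⟩
    filter_upwards [hθ, eventually_ge_atTop 1, eventually_ge_atTop (2 * M)] with lam h1 h2 h3 t ht
    have h4 := hM t ht.1
    refine ⟨?_, ?_, ?_⟩
    · calc ‖V (s.sgn * t)‖ ≤ M * 1 := by simpa using h4
        _ ≤ max M C * lam := by gcongr; exact le_max_left _ _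
    · exact (Complex.re_le_norm _).trans (h4.trans (by linarith))
    · refine (h1 t ht).trans (mul_le_mul_of_nonneg_right (le_max_right _ _)
        (Real.rpow_nonneg (by linarith) _))
  · intro η hη
    refine ⟨r, by linarith, ?_⟩
    filter_upwards [hθ, eventually_mul_rpow_le hθ1 ((1 + M) * C) (η * c) (by positivity)]
      with lam h1 h2 t ht
    have h0 : 0 ≤ t := by linarith [ht.1]
    have h3 := h1 t ⟨h0, ht.2⟩
    calc (1 + ‖V (s.sgn * t)‖) * jap t ^ ν s ≤ (1 + M) * (C * lam ^ θ) := by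
          gcongr
          · exact Real.rpow_nonneg (jap_pos t).le _
          · exact hM t h0
      _ ≤ η * c * lam ^ (1 / 2 : ℝ) := by rw [← mul_assoc]; exact h2
      _ = η * √lam * c := by rw [Real.sqrt_eq_rpow]; ring
      _ ≤ η * √lam * |(V (s.sgn * t)).im| := by gcongr; exact him t ht.1
  · intro η hη a
    simpa using eventually_rpow_le_exp a (half_pos hε0) hη 1
  · intro η hη
    simpa using eventually_rpow_le_exp ((1 + ε₂) / 2) (half_pos hε0) hη 1
  · intro η hη
    filter_upwards [eventually_rpow_le_exp (-((1 + ε₂) / 2)) (half_pos hε0) hη 4,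
      eventually_gt_atTop 0] with lam h1 h0
    refine le_trans (le_of_eq ?_) h1
    rw [Real.rpow_neg h0.le]; field_simp
  -- Beyond r, |Im V| ≥ c, and t ≥ 3δ/4 with r ≤ δ/4 leaves an interval of length at least δ/2. The
  -- rate times √λ is exactly δ.
  · refine ⟨c / 2, by positivity, ?_⟩
    filter_upwards [hδt.eventually_ge_atTop (4 * r), eventually_gt_atTop 0] with lam h1 h0 t ht
    set d := lam ^ ((1 + ε₂) / 2) with hd
    have h2 := intervalIntegral_le_of_le (t := t) hcont (fun x => abs_nonneg _)
      (by linarith : 0 ≤ r) (by linarith [ht.1] : r ≤ t) le_rfl fun x hx => him x hx.1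
    have h3 : lam ^ (ε₂ / 2) * √lam = d := by
      rw [Real.sqrt_eq_rpow, ← Real.rpow_add h0, hd]; congr 1; ring
    rw [mul_assoc, h3]
    refine le_trans ?_ h2
    have h4 : d / 2 ≤ t - r := by linarith [ht.1]
    nlinarith
  · refine ⟨(1 + M) * K, by positivity, ?_⟩
    filter_upwards [herr, eventually_gt_atTop 0] with lam h1 h0 t ht
    have h2 := h1 t ht
    calc lam ^ (-((n : ℝ) + 1) / 2) * ((1 + ‖V (s.sgn * t)‖) * jap t ^ (((n : ℝ) + 1) * ν s))
        = (1 + ‖V (s.sgn * t)‖) * (lam ^ (-((n : ℝ) + 1) / 2) *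
            jap t ^ (((n : ℝ) + 1) * ν s)) := by ring
      _ ≤ (1 + M) * (K * errBound n V ν ε₁ ε₂ s lam) := by
          gcongr
          · exact mul_nonneg (Real.rpow_nonneg h0.le _) (Real.rpow_nonneg (jap_pos t).le _)
          · exact hM t ht.1.le
      _ = _ := by ring
  -- Evaluate the upper estimate at t = 1, where the weight is a fixed constant.
  · refine ⟨K * jap 1 ^ (-(((n : ℝ) + 1) * ν s)), ?_, ?_⟩
    · have := Real.rpow_pos_of_pos (jap_pos 1) (-(((n : ℝ) + 1) * ν s))
      positivity
    filter_upwards [herr, hδt.eventually_gt_atTop 1] with lam h1 h2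
    have h3 := h1 1 ⟨one_pos, h2⟩
    have h4 := Real.rpow_pos_of_pos (jap_pos 1) (((n : ℝ) + 1) * ν s)
    rw [← le_div_iff₀ h4] at h3
    refine h3.trans (le_of_eq ?_)
    rw [Real.rpow_neg (jap_pos 1).le]
    field_simp

end

/-! ### Unbounded potentials -/

theorem jap_rpow_le_two_rpow_mul {x δ a : ℝ} (hδ : 1 ≤ δ) (h1 : δ / 2 ≤ x) (h2 : x ≤ δ) :
    jap x ^ a ≤ 2 ^ |a| * δ ^ a := by
  have hδ0 : 0 < δ := by linarith
  rcases le_total 0 a with ha | ha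
  · rw [abs_of_nonneg ha]
    exact jap_rpow_le_delta hδ (by linarith) h2 ha
  · rw [abs_of_nonpos ha]
    have h3 : jap x ^ a ≤ (δ / 2) ^ a :=
      Real.rpow_le_rpow_of_nonpos (by linarith) (h1.trans (le_jap x)) ha
    rwa [Real.div_rpow hδ0.le (by norm_num), div_eq_mul_inv, ← Real.rpow_neg (by norm_num),
      mul_comm] at h3

theorem rpow_le_two_rpow_mul_jap {δ a : ℝ} (hδ : 1 ≤ δ) : δ ^ a ≤ 2 ^ |a| * jap δ ^ a := by
  have h := jap_rpow_le_two_rpow_mul (a := -a) hδ (by linarith) le_rfl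
  rw [Real.rpow_neg (jap_pos δ).le, Real.rpow_neg (by linarith), abs_neg] at h
  have h1 := Real.rpow_pos_of_pos (jap_pos δ) a
  have h2 := Real.rpow_pos_of_pos (by linarith : 0 < δ) a
  rwa [inv_le_iff_one_le_mul₀ h1, ← div_eq_mul_inv, div_mul_eq_mul_div, one_le_div h2] at h

section

variable {n : ℕ} {V : ℝ → ℂ} {ν : Side → ℝ} {ε₁ ε₂ : ℝ}

/-- For ν < -1 the weight ⟨t⟩^ν is integrable at infinity, and Gronwall's inequality would bound V.
The conclusion makes ν + 1 + ε₁ positive and gives Δ ≤ δ/4 once δ ≥ 1. -/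
theorem Admissible.neg_one_le_nu (hV : Admissible (n + 1) V ν ε₁) {s : Side}
    (hb : ¬ BoundedAt s V) : -1 ≤ ν s := by
  by_contra hν
  rw [not_le] at hν
  refine hb ?_
  obtain ⟨C, hC, r, hr, h⟩ := hV.norm_gronwall s
  have hr0 : 0 < r := by linarith
  refine ⟨‖V (s.sgn * r)‖ * Real.exp (C * (r ^ (ν s + 1) / (-(ν s + 1)))), ?_⟩
  have key : ∀ y ≥ r, ‖V (s.sgn * y)‖
      ≤ ‖V (s.sgn * r)‖ * Real.exp (C * (r ^ (ν s + 1) / (-(ν s + 1)))) := by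
    intro y hy
    refine (h r y le_rfl hy).trans ?_
    gcongr
    have hmem : (0 : ℝ) ∉ uIcc r y := by
      rw [uIcc_of_le hy]; exact fun h => absurd h.1 (not_le.2 hr0)
    have hi : IntervalIntegrable (fun t : ℝ => t ^ ν s) volume r y :=
      intervalIntegral.intervalIntegrable_rpow (Or.inr hmem)
    have h1 : ∫ t in r..y, jap t ^ ν s ≤ ∫ t in r..y, t ^ ν s := by
      refine intervalIntegral.integral_mono_on hy
        ((continuous_jap_rpow _).intervalIntegrable _ _) hi fun t ht => ?_
      exact Real.rpow_le_rpow_of_nonpos (by linarith [ht.1]) (le_jap t) (by linarith)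
    refine h1.trans ?_
    rw [integral_rpow (Or.inr ⟨by linarith, hmem⟩), div_neg, ← neg_div]
    refine div_le_div_of_nonpos_of_le (by linarith) ?_
    linarith [Real.rpow_nonneg (hr0.le.trans hy) (ν s + 1)]
  have h2 : ∀ᶠ x in s.atInfty, r ≤ s.sgn * x := by
    cases s
    · filter_upwards [eventually_le_atBot (-r)] with x hx
      simp only [Side.sgn]; linarith
    · filter_upwards [eventually_ge_atTop r] with x hx
      simp only [Side.sgn]; linarith
  filter_upwards [h2] with x hx
  have := key _ hx
  rwa [s.sgn_mul_cancel] at this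

theorem Admissible.abs_im_le_exp (hV : Admissible (n + 1) V ν ε₁) {s : Side} (hν : -1 ≤ ν s)
    {η : ℝ} (hη : 0 < η) :
    ∀ᶠ y in atTop, |(V (s.sgn * y)).im| ≤ Real.exp (η * y ^ (ν s + 1 + ε₁)) := by
  have hε := hV.eps_pos
  obtain ⟨C, hC, r, hr, h⟩ := hV.im_gronwall s
  have hr0 : 0 < r := by linarith
  -- Half of ε₁ keeps b positive even at ν = -1, where ∫t^ν is logarithmic, and leaves room below
  -- the target exponent ν + 1 + ε₁.
  set b := ν s + 1 + ε₁ / 2 with hbdef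
  have hb : 0 < b := by linarith
  filter_upwards [eventually_ge_atTop r,
    eventually_rpow_le_exp 0 (by linarith : 0 < ν s + 1 + ε₁) (half_pos hη) |(V (s.sgn * r)).im|,
    eventually_mul_rpow_le (by linarith : b < ν s + 1 + ε₁) (C * (2 ^ |ν s| / b)) (η / 2)
      (half_pos hη)] with y hy h1 h2
  rw [Real.rpow_zero, mul_one] at h1
  have h3 : ∫ t in r..y, jap t ^ ν s ≤ 2 ^ |ν s| / b * y ^ b := by
    have hi : IntervalIntegrable (fun t : ℝ => 2 ^ |ν s| * t ^ (b - 1)) volume r y :=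
      (intervalIntegral.intervalIntegrable_rpow' (by linarith)).const_mul _
    have h4 : ∫ t in r..y, jap t ^ ν s ≤ ∫ t in r..y, 2 ^ |ν s| * t ^ (b - 1) := by
      refine intervalIntegral.integral_mono_on hy
        ((continuous_jap_rpow _).intervalIntegrable _ _) hi fun t ht => ?_
      have ht1 : 1 ≤ t := hr.trans ht.1
      refine (jap_rpow_le_two_rpow_mul ht1 (by linarith) le_rfl).trans ?_
      gcongr
      linarith
    refine h4.trans ?_
    rw [intervalIntegral.integral_const_mul, integral_rpow (Or.inl (by linarith)),
      sub_add_cancel, div_mul_eq_mul_div, ← mul_div_assoc]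
    gcongr
    linarith [Real.rpow_nonneg hr0.le b]
  calc |(V (s.sgn * y)).im|
      ≤ |(V (s.sgn * r)).im| * Real.exp (C * ∫ t in r..y, jap t ^ ν s) := h r y le_rfl hy
    _ ≤ Real.exp (η / 2 * y ^ (ν s + 1 + ε₁)) * Real.exp (η / 2 * y ^ (ν s + 1 + ε₁)) := by
        refine mul_le_mul h1 (Real.exp_le_exp.2 (le_trans ?_ h2)) (Real.exp_pos _).le
          (Real.exp_pos _).le
        rw [mul_assoc]
        exact mul_le_mul_of_nonneg_left h3 hC
    _ = _ := by rw [← Real.exp_add]; congr 1; ring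

/-! ### The radius at an unbounded end as a first hitting time -/

/-- The function whose level sets define `δ_±`. -/
noncomputable def levelFun (V : ℝ → ℂ) (ν : Side → ℝ) (ε₁ : ℝ) (s : Side) (d : ℝ) : ℝ :=
  |(V (s.sgn * d)).im| ^ 2 / jap d ^ (4 * ν s + 2 * ε₁ + 2)

theorem continuous_levelFun (hV : Continuous V) (ν : Side → ℝ) (ε₁ : ℝ) (s : Side) :
    Continuous (levelFun V ν ε₁ s) := by
  refine Continuous.div ?_ (continuous_jap_rpow _)
    fun x => (Real.rpow_pos_of_pos (jap_pos x) _).ne'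
  exact (Complex.continuous_im.comp (hV.comp (continuous_const.mul continuous_id))).abs.pow 2

/-- Divide condition (c) by ⟨t⟩^{4ν+2ε₁+2} and read off the two summands. -/
theorem Admissible.le_levelFun (hV : Admissible (n + 1) V ν ε₁) {s : Side}
    (hb : ¬ BoundedAt s V) : ∃ K > 0, ∃ r ≥ (1 : ℝ), ∀ t ≥ r,
      jap t ^ (4 * ν s + 2 * ε₁ + 2) ≤ K * levelFun V ν ε₁ s t ∧
      |(V (s.sgn * t)).re| * jap t ^ (2 * ε₁) ≤ K * levelFun V ν ε₁ s t := by
  obtain ⟨C, hC⟩ := (hV.im_large s hb).bound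
  obtain ⟨r, hr, h⟩ := s.mem_atInfty hC
  refine ⟨|C| + 1, by positivity, r, hr, fun t ht => ?_⟩
  have h1 := h (s.sgn * t) (by rwa [s.sgn_mul_cancel])
  simp only [mem_ofPred_eq] at h1
  have hj := jap_pos t
  have hJ : ∀ a : ℝ, 0 < jap t ^ a := fun a => Real.rpow_pos_of_pos hj a
  rw [jap_sgn_mul, Real.norm_of_nonneg (by have := hJ (4 * (ν s + ε₁) + 2);
                                           have := hJ (4 * ν s + 2); positivity),
    Real.norm_of_nonneg (by positivity)] at h1
  have h2 : jap t ^ (4 * (ν s + ε₁) + 2) * (jap t ^ (4 * ν s + 2) + |(V (s.sgn * t)).re|)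
      ≤ (|C| + 1) * |(V (s.sgn * t)).im| ^ 2 :=
    h1.trans (by gcongr; linarith [le_abs_self C])
  have e1 : jap t ^ (4 * (ν s + ε₁) + 2)
      = jap t ^ (2 * ε₁) * jap t ^ (4 * ν s + 2 * ε₁ + 2) := by
    rw [← Real.rpow_add hj]; congr 1; ring
  have e2 : jap t ^ (2 * ε₁) * jap t ^ (4 * ν s + 2) = jap t ^ (4 * ν s + 2 * ε₁ + 2) := by
    rw [← Real.rpow_add hj]; congr 1; ring
  have h3 : jap t ^ (2 * ε₁) * (jap t ^ (4 * ν s + 2) + |(V (s.sgn * t)).re|)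
      ≤ (|C| + 1) * levelFun V ν ε₁ s t := by
    rw [levelFun, ← mul_div_assoc, le_div_iff₀ (hJ _)]
    refine le_trans (le_of_eq ?_) h2
    rw [e1]; ring
  rw [mul_add, e2] at h3
  have h4 : 0 ≤ jap t ^ (2 * ε₁) * |(V (s.sgn * t)).re| := mul_nonneg (hJ _).le (abs_nonneg _)
  have h5 := (hJ (4 * ν s + 2 * ε₁ + 2)).le
  constructor
  · linarith
  · rw [mul_comm]; linarith

/-- If F stayed bounded, `Admissible.le_levelFun` would bound the weight ⟨t⟩^{4ν+2ε₁+2} and Re V.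
Then |Im V|², the product of F and that weight, would be bounded too, contradicting the
unboundedness of V. -/
theorem Admissible.levelFun_unbounded (hV : Admissible (n + 1) V ν ε₁) {s : Side}
    (hb : ¬ BoundedAt s V) (B : ℝ) : ∃ t ≥ 0, B < levelFun V ν ε₁ s t := by
  by_contra hcon
  push Not at hcon
  refine hb ?_
  have hε := hV.eps_pos
  obtain ⟨K, hK, r, hr, h⟩ := hV.le_levelFun hb
  have hB : 0 ≤ B := le_trans (by unfold levelFun; have := jap_pos 0; positivity) (hcon 0 le_rfl)
  refine ⟨K * B + √(B * (K * B)), ?_⟩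
  have h2 : ∀ᶠ x in s.atInfty, r ≤ s.sgn * x := by
    cases s
    · filter_upwards [eventually_le_atBot (-r)] with x hx
      simp only [Side.sgn]; linarith
    · filter_upwards [eventually_ge_atTop r] with x hx
      simp only [Side.sgn]; linarith
  filter_upwards [h2] with x hx
  obtain ⟨h3, h4⟩ := h _ hx
  have h5 := hcon (s.sgn * x) (by linarith)
  have hp := Real.rpow_pos_of_pos (jap_pos (s.sgn * x)) (4 * ν s + 2 * ε₁ + 2)
  have h6 : K * levelFun V ν ε₁ s (s.sgn * x) ≤ K * B := by gcongr
  have h7 : |(V x).im| ^ 2 ≤ B * (K * B) := by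
    have : |(V x).im| ^ 2 / jap (s.sgn * x) ^ (4 * ν s + 2 * ε₁ + 2) ≤ B := by
      simpa [levelFun, s.sgn_mul_cancel] using h5
    rw [div_le_iff₀ hp] at this
    exact this.trans (by gcongr; exact h3.trans h6)
  rw [s.sgn_mul_cancel] at h4
  have h8 : |(V x).re| ≤ K * B := by
    refine le_trans ?_ (h4.trans h6)
    exact le_mul_of_one_le_right (abs_nonneg _)
      (Real.one_le_rpow (one_le_jap _) (by linarith))
  have h9 : |(V x).im| ≤ √(B * (K * B)) := Real.le_sqrt_of_sq_le h7
  exact (Complex.norm_le_abs_re_add_abs_im _).trans (add_le_add h8 h9)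

/-- Closedness puts the infimum in the level set, and by the intermediate value theorem F cannot
exceed λ earlier. As F is bounded on compact intervals, the first hitting time escapes to infinity.
-/
theorem sInf_level {F : ℝ → ℝ} (hF : Continuous F) (hub : ∀ B, ∃ t ≥ 0, B < F t) :
    Tendsto (fun lam => sInf {d : ℝ | 0 ≤ d ∧ F d = lam}) atTop atTop ∧
    ∀ᶠ lam in atTop, F (sInf {d : ℝ | 0 ≤ d ∧ F d = lam}) = lam ∧
      ∀ t ∈ Icc 0 (sInf {d : ℝ | 0 ≤ d ∧ F d = lam}), F t ≤ lam := by
  have hcl : ∀ lam, IsClosed {d : ℝ | 0 ≤ d ∧ F d = lam} := fun lam =>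
    (isClosed_le continuous_const continuous_id).inter (isClosed_eq hF continuous_const)
  have hbd : ∀ lam, BddBelow {d : ℝ | 0 ≤ d ∧ F d = lam} := fun lam => ⟨0, fun d hd => hd.1⟩
  have hne : ∀ lam ≥ F 0, ∀ t ≥ 0, lam ≤ F t → ∃ d ∈ Icc 0 t, F d = lam := fun lam h t ht hlt =>
    (intermediate_value_Icc ht hF.continuousOn) ⟨h, hlt⟩
  have hmem : ∀ lam ≥ F 0, sInf {d : ℝ | 0 ≤ d ∧ F d = lam} ∈ {d : ℝ | 0 ≤ d ∧ F d = lam} := by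
    intro lam h
    obtain ⟨t, ht, hlt⟩ := hub lam
    obtain ⟨d, hd, hd'⟩ := hne lam h t ht hlt.le
    exact (hcl lam).csInf_mem ⟨d, hd.1, hd'⟩ (hbd lam)
  refine ⟨?_, ?_⟩
  · refine tendsto_atTop.2 fun R => ?_
    obtain ⟨M, hM⟩ := (isCompact_Icc (a := 0) (b := R)).exists_bound_of_continuousOn
      hF.continuousOn
    filter_upwards [eventually_ge_atTop (F 0), eventually_gt_atTop M] with lam h1 h2
    obtain ⟨h3, h4⟩ := hmem lam h1
    by_contra hlt
    have := (le_abs_self _).trans (hM _ ⟨h3, (not_le.1 hlt).le⟩)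
    linarith
  · filter_upwards [eventually_ge_atTop (F 0)] with lam h1
    refine ⟨(hmem lam h1).2, fun t ht => ?_⟩
    by_contra hlt
    obtain ⟨d, hd, hd'⟩ := hne lam h1 t ht.1 (not_le.1 hlt).le
    have h2 := csInf_le (hbd lam) ⟨hd.1, hd'⟩
    have h3 : d = t := le_antisymm hd.2 (ht.2.trans h2)
    rw [h3] at hd'
    exact hlt hd'.le

end

/-! ### Estimates at an unbounded end -/

section

variable {n : ℕ} {V : ℝ → ℂ} {ν : Side → ℝ} {ε₁ ε₂ : ℝ}

theorem Admissible.delta_spec (hV : Admissible (n + 1) V ν ε₁) {s : Side}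
    (hb : ¬ BoundedAt s V) :
    Tendsto (fun lam => delta V ν ε₁ ε₂ lam s) atTop atTop ∧
    ∀ᶠ lam in atTop, levelFun V ν ε₁ s (delta V ν ε₁ ε₂ lam s) = lam ∧
      ∀ t ∈ Icc 0 (delta V ν ε₁ ε₂ lam s), levelFun V ν ε₁ s t ≤ lam := by
  have h := sInf_level (continuous_levelFun hV.continuous ν ε₁ s) (hV.levelFun_unbounded hb)
  have e : ∀ lam, delta V ν ε₁ ε₂ lam s = sInf {d : ℝ | 0 ≤ d ∧ levelFun V ν ε₁ s d = lam} :=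
    fun lam => by rw [delta, if_neg hb]; rfl
  simp only [e]
  exact h

theorem abs_im_sq_eq (s : Side) (t : ℝ) : |(V (s.sgn * t)).im| ^ 2 =
    levelFun V ν ε₁ s t * jap t ^ (4 * ν s + 2 * ε₁ + 2) := by
  rw [levelFun, div_mul_cancel₀ _ (Real.rpow_pos_of_pos (jap_pos t) _).ne']

theorem tendsto_jap_rpow {a : ℝ} (ha : 0 < a) : Tendsto (fun t => jap t ^ a) atTop atTop :=
  (tendsto_rpow_atTop ha).comp (tendsto_atTop_mono le_jap tendsto_id)

/-- All three bounds come from F ≤ λ on [0, δ]. The imaginary part satisfies |Im V|² =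
F·⟨t⟩^{4ν+2ε₁+2} ≤ λ·Kλ. For the real part, |Re V| ⟨t⟩^{2ε₁} ≤ Kλ, and far out ⟨t⟩^{2ε₁} ≥ 2K. The
weight obeys ⟨t⟩^{4ν} ≤ ⟨t⟩^{4ν+2ε₁+2} ≤ Kλ, whence the exponent 1/4. A fixed compact part is
covered by taking λ large. -/
theorem Admissible.bound_of_unbounded (hV : Admissible (n + 1) V ν ε₁) {s : Side}
    (hb : ¬ BoundedAt s V) :
    ∃ C > 0, ∀ᶠ lam in atTop, ∀ t ∈ Icc 0 (delta V ν ε₁ ε₂ lam s),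
      ‖V (s.sgn * t)‖ ≤ C * lam ∧ (V (s.sgn * t)).re ≤ lam / 2 ∧
      jap t ^ ν s ≤ C * lam ^ (1 / 4 : ℝ) := by
  have hε := hV.eps_pos
  obtain ⟨K, hK, r, hr, h⟩ := hV.le_levelFun hb
  obtain ⟨r₁, hr₁⟩ := eventually_atTop.1
    ((tendsto_jap_rpow (by linarith : 0 < 2 * ε₁)).eventually_ge_atTop (2 * K))
  set R := max r r₁
  obtain ⟨M, hM⟩ := isCompact_Icc.exists_bound_of_continuousOn (s := Icc 0 R)
    (f := fun t => V (s.sgn * t))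
    (hV.continuous.comp (continuous_const.mul continuous_id)).continuousOn
  obtain ⟨L, hL⟩ := isCompact_Icc.exists_bound_of_continuousOn (s := Icc 0 R)
    (continuous_jap_rpow (ν s)).continuousOn
  refine ⟨1 + |L| + K + √K + K ^ (1 / 4 : ℝ), by positivity, ?_⟩
  filter_upwards [(hV.delta_spec (ε₂ := ε₂) hb).2, eventually_ge_atTop 1,
    eventually_ge_atTop (2 * M)] with lam hd h1 h2 t ht
  have hq : (1 : ℝ) ≤ lam ^ (1 / 4 : ℝ) := Real.one_le_rpow h1 (by norm_num)
  have hK4 : 0 ≤ K ^ (1 / 4 : ℝ) := Real.rpow_nonneg hK.le _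
  have hsK := Real.sqrt_nonneg K
  have hLn := abs_nonneg L
  rcases le_total t R with htR | htR
  · have h3 := hM t ⟨ht.1, htR⟩
    have h4 := hL t ⟨ht.1, htR⟩
    refine ⟨?_, ?_, ?_⟩
    · nlinarith
    · exact (Complex.re_le_norm _).trans (h3.trans (by linarith))
    · have := (le_abs_self _).trans h4
      have := le_abs_self L
      nlinarith
  · obtain ⟨h3, h4⟩ := h t ((le_max_left _ _).trans htR)
    have h5 := hd.2 t ht
    have h6 := hr₁ t ((le_max_right _ _).trans htR)
    have h7 : K * levelFun V ν ε₁ s t ≤ K * lam := by gcongr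
    have hp := Real.rpow_pos_of_pos (jap_pos t) (4 * ν s + 2 * ε₁ + 2)
    have him : |(V (s.sgn * t)).im| ≤ √K * lam := by
      have : |(V (s.sgn * t)).im| ^ 2 ≤ (√K * lam) ^ 2 := by
        rw [abs_im_sq_eq (V := V) (ν := ν) (ε₁ := ε₁), mul_pow, Real.sq_sqrt hK.le]
        calc _ ≤ lam * (K * lam) := by
              apply mul_le_mul h5 (h3.trans h7) hp.le (by linarith)
          _ = _ := by ring
      exact le_of_sq_le_sq this (by positivity)
    have hre0 := abs_nonneg (V (s.sgn * t)).re
    have hre : |(V (s.sgn * t)).re| ≤ lam / 2 := by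
      have : |(V (s.sgn * t)).re| * (2 * K) ≤ K * lam :=
        (mul_le_mul_of_nonneg_left h6 hre0).trans (h4.trans h7)
      have h8 : K * (2 * |(V (s.sgn * t)).re|) ≤ K * lam := by linarith
      have := le_of_mul_le_mul_left h8 hK
      linarith
    refine ⟨?_, (le_abs_self _).trans hre, ?_⟩
    · have := Complex.norm_le_abs_re_add_abs_im (V (s.sgn * t))
      nlinarith
    · have h8 : jap t ^ (4 * ν s) ≤ K * lam := by
        refine (Real.rpow_le_rpow_of_exponent_le (one_le_jap t) ?_).trans (h3.trans h7)
        linarith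
      have h9 : jap t ^ ν s = (jap t ^ (4 * ν s)) ^ (1 / 4 : ℝ) := by
        rw [← Real.rpow_mul (jap_pos t).le]; congr 1; ring
      rw [h9]
      refine (Real.rpow_le_rpow (Real.rpow_nonneg (jap_pos t).le _) h8 (by norm_num)).trans ?_
      rw [Real.mul_rpow hK.le (by linarith)]
      gcongr
      linarith

/-- This makes the correction to Ψ, of size (1+|V|)⟨t⟩^ν/λ, negligible against the leading real part
|Im V|/√λ. The contributions of Re V and of 1 + |Im V| each receive half of η. The latter is settled
by ⟨t⟩^ν = O(λ^{1/4}) = o(√λ), the constant 1 being absorbed by |Im V| ≥ c. -/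
theorem Admissible.small_of_unbounded (hV : Admissible (n + 1) V ν ε₁) {s : Side}
    (hb : ¬ BoundedAt s V) {η : ℝ} (hη : 0 < η) :
    ∃ r ≥ 0, ∀ᶠ lam in atTop, ∀ t ∈ Icc r (delta V ν ε₁ ε₂ lam s),
    (1 + ‖V (s.sgn * t)‖) * jap t ^ ν s ≤ η * √lam * |(V (s.sgn * t)).im| := by
  have hε := hV.eps_pos
  have hν := hV.neg_one_le_nu hb
  obtain ⟨K, hK, r, hr, h⟩ := hV.le_levelFun hb
  obtain ⟨C, hC, hbound⟩ := hV.bound_of_unbounded (ε₂ := ε₂) hb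
  obtain ⟨c, hc, r₂, hr₂, hcr⟩ := hV.im_lower s
  obtain ⟨r₁, hr₁⟩ := eventually_atTop.1
    ((tendsto_jap_rpow hε).eventually_ge_atTop (2 * K / η))
  refine ⟨max r (max r₁ r₂), by have := le_max_left r (max r₁ r₂); linarith, ?_⟩
  filter_upwards [(hV.delta_spec (ε₂ := ε₂) hb).2, hbound, eventually_gt_atTop 0,
    eventually_mul_rpow_le (by norm_num : (1 / 4 : ℝ) < 1 / 2) ((1 / c + 1) * C) (η / 2)
      (half_pos hη)] with lam hd h1 h0 h2 t ht
  have htr : r ≤ t := (le_max_left _ _).trans ht.1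
  have htr₁ : r₁ ≤ t := (le_max_left _ _).trans ((le_max_right _ _).trans ht.1)
  have htr₂ : r₂ ≤ t := (le_max_right _ _).trans ((le_max_right _ _).trans ht.1)
  have ht' : t ∈ Icc 0 (delta V ν ε₁ ε₂ lam s) := ⟨by linarith, ht.2⟩
  set I := |(V (s.sgn * t)).im| with hI
  have hj := jap_pos t
  have hJ : ∀ a : ℝ, 0 < jap t ^ a := fun a => Real.rpow_pos_of_pos hj a
  have hcI : c ≤ I := by
    refine (hcr t htr₂).trans ((le_abs_self _).trans ?_)
    rw [abs_mul, s.abs_sgn, one_mul]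
  have hI0 : 0 ≤ I := abs_nonneg _
  obtain ⟨-, h4⟩ := h t htr
  have h5 := hd.2 t ht'
  -- the real part
  have hre : |(V (s.sgn * t)).re| * jap t ^ ν s ≤ η / 2 * √lam * I := by
    have e1 : I ≤ √lam * jap t ^ (2 * ν s + ε₁ + 1) := by
      have : I ^ 2 ≤ (√lam * jap t ^ (2 * ν s + ε₁ + 1)) ^ 2 := by
        rw [hI, abs_im_sq_eq (V := V) (ν := ν) (ε₁ := ε₁), mul_pow, Real.sq_sqrt h0.le,
          ← Real.rpow_natCast (jap t ^ _) 2, ← Real.rpow_mul hj.le]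
        refine mul_le_mul h5 (le_of_eq ?_) (hJ _).le h0.le
        congr 1; push_cast; ring
      exact le_of_sq_le_sq this (mul_nonneg (Real.sqrt_nonneg _) (hJ _).le)
    -- Only one factor of |Im V|² is replaced by its bound √λ ⟨t⟩^{2ν+ε₁+1}; the other must survive
    -- on the right-hand side.
    have e2 : levelFun V ν ε₁ s t
        ≤ I * √lam * jap t ^ (-(2 * ν s + ε₁ + 1)) := by
      rw [levelFun, div_le_iff₀ (hJ _)]
      calc I ^ 2 = I * I := sq I
        _ ≤ I * (√lam * jap t ^ (2 * ν s + ε₁ + 1)) := by gcongr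
        _ = _ := by
          rw [mul_assoc (I * √lam), ← Real.rpow_add hj, mul_assoc]
          congr 3; ring
    -- The exponents require ν ≤ 2ν + 2ε₁ + 1, which follows from ν ≥ -1; the spare factor ⟨t⟩^{-ε₁}
    -- is what becomes small.
    have e3 : jap t ^ ν s ≤ jap t ^ (2 * ε₁) * (jap t ^ (2 * ν s + ε₁ + 1)
        * jap t ^ (-ε₁)) := by
      rw [← Real.rpow_add hj, ← Real.rpow_add hj]
      exact Real.rpow_le_rpow_of_exponent_le (one_le_jap t) (by linarith)
    have e4 : K * jap t ^ (-ε₁) ≤ η / 2 := by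
      have := hr₁ t htr₁
      rw [Real.rpow_neg hj.le, ← div_eq_mul_inv, div_le_iff₀ (hJ _)]
      rw [div_le_iff₀ hη] at this
      linarith
    calc |(V (s.sgn * t)).re| * jap t ^ ν s
        ≤ |(V (s.sgn * t)).re| * (jap t ^ (2 * ε₁) * (jap t ^ (2 * ν s + ε₁ + 1)
          * jap t ^ (-ε₁))) := by gcongr
      _ = (|(V (s.sgn * t)).re| * jap t ^ (2 * ε₁)) * (jap t ^ (2 * ν s + ε₁ + 1)
          * jap t ^ (-ε₁)) := by ring
      _ ≤ (K * (I * √lam * jap t ^ (-(2 * ν s + ε₁ + 1)))) * (jap t ^ (2 * ν s + ε₁ + 1)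
          * jap t ^ (-ε₁)) := by
          refine mul_le_mul_of_nonneg_right (h4.trans (by gcongr)) (mul_nonneg (hJ _).le (hJ _).le)
      _ = (K * jap t ^ (-ε₁)) * √lam * I *
          (jap t ^ (-(2 * ν s + ε₁ + 1)) * jap t ^ (2 * ν s + ε₁ + 1)) := by ring
      _ = (K * jap t ^ (-ε₁)) * √lam * I := by
          rw [← Real.rpow_add hj, neg_add_cancel, Real.rpow_zero, mul_one]
      _ ≤ _ := by gcongr
  have him : (1 / c + 1) * I * jap t ^ ν s ≤ η / 2 * √lam * I := by
    calc (1 / c + 1) * I * jap t ^ ν s ≤ (1 / c + 1) * I * (C * lam ^ (1 / 4 : ℝ)) := by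
          gcongr; exact (h1 t ht').2.2
      _ = ((1 / c + 1) * C * lam ^ (1 / 4 : ℝ)) * I := by ring
      _ ≤ η / 2 * lam ^ (1 / 2 : ℝ) * I := by gcongr
      _ = _ := by rw [Real.sqrt_eq_rpow]
  have hone : 1 ≤ 1 / c * I := by rw [one_div, ← div_eq_inv_mul, one_le_div hc]; exact hcI
  calc (1 + ‖V (s.sgn * t)‖) * jap t ^ ν s
      ≤ ((1 / c + 1) * I + |(V (s.sgn * t)).re|) * jap t ^ ν s := by
        refine mul_le_mul_of_nonneg_right ?_ (hJ _).le
        have := Complex.norm_le_abs_re_add_abs_im (V (s.sgn * t))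
        rw [← hI] at this
        linarith
    _ ≤ _ := by rw [add_mul]; linarith

/-- At δ one has λ = F(δ), a square of Im V times a power of ⟨δ⟩. Two thirds of η pay for the square
and one third for the power. -/
theorem Admissible.lam_le_exp (hV : Admissible (n + 1) V ν ε₁) {s : Side}
    (hb : ¬ BoundedAt s V) {η : ℝ} (hη : 0 < η) :
    ∀ᶠ lam in atTop, lam ≤ Real.exp (η * delta V ν ε₁ ε₂ lam s ^ (ν s + 1 + ε₁)) := by
  have hε := hV.eps_pos
  have hν := hV.neg_one_le_nu hb
  obtain ⟨hδ, hspec⟩ := hV.delta_spec (ε₂ := ε₂) hb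
  have h3 : 0 < η / 3 := by positivity
  filter_upwards [hspec, hδ.eventually (hV.abs_im_le_exp hν h3), hδ.eventually_ge_atTop 1,
    hδ.eventually (eventually_rpow_le_exp (-(4 * ν s + 2 * ε₁ + 2))
      (by linarith : 0 < ν s + 1 + ε₁) h3 (2 ^ |(-(4 * ν s + 2 * ε₁ + 2))|))]
    with lam h1 h2 h4 h5
  set d := delta V ν ε₁ ε₂ lam s
  have h6 := (jap_rpow_le_two_rpow_mul (a := -(4 * ν s + 2 * ε₁ + 2)) h4 (by linarith)
    le_rfl).trans h5
  calc lam = |(V (s.sgn * d)).im| ^ 2 * jap d ^ (-(4 * ν s + 2 * ε₁ + 2)) := by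
        rw [Real.rpow_neg (jap_pos d).le, ← div_eq_mul_inv]; exact h1.1.symm
    _ ≤ Real.exp (η / 3 * d ^ (ν s + 1 + ε₁)) ^ 2 * Real.exp (η / 3 * d ^ (ν s + 1 + ε₁)) := by
        gcongr
        exact Real.rpow_nonneg (jap_pos d).le _
    _ = _ := by rw [← Real.exp_nat_mul, ← Real.exp_add]; congr 1; push_cast; ring

/-- The window [δ - 2Δ, δ - Δ] alone suffices. On [δ - 2Δ, δ] the integral of ⟨t⟩^ν is bounded, so
by Gronwall |Im V| is at least a fixed fraction of |Im V(δ)|, which is comparable to √λ δ^{2ν+ε₁+1}.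
Multiplying by the length δ^{-ν}/4 gives the rate. -/
theorem Admissible.decay_of_unbounded (hV : Admissible (n + 1) V ν ε₁) {s : Side}
    (hb : ¬ BoundedAt s V) :
    ∃ c > 0, ∀ᶠ lam in atTop, ∀ t ∈ Icc
      (delta V ν ε₁ ε₂ lam s - delta V ν ε₁ ε₂ lam s ^ (-ν s) / 4) (delta V ν ε₁ ε₂ lam s),
    c * delta V ν ε₁ ε₂ lam s ^ (ν s + 1 + ε₁) * √lam
      ≤ ∫ r in (0 : ℝ)..t, |(V (s.sgn * r)).im| := by
  have hε := hV.eps_pos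
  have hν := hV.neg_one_le_nu hb
  obtain ⟨hδ, hspec⟩ := hV.delta_spec (ε₂ := ε₂) hb
  obtain ⟨C, hC, r, hr, h⟩ := hV.im_gronwall s
  have hcont : Continuous fun t => |(V (s.sgn * t)).im| :=
    (Complex.continuous_im.comp (hV.continuous.comp (continuous_const.mul continuous_id))).abs
  set K := Real.exp (C * (2 ^ |ν s| / 2))
  set q := 2 * ν s + ε₁ + 1
  -- K is the Gronwall factor, 2^|q| the cost of passing between ⟨δ⟩ and δ, and 4 comes from Δ.
  refine ⟨(K * 2 ^ |q| * 4)⁻¹, by positivity, ?_⟩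
  filter_upwards [hspec, hδ.eventually_ge_atTop (2 * r), eventually_gt_atTop 0]
    with lam h1 h2 h0 t ht
  set d := delta V ν ε₁ ε₂ lam s
  have hd1 : 1 ≤ d := by linarith
  have hd0 : 0 < d := by linarith
  set Δ := d ^ (-ν s) / 4 with hΔ
  have hΔ0 : 0 < Δ := by have := Real.rpow_pos_of_pos hd0 (-ν s); positivity
  have hΔd : Δ ≤ d / 4 := by
    rw [hΔ]
    have : d ^ (-ν s) ≤ d ^ (1 : ℝ) := Real.rpow_le_rpow_of_exponent_le hd1 (by linarith)
    rw [Real.rpow_one] at this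
    linarith
  have hI : √lam * d ^ q ≤ 2 ^ |q| * |(V (s.sgn * d)).im| := by
    have h3 : √lam * jap d ^ q = |(V (s.sgn * d)).im| := by
      rw [← Real.sqrt_sq (abs_nonneg (V (s.sgn * d)).im),
        abs_im_sq_eq (V := V) (ν := ν) (ε₁ := ε₁), h1.1, Real.sqrt_mul h0.le]
      congr 1
      rw [Real.sqrt_eq_rpow, ← Real.rpow_mul (jap_pos d).le]
      congr 1; ring
    have h4 := rpow_le_two_rpow_mul_jap (a := q) hd1
    rw [← h3]
    calc √lam * d ^ q ≤ √lam * (2 ^ |q| * jap d ^ q) := by gcongr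
      _ = _ := by ring
  have hlow : ∀ x ∈ Icc (d - 2 * Δ) (d - Δ), K⁻¹ * |(V (s.sgn * d)).im|
      ≤ |(V (s.sgn * x)).im| := by
    intro x hx
    have hxd : x ≤ d := by linarith [hx.2]
    have h5 := h x d (by linarith [hx.1]) hxd
    rw [inv_mul_le_iff₀ (Real.exp_pos _)]
    refine h5.trans ((mul_le_mul_of_nonneg_left (Real.exp_le_exp.2
      (mul_le_mul_of_nonneg_left ?_ hC)) (abs_nonneg _)).trans (le_of_eq (mul_comm _ _)))
    have h6 : ∫ t in x..d, jap t ^ ν s ≤ ∫ _ in x..d, 2 ^ |ν s| * d ^ ν s := by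
      refine intervalIntegral.integral_mono_on hxd
        ((continuous_jap_rpow _).intervalIntegrable _ _) (by simp) fun t ht => ?_
      exact jap_rpow_le_two_rpow_mul hd1 (by linarith [ht.1, hx.1]) ht.2
    refine h6.trans ?_
    rw [intervalIntegral.integral_const, smul_eq_mul]
    have h7 : d - x ≤ 2 * Δ := by linarith [hx.1]
    have h8 : d ^ (-ν s) * d ^ ν s = 1 := by
      rw [← Real.rpow_add hd0, neg_add_cancel, Real.rpow_zero]
    calc (d - x) * (2 ^ |ν s| * d ^ ν s) ≤ 2 * Δ * (2 ^ |ν s| * d ^ ν s) := by gcongr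
      _ = 2 ^ |ν s| / 2 * (d ^ (-ν s) * d ^ ν s) := by rw [hΔ]; ring
      _ = _ := by rw [h8, mul_one]
  have h9 := intervalIntegral_le_of_le (t := t) hcont (fun x => abs_nonneg _)
    (by linarith : 0 ≤ d - 2 * Δ) (by linarith : d - 2 * Δ ≤ d - Δ) ht.1 hlow
  refine le_trans ?_ h9
  have e : d ^ (ν s + 1 + ε₁) = d ^ q * d ^ (-ν s) := by
    rw [← Real.rpow_add hd0]; congr 1; ring
  have e2 : d - Δ - (d - 2 * Δ) = d ^ (-ν s) / 4 := by rw [hΔ]; ring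
  rw [e, e2]
  have hK : 0 < K := Real.exp_pos _
  calc (K * 2 ^ |q| * 4)⁻¹ * (d ^ q * d ^ (-ν s)) * √lam
      = (K * 2 ^ |q| * 4)⁻¹ * d ^ (-ν s) * (√lam * d ^ q) := by ring
    _ ≤ (K * 2 ^ |q| * 4)⁻¹ * d ^ (-ν s) * (2 ^ |q| * |(V (s.sgn * d)).im|) := by
        gcongr
    _ = _ := by field_simp

/-- The point is to dispose of the 1 in 1 + |V|. For ν < 0, beyond r it is at most |V|/c, and before
r everything is bounded while the supremum exceeds its positive value m at r. For ν ≥ 0, 1 + |V| =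
O(λ), and the extra λ changes the power to (1-n)/2. -/
theorem Admissible.err_of_unbounded (hV : Admissible (n + 1) V ν ε₁) {s : Side}
    (hb : ¬ BoundedAt s V) :
    ∃ C > 0, ∀ᶠ lam in atTop, lam ^ (-((n : ℝ) + 1) / 2) ≤ C * errBound n V ν ε₁ ε₂ s lam ∧
      ∀ t ∈ Ioo 0 (delta V ν ε₁ ε₂ lam s),
      lam ^ (-((n : ℝ) + 1) / 2) * ((1 + ‖V (s.sgn * t)‖) * jap t ^ (((n : ℝ) + 1) * ν s))
        ≤ C * errBound n V ν ε₁ ε₂ s lam := by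
  obtain ⟨hδ, -⟩ := hV.delta_spec (ε₂ := ε₂) hb
  set q := ((n : ℝ) + 1) * ν s with hq
  rcases lt_or_ge (ν s) 0 with hν | hν
  · obtain ⟨c, hc, r, hr, hcr⟩ := hV.im_lower s
    have hcV : ∀ t ≥ r, c ≤ ‖V (s.sgn * t)‖ := fun t ht => by
      refine (hcr t ht).trans ((le_abs_self _).trans ?_)
      rw [abs_mul, s.abs_sgn, one_mul]
      exact Complex.abs_im_le_norm _
    have hcW : Continuous fun t => V (s.sgn * t) :=
      hV.continuous.comp (continuous_const.mul continuous_id)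
    obtain ⟨M, hM⟩ := isCompact_Icc.exists_bound_of_continuousOn (s := Icc 0 r)
      (f := fun t => (1 + ‖V (s.sgn * t)‖) * jap t ^ q)
      ((continuous_const.add hcW.norm).mul (continuous_jap_rpow q)).continuousOn
    set m := ‖V (s.sgn * r)‖ * jap r ^ q with hm
    have hm0 : 0 < m := mul_pos (hc.trans_le (hcV r le_rfl)) (Real.rpow_pos_of_pos (jap_pos r) _)
    refine ⟨1 / c + 1 + |M| / m + 1 / m, by positivity, ?_⟩
    filter_upwards [hδ.eventually_gt_atTop r, eventually_gt_atTop 0] with lam h1 h0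
    set d := delta V ν ε₁ ε₂ lam s with hd
    have hbdd : BddAbove ((fun x => ‖V x‖ * jap x ^ q) '' {x | x ∈ s.halfLine ∧ |x| < d}) := by
      have : BddAbove ((fun x => ‖V x‖ * jap x ^ q) '' Icc (-d) d) :=
        (isCompact_Icc.image (hV.continuous.norm.mul (continuous_jap_rpow q))).bddAbove
      exact this.mono (image_mono fun x hx => abs_le.1 hx.2.le)
    have hS : ∀ t ∈ Ioo 0 d, ‖V (s.sgn * t)‖ * jap t ^ q ≤ supWeighted V s d q := fun t ht => by
      refine le_csSup hbdd ⟨s.sgn * t, ⟨?_, ?_⟩, ?_⟩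
      · cases s
        · simpa [Side.halfLine, Side.sgn] using ht.1
        · simpa [Side.halfLine, Side.sgn] using ht.1
      · rw [abs_mul, s.abs_sgn, one_mul, abs_of_pos ht.1]; exact ht.2
      · simp only [jap_sgn_mul]
    have hSm : m ≤ supWeighted V s d q := hS r ⟨by linarith, h1⟩
    have hS0 : 0 < supWeighted V s d q := hm0.trans_le hSm
    have hmS : 1 ≤ 1 / m * supWeighted V s d q := by
      rw [one_div, ← div_eq_inv_mul, one_le_div hm0]; exact hSm
    have hl := Real.rpow_pos_of_pos h0 (-((n : ℝ) + 1) / 2)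
    rw [errBound, if_neg hb, if_pos hν, mul_left_comm]
    have hA : 0 ≤ 1 / c * supWeighted V s d q := by positivity
    have hB : 0 ≤ |M| / m * supWeighted V s d q := by positivity
    refine ⟨?_, fun t ht => ?_⟩
    · refine le_mul_of_one_le_right hl.le ?_
      linarith
    · refine mul_le_mul_of_nonneg_left ?_ hl.le
      rcases le_total t r with htr | htr
      · have h2 := (le_abs_self _).trans (hM t ⟨ht.1.le, htr⟩)
        have h3 : |M| * 1 ≤ |M| * (1 / m * supWeighted V s d q) := by gcongr
        have h4 : |M| * (1 / m * supWeighted V s d q) = |M| / m * supWeighted V s d q := by ring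
        have := le_abs_self M
        linarith
      · have h2 : 1 ≤ 1 / c * ‖V (s.sgn * t)‖ := by
          rw [one_div, ← div_eq_inv_mul, one_le_div hc]; exact hcV t htr
        have hj := Real.rpow_pos_of_pos (jap_pos t) q
        calc (1 + ‖V (s.sgn * t)‖) * jap t ^ q
            ≤ (1 / c * ‖V (s.sgn * t)‖ + ‖V (s.sgn * t)‖) * jap t ^ q := by gcongr
          _ = (1 / c + 1) * (‖V (s.sgn * t)‖ * jap t ^ q) := by ring
          _ ≤ (1 / c + 1) * supWeighted V s d q := by gcongr; exact hS t ht
          _ ≤ _ := by linarith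
  · obtain ⟨C, hC, hbound⟩ := hV.bound_of_unbounded (ε₂ := ε₂) hb
    have hq0 : 0 ≤ q := by positivity
    refine ⟨(1 + C) * 2 ^ q + 1, by positivity, ?_⟩
    filter_upwards [hbound, hδ.eventually_ge_atTop 1, eventually_ge_atTop 1] with lam h1 h2 h3
    set d := delta V ν ε₁ ε₂ lam s with hd
    have h0 : 0 < lam := by linarith
    rw [errBound, if_neg hb, if_neg hν.not_gt]
    have hdq : 1 ≤ d ^ q := Real.one_le_rpow h2 hq0
    have hl := Real.rpow_pos_of_pos h0 ((1 - (n : ℝ)) / 2)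
    have e : lam ^ (-((n : ℝ) + 1) / 2) * lam = lam ^ ((1 - (n : ℝ)) / 2) := by
      rw [← Real.rpow_add_one h0.ne']; congr 1; ring
    refine ⟨?_, fun t ht => ?_⟩
    · have h4 : lam ^ (-((n : ℝ) + 1) / 2) ≤ lam ^ ((1 - (n : ℝ)) / 2) :=
        Real.rpow_le_rpow_of_exponent_le h3 (by linarith)
      have h5 : lam ^ ((1 - (n : ℝ)) / 2) ≤ d ^ q * lam ^ ((1 - (n : ℝ)) / 2) :=
        le_mul_of_one_le_left hl.le hdq
      have h6 : 0 ≤ (1 + C) * 2 ^ q * (d ^ q * lam ^ ((1 - (n : ℝ)) / 2)) := by positivity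
      linarith
    · have h4 := (h1 t ⟨ht.1.le, ht.2.le⟩).1
      have h5 := jap_rpow_le_delta h2 ht.1.le ht.2.le hq0
      have h6 : 1 + ‖V (s.sgn * t)‖ ≤ (1 + C) * lam := by linarith
      have hl' := Real.rpow_pos_of_pos h0 (-((n : ℝ) + 1) / 2)
      calc lam ^ (-((n : ℝ) + 1) / 2) * ((1 + ‖V (s.sgn * t)‖) * jap t ^ q)
          ≤ lam ^ (-((n : ℝ) + 1) / 2) * (((1 + C) * lam) * (2 ^ q * d ^ q)) := by
            gcongr
            exact Real.rpow_nonneg (jap_pos t).le _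
        _ = (1 + C) * 2 ^ q * (d ^ q * (lam ^ (-((n : ℝ) + 1) / 2) * lam)) := by ring
        _ = (1 + C) * 2 ^ q * (d ^ q * lam ^ ((1 - (n : ℝ)) / 2)) := by rw [e]
        _ ≤ _ := by gcongr; linarith

theorem Admissible.sideControl_of_unbounded (hV : Admissible (n + 1) V ν ε₁) {s : Side}
    (hb : ¬ BoundedAt s V) :
    SideControl n (fun t => V (s.sgn * t)) s.sgn (ν s)
      (fun lam => delta V ν ε₁ ε₂ lam s) (fun lam => width V ν ε₁ ε₂ lam s)
      (rate V ν ε₁ ε₂ s) (errBound n V ν ε₁ ε₂ s) := by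
  have hε := hV.eps_pos
  have hν := hV.neg_one_le_nu hb
  have hΔ : (fun lam => width V ν ε₁ ε₂ lam s)
      = fun lam => delta V ν ε₁ ε₂ lam s ^ (-ν s) / 4 := by
    funext lam; rw [width, if_neg hb]
  have hE : rate V ν ε₁ ε₂ s = fun lam => delta V ν ε₁ ε₂ lam s ^ (ν s + 1 + ε₁) := by
    funext lam; rw [rate, if_neg hb]
  rw [hΔ, hE]
  obtain ⟨hδ, hspec⟩ := hV.delta_spec (ε₂ := ε₂) hb
  have hb0 : 0 < ν s + 1 + ε₁ := by linarith
  obtain ⟨C, hC, hbound⟩ := hV.bound_of_unbounded (ε₂ := ε₂) hb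
  obtain ⟨c, hc, r, hr, hcr⟩ := hV.im_lower s
  obtain ⟨K, hK, hKe⟩ := hV.err_of_unbounded (ε₂ := ε₂) hb
  refine ⟨hδ, (tendsto_rpow_atTop hb0).comp hδ, ?_, ?_, ?_, ?_, ⟨c, hc, r, by linarith, hcr⟩,
    ?_, ?_, ?_, hV.decay_of_unbounded hb, ⟨K, hK, hKe.mono fun lam h => h.2⟩,
    ⟨K, hK, hKe.mono fun lam h => h.1⟩⟩
  · filter_upwards [hδ.eventually_gt_atTop 0] with lam h
    have := Real.rpow_pos_of_pos h (-ν s)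
    positivity
  · filter_upwards [hδ.eventually_ge_atTop 1] with lam h
    have : delta V ν ε₁ ε₂ lam s ^ (-ν s) ≤ delta V ν ε₁ ε₂ lam s ^ (1 : ℝ) :=
      Real.rpow_le_rpow_of_exponent_le h (by linarith)
    rw [Real.rpow_one] at this
    linarith
  · exact ⟨C, hC, 1 / 4, by norm_num, by norm_num, hbound⟩
  · exact fun η hη => hV.small_of_unbounded hb hη
  · intro η hη a
    rcases le_or_gt a 0 with ha | ha
    · filter_upwards [eventually_ge_atTop 1, hδ.eventually_gt_atTop 0] with lam h1 h2
      refine (Real.rpow_le_one_of_one_le_of_nonpos h1 ha).trans (Real.one_le_exp ?_)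
      have := Real.rpow_pos_of_pos h2 (ν s + 1 + ε₁)
      positivity
    · filter_upwards [hV.lam_le_exp (ε₂ := ε₂) hb (div_pos hη ha), eventually_gt_atTop 0]
        with lam h1 h2
      refine (Real.rpow_le_rpow h2.le h1 ha.le).trans (le_of_eq ?_)
      rw [← Real.exp_mul]
      congr 1
      field_simp
  · intro η hη
    simpa using hδ.eventually (eventually_rpow_le_exp 1 hb0 hη 1)
  · intro η hη
    filter_upwards [hδ.eventually (eventually_rpow_le_exp (ν s) hb0 hη 4),
      hδ.eventually_gt_atTop 0] with lam h1 h2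
    refine le_trans (le_of_eq ?_) h1
    rw [Real.rpow_neg h2.le]
    field_simp

theorem Admissible.sideControl (hV : Admissible (n + 1) V ν ε₁) (s : Side)
    (hε₂ : BoundedAt s V → 0 < ε₂ ∧ ε₂ < 1 - ν s) :
    SideControl n (fun t => V (s.sgn * t)) s.sgn (ν s)
      (fun lam => delta V ν ε₁ ε₂ lam s) (fun lam => width V ν ε₁ ε₂ lam s)
      (rate V ν ε₁ ε₂ s) (errBound n V ν ε₁ ε₂ s) := by
  by_cases hb : BoundedAt s V
  · exact hV.sideControl_of_bounded hb (hε₂ hb)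
  · exact hV.sideControl_of_unbounded hb

end

/-! ### Pointwise bounds for the eikonal and transport functions -/

section

variable {n : ℕ} {V : ℝ → ℂ} {lam x : ℝ}

theorem sub_mem_slitPlane (h0 : 0 < lam) (hre : (V x).re ≤ lam / 2) :
    (lam : ℂ) - V x ∈ Complex.slitPlane := by
  refine Complex.mem_slitPlane_iff.2 (Or.inl ?_)
  simp only [Complex.sub_re, Complex.ofReal_re]
  linarith

theorem root_re_pos (h0 : 0 < lam) (hre : (V x).re ≤ lam / 2) : 0 < (root V lam x).re := by
  rw [root, one_div, Complex.cpow_inv_two_re]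
  refine Real.sqrt_pos.2 ?_
  have := norm_nonneg ((lam : ℂ) - V x)
  simp only [Complex.sub_re, Complex.ofReal_re]
  linarith

theorem norm_root_sq_le {C : ℝ} (h0 : 0 < lam) (hC : ‖V x‖ ≤ C * lam) :
    ‖root V lam x‖ ^ 2 ≤ (1 + C) * lam := by
  rw [← norm_pow, root_sq]
  refine (norm_sub_le _ _).trans ?_
  rw [Complex.norm_real, Real.norm_of_nonneg h0.le]
  linarith

theorem norm_root_le {C : ℝ} (h0 : 0 < lam) (hC : ‖V x‖ ≤ C * lam) :
    ‖root V lam x‖ ≤ √(1 + C) * √lam := by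
  have hC0 : 0 ≤ 1 + C := by
    have h := (sq_nonneg ‖root V lam x‖).trans (norm_root_sq_le h0 hC)
    exact nonneg_of_mul_nonneg_left h h0
  rw [← Real.sqrt_mul hC0]
  exact Real.le_sqrt_of_sq_le (norm_root_sq_le h0 hC)

/-- (Re z)² ≥ Re z² = λ - Re V ≥ λ/2. -/
theorem root_re_lower (h0 : 0 < lam) (hre : (V x).re ≤ lam / 2) :
    √lam ≤ 2 * (root V lam x).re := by
  have h1 := congrArg Complex.re (root_sq V lam x)
  rw [sq, Complex.mul_re, Complex.sub_re, Complex.ofReal_re] at h1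
  refine Real.sqrt_le_iff.2 ⟨by linarith [root_re_pos h0 hre], ?_⟩
  nlinarith [mul_self_nonneg (root V lam x).im]

theorem re_I_mul_root (h0 : 0 < lam) (hre : (V x).re ≤ lam / 2) :
    (root V lam x * Complex.I).re = (V x).im / (2 * (root V lam x).re) := by
  have h1 := congrArg Complex.im (root_sq V lam x)
  rw [sq, Complex.mul_im, Complex.sub_im, Complex.ofReal_im] at h1
  have h2 := root_re_pos h0 hre
  rw [eq_div_iff (by positivity), Complex.mul_re, Complex.I_re, Complex.I_im]
  linarith

theorem norm_inv_root_pow_le (h0 : 0 < lam) (hre : (V x).re ≤ lam / 2) (m : ℕ) :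
    ‖(root V lam x)⁻¹ ^ (m + 2)‖ ≤ 2 ^ (m + 2) * (lam⁻¹ * (√lam)⁻¹ ^ m) := by
  have hs : 0 < √lam := Real.sqrt_pos.2 h0
  have hz : √lam ≤ 2 * ‖root V lam x‖ :=
    (root_re_lower h0 hre).trans (by have := Complex.re_le_norm (root V lam x); linarith)
  have hz0 : 0 < ‖root V lam x‖ := by linarith
  have h1 : ‖root V lam x‖⁻¹ ≤ 2 * (√lam)⁻¹ := by
    rw [inv_le_comm₀ hz0 (by positivity), mul_inv, inv_inv]; linarith
  rw [norm_pow, norm_inv]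
  calc ‖root V lam x‖⁻¹ ^ (m + 2) ≤ (2 * (√lam)⁻¹) ^ (m + 2) := by gcongr
    _ = 2 ^ (m + 2) * (((√lam) ^ 2)⁻¹ * (√lam)⁻¹ ^ m) := by
        rw [mul_pow, pow_add (√lam)⁻¹, inv_pow _ 2]; ring
    _ = _ := by rw [Real.sq_sqrt h0.le]

/-- Two of the m + 2 factors z⁻¹ produce e = (1+|V|)/λ, and the other m combine with w^m to t^m, t =
w/√λ. These are the parameters of `SymBound`. -/
theorem norm_jet_le {K C w : ℝ} (h0 : 0 < lam) (hre : (V x).re ≤ lam / 2) (hw : 0 ≤ w)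
    (hK : 0 ≤ K) (hC : K * 2 ^ (n + 3) ≤ C) {m : ℕ} (hm : m ≤ n + 1)
    (hd : ‖iteratedDeriv m V x‖ ≤ K * ((1 + ‖V x‖) * w ^ m)) :
    ‖jet V lam m x‖ ≤ C * ((1 + ‖V x‖) / lam) * (w / √lam) ^ m := by
  have hs : 0 < √lam := Real.sqrt_pos.2 h0
  rw [jet, norm_mul]
  have h1 := norm_inv_root_pow_le h0 hre m (V := V) (x := x)
  have h2 : (2 : ℝ) ^ (m + 2) ≤ 2 ^ (n + 3) := pow_le_pow_right₀ (by norm_num) (by omega)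
  calc ‖iteratedDeriv m V x‖ * ‖(root V lam x)⁻¹ ^ (m + 2)‖
      ≤ (K * ((1 + ‖V x‖) * w ^ m)) * (2 ^ (n + 3) * (lam⁻¹ * (√lam)⁻¹ ^ m)) := by
        refine mul_le_mul hd (h1.trans ?_) (norm_nonneg _) (by positivity)
        gcongr
    _ = (K * 2 ^ (n + 3)) * ((1 + ‖V x‖) / lam) * (w / √lam) ^ m := by
        rw [div_pow, inv_pow]; field_simp
    _ ≤ _ := by gcongr

/-- Uniform bounds for `logDer` and the transport remainder in terms of the derivatives of `V`. -/
theorem exists_logDer_bounds (n : ℕ) {K C : ℝ} (hK : 0 < K) (hC : 0 < C) :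
    ∃ A > 0, ∀ (V : ℝ → ℂ) (lam x w : ℝ), 1 ≤ lam → 0 ≤ w → w ≤ C * √lam → ‖V x‖ ≤ C * lam →
      (V x).re ≤ lam / 2 →
      (∀ m ≤ n + 1, ‖iteratedDeriv m V x‖ ≤ K * ((1 + ‖V x‖) * w ^ m)) →
      ‖logDer V n lam x - root V lam x * Complex.I‖ ≤ A * ((1 + ‖V x‖) * w) / lam ∧
      ‖root V lam x ^ 2 * MvPolynomial.eval (fun m => jet V lam m x) (symR n)‖
        ≤ A * ((1 + ‖V x‖) * (w / √lam) ^ (n + 1)) := by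
  set C₀ := K * 2 ^ (n + 3) + 1 + C with hC₀
  have hC₀0 : 0 < C₀ := by positivity
  have hj : ∀ j, ∃ B : ℝ, 0 ≤ B ∧ (j < n → ∀ (U : ℕ → ℂ) (e t : ℝ), 0 ≤ e → e ≤ C₀ → 0 ≤ t →
      t ≤ C₀ → (∀ m, 1 ≤ m → m ≤ n + 1 → ‖U m‖ ≤ C₀ * e * t ^ m) →
      ‖MvPolynomial.eval U (symQ (j + 1))‖ ≤ B * e * t ^ 1) := fun j => by
    by_cases h : j < n
    · obtain ⟨B, hB, h'⟩ := (((symQ_isSym j).symBound (M := n + 1) (by omega)).mono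
        (by omega : 1 ≤ j + 1)) C₀
      exact ⟨B, hB, fun _ => h'⟩
    · exact ⟨0, le_rfl, fun h' => absurd h' h⟩
  choose B hB hBq using hj
  obtain ⟨D, hD, hR⟩ := symR_bound n C₀
  refine ⟨√(1 + C) * ∑ j ∈ Finset.range n, B j + (1 + C) * D + 1, ?_, ?_⟩
  · have : 0 ≤ ∑ j ∈ Finset.range n, B j := Finset.sum_nonneg fun j _ => hB j
    positivity
  intro V lam x w h1 hw hwC hV hre hd
  have h0 : 0 < lam := by linarith
  have hs : 0 < √lam := Real.sqrt_pos.2 h0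
  have hn := norm_nonneg (V x)
  have he0 : 0 ≤ (1 + ‖V x‖) / lam := by positivity
  have heC : (1 + ‖V x‖) / lam ≤ C₀ := by
    rw [div_le_iff₀ h0, hC₀]
    have : 0 ≤ K * 2 ^ (n + 3) * lam := by positivity
    nlinarith
  have ht0 : 0 ≤ w / √lam := by positivity
  have htC : w / √lam ≤ C₀ := by
    rw [div_le_iff₀ hs, hC₀]
    have : 0 ≤ K * 2 ^ (n + 3) * √lam := by positivity
    nlinarith
  have hU : ∀ m, 1 ≤ m → m ≤ n + 1 →
      ‖jet V lam m x‖ ≤ C₀ * ((1 + ‖V x‖) / lam) * (w / √lam) ^ m := fun m _ hm =>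
    norm_jet_le h0 hre hw hK.le (by rw [hC₀]; linarith) hm (hd m hm)
  have hS0 : 0 ≤ ∑ j ∈ Finset.range n, B j := Finset.sum_nonneg fun j _ => hB j
  constructor
  · have e : logDer V n lam x - root V lam x * Complex.I
        = root V lam x * ∑ j ∈ Finset.range n, coeff V lam (j + 1) x := by
      rw [logDer, Finset.sum_range_succ', coeff_zero]; ring
    rw [e, norm_mul]
    have h2 : ‖∑ j ∈ Finset.range n, coeff V lam (j + 1) x‖
        ≤ (∑ j ∈ Finset.range n, B j) * ((1 + ‖V x‖) / lam * (w / √lam)) := by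
      refine (norm_sum_le _ _).trans ?_
      rw [Finset.sum_mul]
      refine Finset.sum_le_sum fun j hj => ?_
      have := hBq j (Finset.mem_range.1 hj) _ _ _ he0 heC ht0 htC hU
      rw [pow_one, mul_assoc] at this
      exact this
    calc ‖root V lam x‖ * ‖∑ j ∈ Finset.range n, coeff V lam (j + 1) x‖
        ≤ (√(1 + C) * √lam) * ((∑ j ∈ Finset.range n, B j) *
            ((1 + ‖V x‖) / lam * (w / √lam))) :=
          mul_le_mul (norm_root_le h0 hV) h2 (norm_nonneg _) (by positivity)
      _ = (√(1 + C) * ∑ j ∈ Finset.range n, B j) * ((1 + ‖V x‖) * w) / lam := by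
          field_simp
      _ ≤ _ := by
          gcongr
          have : 0 ≤ (1 + C) * D := by positivity
          linarith
  · rw [norm_mul, norm_pow]
    have h2 := hR _ _ _ he0 heC ht0 htC hU
    calc ‖root V lam x‖ ^ 2 * ‖MvPolynomial.eval (fun m => jet V lam m x) (symR n)‖
        ≤ ((1 + C) * lam) * (D * ((1 + ‖V x‖) / lam) * (w / √lam) ^ (n + 1)) :=
          mul_le_mul (norm_root_sq_le h0 hV) h2 (norm_nonneg _) (by positivity)
      _ = ((1 + C) * D) * ((1 + ‖V x‖) * (w / √lam) ^ (n + 1)) := by field_simp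
      _ ≤ _ := by
          gcongr
          have : 0 ≤ √(1 + C) * ∑ j ∈ Finset.range n, B j := by positivity
          linarith

end

/-! ### The logarithmic derivative along one end -/

section Side

variable {n : ℕ} {V : ℝ → ℂ} {ν : Side → ℝ} {ε₁ : ℝ} {s : Side} {δ Δ E B : ℝ → ℝ}

theorem SideControl.slitPlane (h : SideControl n (fun t => V (s.sgn * t)) s.sgn (ν s) δ Δ E B) :
    ∀ᶠ lam in atTop, ∀ t ∈ Icc 0 (δ lam), (lam : ℂ) - V (s.sgn * t) ∈ Complex.slitPlane := by
  obtain ⟨C, -, θ, -, -, hb⟩ := h.bound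
  filter_upwards [hb, eventually_gt_atTop 0] with lam h1 h0 t ht
  exact sub_mem_slitPlane h0 (h1 t ht).2.1

theorem SideControl.logDer_bounds (hV : Admissible (n + 1) V ν ε₁)
    (h : SideControl n (fun t => V (s.sgn * t)) s.sgn (ν s) δ Δ E B) :
    ∃ A > 0, ∀ᶠ lam in atTop, ∀ᵐ t, t ∈ Icc 0 (δ lam) →
      ‖logDer V n lam (s.sgn * t) - root V lam (s.sgn * t) * Complex.I‖
        ≤ A * ((1 + ‖V (s.sgn * t)‖) * jap t ^ ν s) / lam ∧
      ‖logDer V n lam (s.sgn * t)‖ ≤ A * √lam ∧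
      ‖root V lam (s.sgn * t) ^ 2 * MvPolynomial.eval (fun m => jet V lam m (s.sgn * t)) (symR n)‖
        ≤ A * B lam := by
  obtain ⟨K, hK, hd⟩ := hV.norm_iteratedDeriv_le s
  obtain ⟨C, hC, θ, hθ0, hθ1, hb⟩ := h.bound
  obtain ⟨A, hA, hAb⟩ := exists_logDer_bounds n hK hC
  obtain ⟨D, hD, herr⟩ := h.err
  refine ⟨A + (√(1 + C) + A * (1 + C) * C) + A * D, by positivity, ?_⟩
  have hd' : ∀ᵐ t, ∀ m ≤ n + 1, 0 ≤ t →
      ‖iteratedDeriv m V (s.sgn * t)‖ ≤ K * ((1 + ‖V (s.sgn * t)‖) * jap t ^ (m * ν s)) := by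
    rw [ae_all_iff]
    intro m
    by_cases hm : m ≤ n + 1
    · filter_upwards [hd m hm] with t ht _ using ht
    · exact ae_of_all _ fun t hm' => absurd hm' hm
  -- The error bound is available only on the open interval; the endpoints are discarded as null
  -- sets.
  have hne : ∀ a : ℝ, ∀ᵐ t : ℝ, t ≠ a := fun a => by simp [ae_iff]
  filter_upwards [hb, herr, eventually_ge_atTop 1] with lam h1 h2 h3
  filter_upwards [hd', hne 0, hne (δ lam)] with t ht hn1 hn2 hmem
  obtain ⟨h4, h5, h6⟩ := h1 t hmem
  have h0 : 0 < lam := by linarith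
  have hs : 0 < √lam := Real.sqrt_pos.2 h0
  have hw := Real.rpow_nonneg (jap_pos t).le (ν s)
  have h7 : jap t ^ ν s ≤ C * √lam := by
    refine h6.trans ?_
    rw [Real.sqrt_eq_rpow]
    gcongr
  obtain ⟨h8, h9⟩ := hAb V lam (s.sgn * t) (jap t ^ ν s) h3 hw h7 h4 h5 fun m hm => by
    have := ht m hm hmem.1
    rwa [mul_comm (m : ℝ), Real.rpow_mul (jap_pos t).le, Real.rpow_natCast] at this
  have hn := norm_nonneg (V (s.sgn * t))
  have hB : A * ((1 + ‖V (s.sgn * t)‖) * (jap t ^ ν s / √lam) ^ (n + 1)) ≤ A * (D * B lam) := by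
    refine mul_le_mul_of_nonneg_left (le_trans (le_of_eq ?_)
      (h2 t ⟨lt_of_le_of_ne hmem.1 hn1.symm, lt_of_le_of_ne hmem.2 hn2⟩)) hA.le
    have e1 : (jap t ^ ν s) ^ (n + 1) = jap t ^ (((n : ℝ) + 1) * ν s) := by
      rw [← Real.rpow_natCast, ← Real.rpow_mul (jap_pos t).le]; push_cast; congr 1; ring
    have e2 : ((√lam) ^ (n + 1))⁻¹ = lam ^ (-((n : ℝ) + 1) / 2) := by
      rw [Real.sqrt_eq_rpow, ← Real.rpow_natCast, ← Real.rpow_mul h0.le, ← Real.rpow_neg h0.le]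
      push_cast; congr 1; ring
    rw [div_pow, e1, div_eq_mul_inv, e2]; ring
  have hB0 : 0 ≤ D * B lam := le_of_mul_le_mul_left ((by
    rw [mul_zero]; positivity : A * 0 ≤ A * ((1 + ‖V (s.sgn * t)‖) *
      (jap t ^ ν s / √lam) ^ (n + 1))).trans hB) hA
  have hB1 : 0 ≤ B lam := nonneg_of_mul_nonneg_right hB0 hD
  have hpos1 : 0 ≤ √(1 + C) + A * (1 + C) * C := by positivity
  have hpos2 : 0 ≤ A * D := by positivity
  refine ⟨h8.trans ?_, ?_, h9.trans (hB.trans ?_)⟩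
  · gcongr
    linarith
  · have h10 : ‖logDer V n lam (s.sgn * t)‖
        ≤ A * ((1 + ‖V (s.sgn * t)‖) * jap t ^ ν s) / lam + √(1 + C) * √lam := by
      have e : logDer V n lam (s.sgn * t) = (logDer V n lam (s.sgn * t)
        - root V lam (s.sgn * t) * Complex.I) + root V lam (s.sgn * t) * Complex.I := by ring
      rw [e]
      refine (norm_add_le _ _).trans (add_le_add h8 ?_)
      rw [norm_mul, Complex.norm_I, mul_one]
      exact norm_root_le h0 h4
    have h11 : A * ((1 + ‖V (s.sgn * t)‖) * jap t ^ ν s) / lam ≤ A * (1 + C) * C * √lam := by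
      rw [div_le_iff₀ h0]
      calc A * ((1 + ‖V (s.sgn * t)‖) * jap t ^ ν s)
          ≤ A * (((1 + C) * lam) * (C * √lam)) := by
            have : 1 + ‖V (s.sgn * t)‖ ≤ (1 + C) * lam := by linarith
            gcongr
        _ = _ := by ring
    have : 0 ≤ (A + A * D) * √lam := by positivity
    nlinarith
  · have : 0 ≤ (A + (√(1 + C) + A * (1 + C) * C)) * B lam := by positivity
    nlinarith

/-- The modulus of the ansatz is governed by the integral of `|Im V|`. -/
theorem SideControl.re_logDer (hV : Admissible (n + 1) V ν ε₁)
    (h : SideControl n (fun t => V (s.sgn * t)) s.sgn (ν s) δ Δ E B) :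
    ∃ c > 0, ∃ r ≥ (1 : ℝ), ∃ A > 0, ∀ᶠ lam in atTop, ∀ᵐ t, t ∈ Icc 0 (δ lam) →
      (t ≤ r → |(logDer V n lam (s.sgn * t)).re| ≤ A / √lam) ∧
      (r ≤ t → c / √lam * |(V (s.sgn * t)).im| ≤ s.sgn * (logDer V n lam (s.sgn * t)).re) := by
  obtain ⟨C, hC, θ, hθ0, hθ1, hb⟩ := h.bound
  obtain ⟨A, hA, hAb⟩ := h.logDer_bounds hV
  obtain ⟨c, hc, r₁, hr₁, him⟩ := h.im_pos
  have hq : 0 < √(1 + C) := Real.sqrt_pos.2 (by positivity)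
  -- The threshold makes the correction at most half of the lower bound |Im V| / (2√(1+C)√λ) for the
  -- leading term.
  obtain ⟨r₂, hr₂, hsm⟩ := h.small ((A * √(1 + C) * 4)⁻¹) (by positivity)
  set r := max 1 (max r₁ r₂) with hr
  obtain ⟨M, hM⟩ := isCompact_Icc.exists_bound_of_continuousOn (s := Icc 0 r)
    (f := fun t => V (s.sgn * t))
    (hV.continuous.comp (continuous_const.mul continuous_id)).continuousOn
  obtain ⟨L, hL⟩ := isCompact_Icc.exists_bound_of_continuousOn (s := Icc 0 r)
    (continuous_jap_rpow (ν s)).continuousOn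
  refine ⟨(√(1 + C) * 4)⁻¹, by positivity, r, le_max_left _ _,
    |M| + A * ((1 + |M|) * |L|) + 1, by positivity, ?_⟩
  filter_upwards [hb, hAb, hsm, eventually_ge_atTop 1] with lam h1 h2 h3 h4
  filter_upwards [h2] with t h5 hmem
  obtain ⟨h6, -, -⟩ := h5 hmem
  obtain ⟨h7, h8, -⟩ := h1 t hmem
  have h0 : 0 < lam := by linarith
  have hs : 0 < √lam := Real.sqrt_pos.2 h0
  have hs1 : √lam ≤ lam := by
    rw [Real.sqrt_le_left h0.le]; nlinarith
  have hz := root_re_pos h0 h8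
  have hz1 := root_re_lower h0 h8
  have hz2 : (root V lam (s.sgn * t)).re ≤ √(1 + C) * √lam :=
    (Complex.re_le_norm _).trans (norm_root_le h0 h7)
  have hdiff : |(logDer V n lam (s.sgn * t)).re
      - (V (s.sgn * t)).im / (2 * (root V lam (s.sgn * t)).re)|
      ≤ A * ((1 + ‖V (s.sgn * t)‖) * jap t ^ ν s) / lam := by
    rw [← re_I_mul_root h0 h8, ← Complex.sub_re]
    exact (Complex.abs_re_le_norm _).trans h6
  constructor
  · intro htr
    have h9 := (hM t ⟨hmem.1, htr⟩).trans (le_abs_self M)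
    have h10 := ((le_abs_self _).trans (hL t ⟨hmem.1, htr⟩)).trans (le_abs_self L)
    have h11 : |(V (s.sgn * t)).im / (2 * (root V lam (s.sgn * t)).re)| ≤ |M| / √lam := by
      rw [abs_div, abs_of_pos (by linarith : 0 < 2 * (root V lam (s.sgn * t)).re)]
      exact div_le_div₀ (abs_nonneg _) ((Complex.abs_im_le_norm _).trans h9) hs hz1
    have h12 : A * ((1 + ‖V (s.sgn * t)‖) * jap t ^ ν s) / lam
        ≤ A * ((1 + |M|) * |L|) / √lam := by
      have := Real.rpow_nonneg (jap_pos t).le (ν s)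
      gcongr
    have h13 : |(logDer V n lam (s.sgn * t)).re| ≤ |M| / √lam + A * ((1 + |M|) * |L|) / √lam := by
      have := abs_sub_abs_le_abs_sub (logDer V n lam (s.sgn * t)).re
        ((V (s.sgn * t)).im / (2 * (root V lam (s.sgn * t)).re))
      linarith
    refine h13.trans ?_
    rw [← add_div]
    exact div_le_div_of_nonneg_right (by linarith) hs.le
  · intro hrt
    have h9 := h3 t ⟨(le_max_right _ _).trans ((le_max_right _ _).trans hrt), hmem.2⟩
    have h10 := him t ((le_max_left _ _).trans ((le_max_right _ _).trans hrt))
    have h11 : s.sgn * (V (s.sgn * t)).im = |(V (s.sgn * t)).im| := by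
      rw [← abs_of_pos (hc.trans_le h10), abs_mul, s.abs_sgn, one_mul]
    set I := |(V (s.sgn * t)).im|
    have hI : 0 ≤ I := abs_nonneg _
    have h12 : A * ((1 + ‖V (s.sgn * t)‖) * jap t ^ ν s) / lam
        ≤ (√(1 + C) * 4)⁻¹ / √lam * I := by
      rw [div_le_iff₀ h0]
      calc A * ((1 + ‖V (s.sgn * t)‖) * jap t ^ ν s)
          ≤ A * ((A * √(1 + C) * 4)⁻¹ * √lam * I) := by gcongr
        _ = (√(1 + C) * 4)⁻¹ / √lam * I * (√lam * √lam) := by field_simp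
        _ = _ := by rw [Real.mul_self_sqrt h0.le]
    have h13 : (√(1 + C) * 2)⁻¹ / √lam * I
        ≤ s.sgn * ((V (s.sgn * t)).im / (2 * (root V lam (s.sgn * t)).re)) := by
      rw [← mul_div_assoc, h11]
      calc (√(1 + C) * 2)⁻¹ / √lam * I = I / (2 * (√(1 + C) * √lam)) := by field_simp
        _ ≤ _ := by gcongr
    have h14 : s.sgn * ((V (s.sgn * t)).im / (2 * (root V lam (s.sgn * t)).re))
        - s.sgn * (logDer V n lam (s.sgn * t)).re
        ≤ A * ((1 + ‖V (s.sgn * t)‖) * jap t ^ ν s) / lam := by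
      rw [← mul_sub]
      refine (le_abs_self _).trans ?_
      rw [abs_mul, s.abs_sgn, one_mul, abs_sub_comm]
      exact hdiff
    have e : (√(1 + C) * 2)⁻¹ / √lam * I = 2 * ((√(1 + C) * 4)⁻¹ / √lam * I) := by
      field_simp
      ring
    linarith

end Side

/-! ### Size of the ansatz -/

section

variable {n : ℕ} {V : ℝ → ℂ} {ν : Side → ℝ} {ε₁ : ℝ} {s : Side} {δ Δ E B : ℝ → ℝ} {lam : ℝ}

theorem Admissible.lipAt_logDer (hV : Admissible (n + 1) V ν ε₁) {x : ℝ}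
    (hx : (lam : ℂ) - V x ∈ Complex.slitPlane) : LipAt (logDer V n lam) x :=
  JWKB.lipAt_logDer hx fun _ hm => (hV.hasLipDeriv hm).lip x

theorem Admissible.ansatz_eq (hV : Admissible (n + 1) V ν ε₁) (hlam : 0 < lam) {x : ℝ}
    (hx : ∀ y ∈ uIcc 0 x, (lam : ℂ) - V y ∈ Complex.slitPlane) :
    ansatz V n lam x = Complex.exp (-∫ t in (0 : ℝ)..x, logDer V n lam t) :=
  JWKB.ansatz_eq hlam (hV.sobolev.regularity hV.continuous).1
    (fun _ hm => (hV.hasLipDeriv hm).lip) hx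

theorem Side.mem_uIcc (s : Side) {t y : ℝ} (ht : 0 ≤ t) (hy : y ∈ uIcc 0 (s.sgn * t)) :
    s.sgn * y ∈ Icc 0 t := by
  cases s <;> simp only [Side.sgn, neg_mul, one_mul] at hy ⊢
  · rw [uIcc_of_ge (by linarith)] at hy
    exact ⟨by linarith [hy.2], by linarith [hy.1]⟩
  · rwa [uIcc_of_le ht] at hy

theorem Admissible.continuousOn_re_logDer (hV : Admissible (n + 1) V ν ε₁) {T : ℝ}
    (hx : ∀ y ∈ Icc 0 T, (lam : ℂ) - V (s.sgn * y) ∈ Complex.slitPlane) :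
    ContinuousOn (fun τ => s.sgn * (logDer V n lam (s.sgn * τ)).re) (Icc 0 T) := fun τ hτ => by
  have h1 : ContinuousAt (logDer V n lam) (s.sgn * τ) := (hV.lipAt_logDer (hx τ hτ)).continuousAt
  have h2 : ContinuousAt (fun τ : ℝ => s.sgn * τ) τ :=
    (continuous_const.mul continuous_id).continuousAt
  have h3 : ContinuousAt (fun τ => logDer V n lam (s.sgn * τ)) τ :=
    ContinuousAt.comp (f := fun τ : ℝ => s.sgn * τ) h1 h2
  exact (continuousAt_const.mul (Complex.continuous_re.continuousAt.comp h3)).continuousWithinAt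

theorem Admissible.norm_ansatz (hV : Admissible (n + 1) V ν ε₁) (hlam : 0 < lam) {t : ℝ}
    (ht : 0 ≤ t) (hx : ∀ y ∈ Icc 0 t, (lam : ℂ) - V (s.sgn * y) ∈ Complex.slitPlane) :
    ‖ansatz V n lam (s.sgn * t)‖
      = Real.exp (-∫ τ in (0 : ℝ)..t, s.sgn * (logDer V n lam (s.sgn * τ)).re) := by
  have hy : ∀ y ∈ uIcc 0 (s.sgn * t), (lam : ℂ) - V y ∈ Complex.slitPlane := fun y hy => by
    have := hx _ (s.mem_uIcc ht hy)
    rwa [s.sgn_mul_cancel] at this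
  have hint : IntervalIntegrable (logDer V n lam) volume 0 (s.sgn * t) :=
    ContinuousOn.intervalIntegrable fun y h =>
      (hV.lipAt_logDer (hy y h)).continuousAt.continuousWithinAt
  rw [hV.ansatz_eq hlam hy, Complex.norm_exp, Complex.neg_re]
  have h1 : (∫ τ in (0 : ℝ)..(s.sgn * t), logDer V n lam τ).re
      = ∫ τ in (0 : ℝ)..(s.sgn * t), (logDer V n lam τ).re :=
    (Complex.reCLM.intervalIntegral_comp_comm hint).symm
  have h2 := s.integral_comp (fun τ => (logDer V n lam τ).re) 0 t
  rw [mul_zero] at h2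
  rw [h1, h2, intervalIntegral.integral_const_mul, smul_eq_mul]

/-- The ansatz is exponentially small in the transition regions and bounded below near `0`. -/
theorem SideControl.norm_ansatz (hV : Admissible (n + 1) V ν ε₁)
    (h : SideControl n (fun t => V (s.sgn * t)) s.sgn (ν s) δ Δ E B) :
    ∃ A > 0, ∃ c > 0, ∀ᶠ lam in atTop,
      (∀ t ∈ Icc (δ lam - Δ lam) (δ lam),
        ‖ansatz V n lam (s.sgn * t)‖ ≤ A * Real.exp (-c * E lam)) ∧
      ∀ t ∈ Icc 0 1, A⁻¹ ≤ ‖ansatz V n lam (s.sgn * t)‖ := by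
  obtain ⟨c, hc, r, hr, A, hA, hre⟩ := h.re_logDer hV
  obtain ⟨c', hc', hdec⟩ := h.decay
  have hcont : Continuous fun t => |(V (s.sgn * t)).im| :=
    (Complex.continuous_im.comp (hV.continuous.comp (continuous_const.mul continuous_id))).abs
  set m := ∫ τ in (0 : ℝ)..r, |(V (s.sgn * τ)).im| with hm
  have hm0 : 0 ≤ m := intervalIntegral.integral_nonneg (by linarith) fun _ _ => abs_nonneg _
  -- A r covers [0, r], where Re Ψ has no prescribed sign, and c m compensates for the part of ∫|Im
  -- V| over [0, r] counted in the decay estimate.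
  refine ⟨Real.exp (A * r + c * m), Real.exp_pos _, c * c', by positivity, ?_⟩
  filter_upwards [hre, hdec, h.slitPlane, h.width_le, h.tendsto_delta.eventually_ge_atTop (2 * r),
    eventually_ge_atTop 1] with lam h1 h2 h3 h4 h5 h6
  have h0 : 0 < lam := by linarith
  have hs1 : 1 ≤ √lam := Real.one_le_sqrt.2 h6
  have hs : 0 < √lam := by linarith
  have hcL := hV.continuousOn_re_logDer h3
  set φ := fun τ => s.sgn * (logDer V n lam (s.sgn * τ)).re with hφ
  have hi : ∀ a b, 0 ≤ a → a ≤ b → b ≤ δ lam → IntervalIntegrable φ volume a b := fun a b h h' h'' =>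
    (hcL.mono (by rw [uIcc_of_le h']; exact Icc_subset_Icc h h'')).intervalIntegrable
  have hsmall : ∀ t, 0 ≤ t → t ≤ r → |∫ τ in (0 : ℝ)..t, φ τ| ≤ A * r := fun t ht htr => by
    have := intervalIntegral.norm_integral_le_of_norm_le_const_ae (a := 0) (b := t) (f := φ)
      (C := A) (by
        filter_upwards [h1] with τ hτ hmem
        rw [uIoc_of_le ht] at hmem
        have h7 := (hτ ⟨hmem.1.le, by linarith [hmem.2]⟩).1 (hmem.2.trans htr)
        rw [hφ, Real.norm_eq_abs]
        simp only [abs_mul, s.abs_sgn, one_mul]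
        exact h7.trans (div_le_self hA.le hs1))
    rw [Real.norm_eq_abs, sub_zero, abs_of_nonneg ht] at this
    exact this.trans (by gcongr)
  constructor
  · intro t ht
    have htr : r ≤ t := by linarith [ht.1]
    have ht0 : 0 ≤ t := by linarith
    rw [hV.norm_ansatz h0 ht0 fun y hy => h3 y ⟨hy.1, hy.2.trans ht.2⟩, ← Real.exp_add]
    refine Real.exp_le_exp.2 ?_
    have h7 := (abs_le.1 (hsmall r (by linarith) le_rfl)).1
    have h8 : ∫ τ in r..t, c / √lam * |(V (s.sgn * τ)).im| ≤ ∫ τ in r..t, φ τ := by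
      refine intervalIntegral.integral_mono_ae_restrict htr
        ((continuous_const.mul hcont).intervalIntegrable _ _) (hi r t (by linarith) htr ht.2) ?_
      refine (ae_restrict_iff' measurableSet_Icc).2 ?_
      filter_upwards [h1] with τ hτ hmem
      exact (hτ ⟨by linarith [hmem.1], hmem.2.trans ht.2⟩).2 hmem.1
    have h9 := intervalIntegral.integral_add_adjacent_intervals (hi 0 r le_rfl (by linarith)
      (by linarith)) (hi r t (by linarith) htr ht.2)
    have h10 := intervalIntegral.integral_add_adjacent_intervals
      (hcont.intervalIntegrable (μ := volume) 0 r) (hcont.intervalIntegrable (μ := volume) r t)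
    have h11 := h2 t ht
    rw [intervalIntegral.integral_const_mul] at h8
    have h12 : c * c' * E lam - c * m ≤ c / √lam * ∫ τ in r..t, |(V (s.sgn * τ)).im| := by
      have h13 : c' * E lam * √lam - m * √lam ≤ ∫ τ in r..t, |(V (s.sgn * τ)).im| := by
        have : m ≤ m * √lam := le_mul_of_one_le_right hm0 hs1
        linarith
      calc c * c' * E lam - c * m = c / √lam * (c' * E lam * √lam - m * √lam) := by field_simp
        _ ≤ _ := by gcongr
    change -(∫ τ in (0 : ℝ)..t, φ τ) ≤ _
    linarith
  · intro t ht
    rw [hV.norm_ansatz h0 ht.1 fun y hy => h3 y ⟨hy.1, by linarith [hy.2, ht.2]⟩, ← Real.exp_neg]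
    refine Real.exp_le_exp.2 ?_
    have h7 := (abs_le.1 (hsmall t ht.1 (ht.2.trans hr))).2
    have : 0 ≤ c * m := by positivity
    change _ ≤ -(∫ τ in (0 : ℝ)..t, φ τ)
    linarith

end

/-! ### The truncated ansatz -/

/-- `η` is a smooth function supported in an interval around `0` on which `lam - V` avoids the
cut of the principal square root. -/
structure SlitCutoff (V : ℝ → ℂ) (lam a b : ℝ) (η : ℝ → ℝ) : Prop where
  pos : 0 < lam
  left : a ≤ 0
  right : 0 ≤ b
  smooth : ContDiff ℝ ∞ η
  eq_zero : ∀ x ∉ Ioo a b, η x = 0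
  slit : ∀ x ∈ Icc a b, (lam : ℂ) - V x ∈ Complex.slitPlane

/-- The remainder of the transport equations, as a multiplier of the ansatz. -/
noncomputable def remainder (V : ℝ → ℂ) (n : ℕ) (lam x : ℝ) : ℂ :=
  root V lam x ^ 2 * MvPolynomial.eval (fun m => jet V lam m x) (symR n)

namespace SlitCutoff

variable {n : ℕ} {V : ℝ → ℂ} {ν : Side → ℝ} {ε₁ lam a b : ℝ} {η : ℝ → ℝ}

theorem eventually_eq_zero (h : SlitCutoff V lam a b η) {x : ℝ} (hx : x ∉ Icc a b) :
    η =ᶠ[𝓝 x] fun _ => 0 := by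
  filter_upwards [isClosed_Icc.isOpen_compl.mem_nhds hx] with y hy
  exact h.eq_zero y fun h' => hy ⟨h'.1.le, h'.2.le⟩

theorem iteratedDeriv_eq_zero (h : SlitCutoff V lam a b η) (j : ℕ) {x : ℝ} (hx : x ∉ Icc a b) :
    iteratedDeriv j η x = 0 := by
  rw [((h.eventually_eq_zero hx).iteratedDeriv_eq j)]
  rw [iteratedDeriv_const]
  split <;> rfl

theorem hasDerivAt_iteratedDeriv (h : SlitCutoff V lam a b η) (j : ℕ) (x : ℝ) :
    HasDerivAt (fun y => ((iteratedDeriv j η y : ℝ) : ℂ)) ((iteratedDeriv (j + 1) η x : ℝ) : ℂ) x := by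
  rw [iteratedDeriv_succ]
  refine HasDerivAt.ofReal_comp ?_
  exact ((h.smooth.differentiable_iteratedDeriv j (by exact_mod_cast ENat.natCast_lt_top j)) x).hasDerivAt

theorem lipAt_iteratedDeriv (h : SlitCutoff V lam a b η) (j : ℕ) (x : ℝ) :
    LipAt (fun y => ((iteratedDeriv j η y : ℝ) : ℂ)) x := by
  refine LipAt.of_contDiffAt (ContDiff.contDiffAt ?_)
  rw [iteratedDeriv_eq_iterate]
  exact Complex.ofRealCLM.contDiff.comp ((h.smooth.iterate_deriv j).of_le (by simp))

/-- Nothing is known about `G` off [a, b], but the product vanishes identically near every such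
point. -/
theorem lipAt_mul (h : SlitCutoff V lam a b η) (j : ℕ) {G : ℝ → ℂ}
    (hG : ∀ x ∈ Icc a b, LipAt G x) (x : ℝ) :
    LipAt (fun y => ((iteratedDeriv j η y : ℝ) : ℂ) * G y) x := by
  by_cases hx : x ∈ Icc a b
  · exact (h.lipAt_iteratedDeriv j x).mul (hG x hx)
  · refine (LipAt.const 0 x).congr ?_
    filter_upwards [isClosed_Icc.isOpen_compl.mem_nhds hx] with y hy
    rw [h.iteratedDeriv_eq_zero j hy]; simp

theorem memLp_mul (h : SlitCutoff V lam a b η) (j : ℕ) {G : ℝ → ℂ}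
    (hG : ∀ x ∈ Icc a b, LipAt G x) :
    MemLp (fun y => ((iteratedDeriv j η y : ℝ) : ℂ) * G y) 2 volume := by
  refine Continuous.memLp_of_hasCompactSupport
    (continuous_iff_continuousAt.2 fun x => (h.lipAt_mul j hG x).continuousAt)
    (HasCompactSupport.intro (isCompact_Icc (a := a) (b := b)) fun x hx => ?_)
  rw [h.iteratedDeriv_eq_zero j hx]; simp

/-- Room beyond the endpoints makes the exponential formula, and hence the derivative of the ansatz,
valid on both sides of a and b. -/
theorem exists_Ioo (h : SlitCutoff V lam a b η) (hV : Continuous V) :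
    ∃ a' < a, ∃ b' > b, ∀ x ∈ Ioo a' b', (lam : ℂ) - V x ∈ Complex.slitPlane := by
  have hab : a ≤ b := h.left.trans h.right
  have hS := isOpen_slitPlane_preimage hV lam
  obtain ⟨a', u, ha, hau⟩ := mem_nhds_iff_exists_Ioo_subset.1
    (hS.mem_nhds (h.slit a ⟨le_rfl, hab⟩))
  obtain ⟨l, b', hb, hlb⟩ := mem_nhds_iff_exists_Ioo_subset.1
    (hS.mem_nhds (h.slit b ⟨hab, le_rfl⟩))
  refine ⟨a', ha.1, b', hb.2, fun x hx => ?_⟩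
  rcases lt_or_ge x a with h1 | h1
  · exact hau ⟨hx.1, h1.trans ha.2⟩
  rcases le_or_gt x b with h2 | h2
  · exact h.slit x ⟨h1, h2⟩
  · exact hlb ⟨hb.1.trans h2, hx.2⟩

theorem hasStrictDerivAt_ansatz (h : SlitCutoff V lam a b η) (hV : Admissible (n + 1) V ν ε₁)
    {x : ℝ} (hx : x ∈ Icc a b) :
    HasStrictDerivAt (ansatz V n lam) (-(logDer V n lam x * ansatz V n lam x)) x := by
  obtain ⟨a', ha, b', hb, hI⟩ := h.exists_Ioo hV.continuous
  have hxI : x ∈ Ioo a' b' := ⟨ha.trans_le hx.1, hx.2.trans_lt hb⟩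
  have h0I : (0 : ℝ) ∈ Ioo a' b' := ⟨ha.trans_le h.left, h.right.trans_lt hb⟩
  have hu : ∀ y ∈ Ioo a' b', ∀ z ∈ uIcc 0 y, (lam : ℂ) - V z ∈ Complex.slitPlane :=
    fun y hy z hz => hI z (ordConnected_Ioo.uIcc_subset h0I hy hz)
  have hc : ContinuousOn (logDer V n lam) (Ioo a' b') := fun y hy =>
    (hV.lipAt_logDer (hI y hy)).continuousAt.continuousWithinAt
  have hint : IntervalIntegrable (logDer V n lam) volume 0 x :=
    (hc.mono (ordConnected_Ioo.uIcc_subset h0I hxI)).intervalIntegrable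
  have h1 := intervalIntegral.integral_hasStrictDerivAt_right hint
    (hc.stronglyMeasurableAtFilter isOpen_Ioo x hxI) (hV.lipAt_logDer (hI x hxI)).continuousAt
  have h2 := HasStrictDerivAt.cexp (HasStrictDerivAt.fun_neg h1)
  have e : (fun y => Complex.exp (-∫ t in (0 : ℝ)..y, logDer V n lam t))
      =ᶠ[𝓝 x] ansatz V n lam := by
    filter_upwards [isOpen_Ioo.mem_nhds hxI] with y hy
    exact (hV.ansatz_eq h.pos (hu y hy)).symm
  refine (h2.congr_of_eventuallyEq e).congr_deriv ?_
  rw [hV.ansatz_eq h.pos (hu x hxI)]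
  ring

theorem lipAt_ansatz (h : SlitCutoff V lam a b η) (hV : Admissible (n + 1) V ν ε₁)
    {x : ℝ} (hx : x ∈ Icc a b) : LipAt (ansatz V n lam) x :=
  (h.hasStrictDerivAt_ansatz hV hx).hasStrictFDerivAt.isBigO_sub

theorem lipAt_logDer_mul_ansatz (h : SlitCutoff V lam a b η) (hV : Admissible (n + 1) V ν ε₁)
    {x : ℝ} (hx : x ∈ Icc a b) : LipAt (fun y => logDer V n lam y * ansatz V n lam y) x :=
  (hV.lipAt_logDer (h.slit x hx)).mul (h.lipAt_ansatz hV hx)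

theorem deriv_mul_deriv_ansatz (h : SlitCutoff V lam a b η) (hV : Admissible (n + 1) V ν ε₁)
    (x : ℝ) : ((deriv η x : ℝ) : ℂ) * deriv (ansatz V n lam) x
      = -(((iteratedDeriv 1 η x : ℝ) : ℂ) * (logDer V n lam x * ansatz V n lam x)) := by
  rw [← iteratedDeriv_one]
  by_cases hx : x ∈ Icc a b
  · rw [(h.hasStrictDerivAt_ansatz hV hx).hasDerivAt.deriv]; ring
  · rw [h.iteratedDeriv_eq_zero 1 hx]; simp

theorem hasLipDeriv (h : SlitCutoff V lam a b η) (hV : Admissible (n + 1) V ν ε₁) :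
    HasLipDeriv (fun x => (η x : ℂ) * ansatz V n lam x)
      (fun x => ((iteratedDeriv 1 η x : ℝ) : ℂ) * ansatz V n lam x
        + -((η x : ℂ) * (logDer V n lam x * ansatz V n lam x))) where
  lip x := by simpa using h.lipAt_mul 0 (fun x hx => h.lipAt_ansatz hV hx) x
  ae_deriv := ae_of_all _ fun x => by
    by_cases hx : x ∈ Icc a b
    · have h1 := (h.hasDerivAt_iteratedDeriv 0 x).mul (h.hasStrictDerivAt_ansatz hV hx).hasDerivAt
      simp only [iteratedDeriv_zero, zero_add] at h1
      refine h1.congr_deriv ?_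
      ring
    · rw [h.iteratedDeriv_eq_zero 1 hx, (h.eventually_eq_zero hx).eq_of_nhds]
      refine ((hasDerivAt_const x (0 : ℂ)).congr_of_eventuallyEq ?_).congr_deriv (by simp)
      filter_upwards [h.eventually_eq_zero hx] with y hy
      rw [hy]; simp

/-- Since (Ψg)' = (Ψ' - Ψ²)g, the Riccati equation replaces it by (λ - V + remainder)g, at the
points where the top derivative of V exists. -/
theorem hasLipDeriv_two (h : SlitCutoff V lam a b η) (hV : Admissible (n + 1) V ν ε₁) :
    HasLipDeriv (fun x => ((iteratedDeriv 1 η x : ℝ) : ℂ) * ansatz V n lam x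
        + -((η x : ℂ) * (logDer V n lam x * ansatz V n lam x)))
      (fun x => ((iteratedDeriv 2 η x : ℝ) : ℂ) * ansatz V n lam x
        - 2 * (((iteratedDeriv 1 η x : ℝ) : ℂ) * (logDer V n lam x * ansatz V n lam x))
        - (η x : ℂ) * ((lam - V x + remainder V n lam x) * ansatz V n lam x)) where
  lip x := (h.lipAt_mul 1 (fun x hx => h.lipAt_ansatz hV hx) x).add
    (by simpa using h.lipAt_mul 0 (fun x hx => h.lipAt_logDer_mul_ansatz hV hx) x : LipAt _ x).neg
  ae_deriv := by
    have hd : ∀ᵐ x, ∀ m ≤ n, HasDerivAt (iteratedDeriv m V) (iteratedDeriv (m + 1) V x) x := by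
      rw [ae_all_iff]
      intro m
      by_cases hm : m ≤ n
      · filter_upwards [(hV.hasLipDeriv hm).ae_deriv] with x hx _ using hx
      · exact ae_of_all _ fun _ h' => absurd h' hm
    filter_upwards [hd] with x hxd
    by_cases hx : x ∈ Icc a b
    · have hg := (h.hasStrictDerivAt_ansatz hV hx).hasDerivAt
      have hL := hasDerivAt_logDer (h.slit x hx) hxd
      have h1 := (h.hasDerivAt_iteratedDeriv 1 x).mul hg
      have h0 := (h.hasDerivAt_iteratedDeriv 0 x).mul (hL.mul hg)
      simp only [iteratedDeriv_zero, zero_add] at h0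
      refine (h1.add h0.neg).congr_deriv ?_
      rw [remainder]
      simp only [Pi.mul_apply]
      ring
    · rw [h.iteratedDeriv_eq_zero 1 hx, h.iteratedDeriv_eq_zero 2 hx,
        (h.eventually_eq_zero hx).eq_of_nhds]
      refine ((hasDerivAt_const x (0 : ℂ)).congr_of_eventuallyEq ?_).congr_deriv (by simp)
      filter_upwards [isClosed_Icc.isOpen_compl.mem_nhds hx] with y hy
      rw [h.iteratedDeriv_eq_zero 1 hy, (h.eventually_eq_zero hy).eq_of_nhds]
      simp

theorem isWeakDeriv_two (h : SlitCutoff V lam a b η) (hV : Admissible (n + 1) V ν ε₁) :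
    IsWeakDeriv 2 (fun x => (η x : ℂ) * ansatz V n lam x)
      (fun x => ((iteratedDeriv 2 η x : ℝ) : ℂ) * ansatz V n lam x
        - 2 * (((iteratedDeriv 1 η x : ℝ) : ℂ) * (logDer V n lam x * ansatz V n lam x))
        - (η x : ℂ) * ((lam - V x + remainder V n lam x) * ansatz V n lam x)) :=
  (h.hasLipDeriv hV).isWeakDeriv.trans (h.hasLipDeriv_two hV).isWeakDeriv

theorem schrodinger_sub (h : SlitCutoff V lam a b η) (hV : Admissible (n + 1) V ν ε₁) :
    ∀ᵐ x, schrodinger V (fun x => (η x : ℂ) * ansatz V n lam x) x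
        - lam * ((η x : ℂ) * ansatz V n lam x)
      = -(((iteratedDeriv 2 η x : ℝ) : ℂ) * ansatz V n lam x)
        + 2 * (((iteratedDeriv 1 η x : ℝ) : ℂ) * (logDer V n lam x * ansatz V n lam x))
        + remainder V n lam x * ((η x : ℂ) * ansatz V n lam x) := by
  have h1 := h.isWeakDeriv_two hV
  filter_upwards [(isWeakDeriv_weakDeriv ⟨_, h1⟩).ae_eq h1] with x hx
  rw [schrodinger, hx]
  ring

theorem memLp (h : SlitCutoff V lam a b η) (hV : Admissible (n + 1) V ν ε₁) :
    MemLp (fun x => (η x : ℂ) * ansatz V n lam x) 2 volume := by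
  simpa using h.memLp_mul 0 fun x hx => h.lipAt_ansatz hV hx

/-- Measurability of the remainder term is read off the equation satisfied by H_V f, whose weak
derivative is measurable by definition; the bound M then gives square integrability. -/
theorem memLp_schrodinger_sub (h : SlitCutoff V lam a b η) (hV : Admissible (n + 1) V ν ε₁) {M : ℝ}
    (hM : ∀ᵐ x, x ∈ Icc a b → ‖remainder V n lam x‖ ≤ M) :
    MemLp (fun x => remainder V n lam x * ((η x : ℂ) * ansatz V n lam x)) 2 volume ∧
    MemLp (schrodinger V (fun x => (η x : ℂ) * ansatz V n lam x)) 2 volume := by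
  set f := fun x => (η x : ℂ) * ansatz V n lam x with hf
  have h1 := h.isWeakDeriv_two hV
  have h2 := isWeakDeriv_weakDeriv ⟨_, h1⟩
  have hfm := h.memLp hV
  have hVf : MemLp (fun x => (lam : ℂ) * f x) 2 volume := hfm.const_mul _
  have hm2 := h.memLp_mul 2 fun x hx => h.lipAt_ansatz hV hx
  have hm1 := (h.memLp_mul 1 fun x hx => h.lipAt_logDer_mul_ansatz hV hx).const_mul 2
  have hsm : AEStronglyMeasurable (schrodinger V f) volume :=
    h2.2.1.aestronglyMeasurable.neg.add
      (hV.continuous.aestronglyMeasurable.mul hfm.aestronglyMeasurable)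
  have hRe : (fun x => remainder V n lam x * f x) =ᵐ[volume] fun x =>
      (schrodinger V f x - lam * f x) + ((iteratedDeriv 2 η x : ℝ) : ℂ) * ansatz V n lam x
        - 2 * (((iteratedDeriv 1 η x : ℝ) : ℂ) * (logDer V n lam x * ansatz V n lam x)) := by
    filter_upwards [h.schrodinger_sub hV] with x hx
    rw [hf] at *
    rw [hx]; ring
  have hRm : AEStronglyMeasurable (fun x => remainder V n lam x * f x) volume :=
    (((hsm.sub hVf.aestronglyMeasurable).add hm2.aestronglyMeasurable).sub
      hm1.aestronglyMeasurable).congr hRe.symm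
  have hR : MemLp (fun x => remainder V n lam x * f x) 2 volume := by
    refine hfm.of_le_mul (c := M) hRm ?_
    filter_upwards [hM] with x hx
    rw [norm_mul]
    by_cases hmem : x ∈ Icc a b
    · exact mul_le_mul_of_nonneg_right (hx hmem) (norm_nonneg _)
    · have : η x = 0 := (h.eventually_eq_zero hmem).eq_of_nhds
      simp [hf, this]
  refine ⟨hR, (((hVf.sub hm2).add hm1).add hR).ae_eq ?_⟩
  filter_upwards [h.schrodinger_sub hV] with x hx
  simp only [Pi.add_apply, Pi.sub_apply]
  rw [sub_eq_iff_eq_add.1 hx]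
  ring

end SlitCutoff

/-! ### Elementary bounds for the norm of `L²(ℝ)` -/

theorem l2norm_nonneg (u : ℝ → ℂ) : 0 ≤ l2norm u := ENNReal.toReal_nonneg

theorem l2norm_add_le {u v : ℝ → ℂ} (hu : MemLp u 2 volume) (hv : MemLp v 2 volume) :
    l2norm (fun x => u x + v x) ≤ l2norm u + l2norm v := by
  rw [l2norm, l2norm, l2norm, ← ENNReal.toReal_add hu.eLpNorm_ne_top hv.eLpNorm_ne_top]
  exact ENNReal.toReal_mono (ENNReal.add_ne_top.2 ⟨hu.eLpNorm_ne_top, hv.eLpNorm_ne_top⟩)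
    (eLpNorm_add_le hu.aestronglyMeasurable hv.aestronglyMeasurable one_le_two)

theorem l2norm_congr_ae {u v : ℝ → ℂ} (h : u =ᵐ[volume] v) : l2norm u = l2norm v := by
  rw [l2norm, l2norm, eLpNorm_congr_ae h]

theorem l2norm_le_mul {u v : ℝ → ℂ} (hv : MemLp v 2 volume) {c : ℝ} (hc : 0 ≤ c)
    (h : ∀ᵐ x, ‖u x‖ ≤ c * ‖v x‖) : l2norm u ≤ c * l2norm v := by
  have h1 := eLpNorm_le_mul_eLpNorm_of_ae_le_mul h (2 : ENNReal)
  rw [l2norm, l2norm, ← ENNReal.toReal_ofReal hc, ← ENNReal.toReal_mul]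
  exact ENNReal.toReal_mono (ENNReal.mul_ne_top ENNReal.ofReal_ne_top hv.eLpNorm_ne_top) h1

theorem toReal_eLpNorm_indicator_Icc {a b : ℝ} (hab : a ≤ b) {k : ℝ} (hk : 0 ≤ k) :
    (eLpNorm ((Icc a b).indicator fun _ => k) 2 volume).toReal = k * √(b - a) := by
  rw [eLpNorm_indicator_const measurableSet_Icc (by norm_num) (by norm_num), Real.volume_Icc,
    ENNReal.toReal_mul, ← ENNReal.toReal_rpow, ENNReal.toReal_ofReal (by linarith),
    toReal_enorm, Real.norm_of_nonneg hk, Real.sqrt_eq_rpow]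
  norm_num

theorem l2norm_le_of_bound {u : ℝ → ℂ} {δ K : Side → ℝ} (hδ : ∀ s, 0 ≤ δ s) (hK : ∀ s, 0 ≤ K s)
    (h0 : ∀ x ∉ Icc (-δ .minus) (δ .plus), u x = 0)
    (h : ∀ s, ∀ᵐ t, t ∈ Icc 0 (δ s) → ‖u (s.sgn * t)‖ ≤ K s) :
    l2norm u ≤ K .minus * √(δ .minus) + K .plus * √(δ .plus) := by
  have hm := Side.minus.ae_comp_sgn_mul (h .minus)
  have hp := Side.plus.ae_comp_sgn_mul (h .plus)
  have hle : ∀ᵐ x, ‖u x‖ ≤ ‖(Icc (-δ .minus) 0).indicator (fun _ => K .minus) x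
      + (Icc 0 (δ .plus)).indicator (fun _ => K .plus) x‖ := by
    filter_upwards [hm, hp] with x h1 h2
    rw [Side.sgn_mul_cancel] at h1 h2
    simp only [Side.sgn, neg_mul, one_mul] at h1 h2
    have i1 : 0 ≤ (Icc (-δ .minus) 0).indicator (fun _ => K .minus) x :=
      indicator_nonneg (fun _ _ => hK _) x
    have i2 : 0 ≤ (Icc 0 (δ .plus)).indicator (fun _ => K .plus) x :=
      indicator_nonneg (fun _ _ => hK _) x
    rw [Real.norm_of_nonneg (add_nonneg i1 i2)]
    by_cases hx : x ∈ Icc (-δ .minus) (δ .plus)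
    · rcases le_total x 0 with hx0 | hx0
      · have hmem : x ∈ Icc (-δ .minus) 0 := ⟨hx.1, hx0⟩
        have h3 := h1 ⟨by linarith, by linarith [hx.1]⟩
        rw [indicator_of_mem hmem]
        linarith
      · have hmem : x ∈ Icc 0 (δ .plus) := ⟨hx0, hx.2⟩
        have h3 := h2 ⟨hx0, hx.2⟩
        rw [indicator_of_mem hmem]
        linarith
    · rw [h0 x hx, norm_zero]
      exact add_nonneg i1 i2
  have fin : ∀ (a b k : ℝ), eLpNorm ((Icc a b).indicator fun _ => k) 2 volume ≠ ⊤ := fun a b k =>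
    (memLp_indicator_const 2 measurableSet_Icc k (Or.inr (by simp))).eLpNorm_ne_top
  have meas : ∀ (a b k : ℝ), AEStronglyMeasurable ((Icc a b).indicator fun _ => k) volume :=
    fun a b k => (stronglyMeasurable_const.indicator measurableSet_Icc).aestronglyMeasurable
  have h1 := (eLpNorm_mono_ae hle).trans (eLpNorm_add_le (p := 2) (meas (-δ .minus) 0 (K .minus))
    (meas 0 (δ .plus) (K .plus)) one_le_two)
  have h2 := ENNReal.toReal_mono (ENNReal.add_ne_top.2 ⟨fin _ _ _, fin _ _ _⟩) h1
  rw [ENNReal.toReal_add (fin _ _ _) (fin _ _ _),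
    toReal_eLpNorm_indicator_Icc (by linarith [hδ .minus]) (hK _),
    toReal_eLpNorm_indicator_Icc (hδ _) (hK _)] at h2
  simpa [l2norm] using h2

theorem le_l2norm {u : ℝ → ℂ} (hu : MemLp u 2 volume) {k : ℝ} (hk : 0 ≤ k)
    (h : ∀ t ∈ Icc (0 : ℝ) 1, k ≤ ‖u t‖) : k ≤ l2norm u := by
  have hle : ∀ x, ‖(Icc (0 : ℝ) 1).indicator (fun _ => k) x‖ ≤ ‖u x‖ := fun x => by
    by_cases hx : x ∈ Icc (0 : ℝ) 1
    · rw [indicator_of_mem hx, Real.norm_of_nonneg hk]; exact h x hx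
    · rw [indicator_of_notMem hx, norm_zero]; exact norm_nonneg _
  have h1 := ENNReal.toReal_mono hu.eLpNorm_ne_top (eLpNorm_mono (p := 2) (μ := volume) hle)
  rw [toReal_eLpNorm_indicator_Icc zero_le_one hk] at h1
  simpa [l2norm] using h1

/-! ### Size of the cut-off terms -/

section

variable {n : ℕ} {V : ℝ → ℂ} {ν : Side → ℝ} {ε₁ : ℝ} {s : Side} {δ Δ E B : ℝ → ℝ}

/-- Each of 1/Δ, √δ and √λ is at most exp(cE/6). Both expressions contain three such factors, which
costs half of the decay exp(-cE). The factor √δ anticipates the passage from supremum to L² norm. -/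
theorem SideControl.transition (hV : Admissible (n + 1) V ν ε₁)
    (h : SideControl n (fun t => V (s.sgn * t)) s.sgn (ν s) δ Δ E B) (C : ℝ) :
    ∃ K > 0, ∃ c > 0, ∀ᶠ lam in atTop, ∀ᵐ t, t ∈ Icc (δ lam - Δ lam) (δ lam) →
      C / Δ lam ^ 2 * ‖ansatz V n lam (s.sgn * t)‖ * √(δ lam) ≤ K * Real.exp (-c * E lam) ∧
      C / Δ lam ^ 1 * ‖logDer V n lam (s.sgn * t) * ansatz V n lam (s.sgn * t)‖ * √(δ lam)
        ≤ K * Real.exp (-c * E lam) := by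
  obtain ⟨A, hA, c, hc, hg⟩ := h.norm_ansatz hV
  obtain ⟨A', hA', hL⟩ := h.logDer_bounds hV
  have hη : 0 < c / 6 := by positivity
  refine ⟨(|C| + 1) * A * (A' + 1), by positivity, c / 2, by positivity, ?_⟩
  filter_upwards [hg, hL, h.width_pos, h.width_le, h.rpow_le _ hη (1 / 2), h.delta_le _ hη,
    h.width_inv_le _ hη, h.tendsto_delta.eventually_ge_atTop 1] with lam h1 h2 h3 h4 h5 h6 h7 h8
  filter_upwards [h2] with t ht hmem
  have h9 := h1.1 t hmem
  have h10 := (ht ⟨by linarith [hmem.1], hmem.2⟩).2.1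
  rw [← Real.sqrt_eq_rpow] at h5
  have hd : √(δ lam) ≤ Real.exp (c / 6 * E lam) :=
    (Real.sqrt_le_iff.2 ⟨by linarith, by nlinarith⟩).trans h6
  set X := Real.exp (c / 6 * E lam) with hX
  have hX0 : 0 < X := Real.exp_pos _
  have hprod : X * X * X * Real.exp (-c * E lam) = Real.exp (-(c / 2) * E lam) := by
    rw [hX, ← Real.exp_add, ← Real.exp_add, ← Real.exp_add]; congr 1; ring
  have hi : 0 < (Δ lam)⁻¹ := inv_pos.2 h3
  have hC : C ≤ |C| + 1 := by linarith [le_abs_self C]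
  rw [← hprod]
  constructor
  · calc C / Δ lam ^ 2 * ‖ansatz V n lam (s.sgn * t)‖ * √(δ lam)
        = C * ((Δ lam)⁻¹ * (Δ lam)⁻¹) * ‖ansatz V n lam (s.sgn * t)‖ * √(δ lam) := by
          rw [div_eq_mul_inv, sq, mul_inv]
      _ ≤ (|C| + 1) * (X * X) * (A * Real.exp (-c * E lam)) * X := by gcongr
      _ = (|C| + 1) * A * 1 * (X * X * X * Real.exp (-c * E lam)) := by ring
      _ ≤ _ := by gcongr; linarith
  · rw [norm_mul]
    calc C / Δ lam ^ 1 * (‖logDer V n lam (s.sgn * t)‖ * ‖ansatz V n lam (s.sgn * t)‖) * √(δ lam)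
        = C * (Δ lam)⁻¹ * (‖logDer V n lam (s.sgn * t)‖ * ‖ansatz V n lam (s.sgn * t)‖)
            * √(δ lam) := by rw [div_eq_mul_inv, pow_one]
      _ ≤ (|C| + 1) * X * (A' * X * (A * Real.exp (-c * E lam))) * X := by
          gcongr
          exact h10.trans (by gcongr)
      _ = (|C| + 1) * A * A' * (X * X * X * Real.exp (-c * E lam)) := by ring
      _ ≤ _ := by gcongr; linarith

end

/-- A cut-off is locally constant away from the transition regions, and its derivatives are
controlled there. -/
theorem IsCutoff.iteratedDeriv_side {C : ℝ} {δ Δ : Side → ℝ} {η : ℝ → ℝ} (h : IsCutoff C δ Δ η)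
    (hpos : ∀ s, 0 < δ s) (hΔ : ∀ s, Δ s ≤ δ s / 4) (s : Side) {j : ℕ}
    (hj : j ∈ Finset.Icc 1 2) {t : ℝ} (ht : 0 ≤ t) :
    (t < δ s - Δ s → iteratedDeriv j η (s.sgn * t) = 0) ∧
    (δ s - Δ s ≤ t → |iteratedDeriv j η (s.sgn * t)| ≤ C / Δ s ^ j) := by
  constructor
  · intro hlt
    have hmem : s.sgn * t ∈ Ioo (-δ .minus + Δ .minus) (δ .plus - Δ .plus) := by
      have h1 := hpos .minus
      have h2 := hpos .plus
      have h3 := hΔ .minus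
      have h4 := hΔ .plus
      cases s <;> simp only [Side.sgn, neg_mul, one_mul] <;> constructor <;> linarith
    have e : η =ᶠ[𝓝 (s.sgn * t)] fun _ => 1 := by
      filter_upwards [isOpen_Ioo.mem_nhds hmem] with y hy using h.eq_one y hy
    rw [e.iteratedDeriv_eq j, iteratedDeriv_const, if_neg]
    have := (Finset.mem_Icc.1 hj).1
    omega
  · intro hle
    have h1 := hpos s
    have h2 := hΔ s
    refine h.deriv_le s j hj _ ?_
    cases s <;> simp only [Side.sgn, Side.halfLine, neg_mul, one_mul, mem_Iio, mem_Ioi] <;> linarith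

theorem IsCutoff.l2norm_le {C : ℝ} {δ Δ : Side → ℝ} {η : ℝ → ℝ} (h : IsCutoff C δ Δ η)
    (hpos : ∀ s, 0 < δ s) (hΔ : ∀ s, Δ s ≤ δ s / 4) {j : ℕ} (hj : j ∈ Finset.Icc 1 2)
    {G : ℝ → ℂ} {b : Side → ℝ} (hb : ∀ s, 0 ≤ b s)
    (hG : ∀ s, ∀ᵐ t, t ∈ Icc (δ s - Δ s) (δ s) →
      C / Δ s ^ j * ‖G (s.sgn * t)‖ * √(δ s) ≤ b s) :
    l2norm (fun x => ((iteratedDeriv j η x : ℝ) : ℂ) * G x) ≤ b .minus + b .plus := by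
  have hzero : ∀ x ∉ Icc (-δ .minus) (δ .plus), ((iteratedDeriv j η x : ℝ) : ℂ) * G x = 0 := by
    intro x hx
    have e : η =ᶠ[𝓝 x] fun _ => 0 := by
      filter_upwards [isClosed_Icc.isOpen_compl.mem_nhds hx] with y hy
      exact h.eq_zero y fun h' => hy ⟨h'.1.le, h'.2.le⟩
    have h0 : iteratedDeriv j η x = 0 := by
      rw [e.iteratedDeriv_eq j, iteratedDeriv_const]
      split <;> rfl
    rw [h0]
    simp
  have hbound : ∀ s, ∀ᵐ t, t ∈ Icc 0 (δ s) →
      ‖((iteratedDeriv j η (s.sgn * t) : ℝ) : ℂ) * G (s.sgn * t)‖ ≤ b s / √(δ s) := by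
    intro s
    filter_upwards [hG s] with t ht hmem
    have hs : 0 < √(δ s) := Real.sqrt_pos.2 (hpos s)
    obtain ⟨h2, h3⟩ := h.iteratedDeriv_side hpos hΔ s hj hmem.1
    rcases lt_or_ge t (δ s - Δ s) with hlt | hge
    · rw [h2 hlt]
      simpa using div_nonneg (hb s) hs.le
    · rw [le_div_iff₀ hs, norm_mul, Complex.norm_real, Real.norm_eq_abs]
      refine le_trans ?_ (ht ⟨hge, hmem.2⟩)
      gcongr
      exact h3 hge
  have h1 := l2norm_le_of_bound (K := fun s => b s / √(δ s)) (fun s => (hpos s).le)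
    (fun s => div_nonneg (hb s) (Real.sqrt_nonneg _)) hzero hbound
  have e : ∀ s, b s / √(δ s) * √(δ s) = b s := fun s =>
    div_mul_cancel₀ _ (Real.sqrt_pos.2 (hpos s)).ne'
  rwa [e, e] at h1


/-! ### The pseudomode estimate -/

theorem Side.exists_eq_sgn_mul {δ : Side → ℝ} {x : ℝ} (hx : x ∈ Icc (-δ .minus) (δ .plus)) :
    ∃ s : Side, ∃ t ∈ Icc 0 (δ s), x = s.sgn * t := by
  rcases le_total x 0 with h | h
  · exact ⟨.minus, -x, ⟨by linarith, by linarith [hx.1]⟩, by simp [Side.sgn]⟩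
  · exact ⟨.plus, x, ⟨h, hx.2⟩, by simp [Side.sgn]⟩

theorem Side.eventually_forall {α : Type*} {l : Filter α} {p : Side → α → Prop}
    (h : ∀ s, ∀ᶠ a in l, p s a) : ∀ᶠ a in l, ∀ s, p s a := by
  filter_upwards [h .minus, h .plus] with a h1 h2 s
  cases s
  exacts [h1, h2]

/-- A quantity bounded by a sum of two contributions splits accordingly. -/
theorem exists_split {X : ℝ → ℝ} {A : Side → ℝ → ℝ} {K : ℝ}
    (hA : ∀ s, ∀ᶠ lam in atTop, 0 ≤ A s lam)
    (hX : ∀ᶠ lam in atTop, |X lam| ≤ K * (A .minus lam + A .plus lam)) :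
    ∃ Y : Side → ℝ → ℝ, (∀ᶠ lam in atTop, X lam = Y .minus lam + Y .plus lam) ∧
      ∀ s, Y s =O[atTop] A s := by
  refine ⟨fun s lam => X lam / (A .minus lam + A .plus lam) * A s lam, ?_, fun s => ?_⟩
  · filter_upwards [hX, hA .minus, hA .plus] with lam h1 h2 h3
    -- The shares are proportional to the two bounds. If the total vanishes, so does X, in agreement
    -- with division by zero giving zero.
    rcases eq_or_ne (A .minus lam + A .plus lam) 0 with h0 | h0
    · rw [h0, mul_zero] at h1
      rw [abs_nonpos_iff.1 h1]
      simp
    · field_simp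
  · refine IsBigO.of_bound |K| ?_
    filter_upwards [hX, hA .minus, hA .plus] with lam h1 h2 h3
    rw [norm_mul]
    refine mul_le_mul_of_nonneg_right ?_ (norm_nonneg _)
    rw [Real.norm_eq_abs, abs_div, abs_of_nonneg (add_nonneg h2 h3)]
    refine div_le_of_le_mul₀ (add_nonneg h2 h3) (abs_nonneg _) (h1.trans ?_)
    exact mul_le_mul_of_nonneg_right (le_abs_self K) (add_nonneg h2 h3)

theorem SideControl.errBound_nonneg {n : ℕ} {W : ℝ → ℂ} {σ μ : ℝ} {δ Δ E B : ℝ → ℝ}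
    (h : SideControl n W σ μ δ Δ E B) : ∀ᶠ lam in atTop, 0 ≤ B lam := by
  obtain ⟨D, hD, h1⟩ := h.err_lower
  filter_upwards [h1, eventually_gt_atTop 0] with lam h2 h3
  exact nonneg_of_mul_nonneg_right ((Real.rpow_nonneg h3.le _).trans h2) hD

/-- The rate beats every power of λ, and λ^{-(n+1)/2} is dominated by B. This is what allows κ to be
absorbed into σ. -/
theorem SideControl.exp_le_errBound {n : ℕ} {W : ℝ → ℂ} {σ μ c : ℝ} {δ Δ E B : ℝ → ℝ} (hc : 0 < c)
    (h : SideControl n W σ μ δ Δ E B) :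
    ∃ D > 0, ∀ᶠ lam in atTop, Real.exp (-c * E lam) ≤ D * B lam := by
  obtain ⟨D, hD, h1⟩ := h.err_lower
  refine ⟨D, hD, ?_⟩
  filter_upwards [h1, h.rpow_le c hc (((n : ℝ) + 1) / 2), eventually_gt_atTop 0] with lam h2 h3 h4
  refine le_trans ?_ h2
  rw [neg_div, Real.rpow_neg h4.le, neg_mul, Real.exp_neg]
  exact inv_anti₀ (Real.rpow_pos_of_pos h4 _) h3

section

variable {n : ℕ} {V : ℝ → ℂ} {ν : Side → ℝ} {ε₁ : ℝ} {δ Δ E B : Side → ℝ → ℝ} {ξ : ℝ → ℝ → ℝ}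
  {C : ℝ}

theorem slitCutoff_of_isCutoff
    (h : ∀ s : Side, SideControl n (fun t => V (s.sgn * t)) s.sgn (ν s) (δ s) (Δ s) (E s) (B s))
    (hξ : ∀ᶠ lam in atTop, IsCutoff C (fun s => δ s lam) (fun s => Δ s lam) (ξ lam)) :
    ∀ᶠ lam in atTop, SlitCutoff V lam (-δ .minus lam) (δ .plus lam) (ξ lam) := by
  filter_upwards [hξ, Side.eventually_forall fun s => (h s).slitPlane,
    Side.eventually_forall fun s => (h s).tendsto_delta.eventually_ge_atTop 1,
    eventually_gt_atTop 0] with lam h1 h2 h3 h4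
  refine ⟨h4, by linarith [h3 .minus], by linarith [h3 .plus], h1.smooth, h1.eq_zero, fun x hx => ?_⟩
  obtain ⟨s, t, ht, rfl⟩ := Side.exists_eq_sgn_mul (δ := fun s => δ s lam) hx
  exact h2 s t ht

/-- The derivatives of the cut-off contribute exponentially small terms. -/
theorem exists_transition_bound (hV : Admissible (n + 1) V ν ε₁)
    (h : ∀ s : Side, SideControl n (fun t => V (s.sgn * t)) s.sgn (ν s) (δ s) (Δ s) (E s) (B s))
    (hξ : ∀ᶠ lam in atTop, IsCutoff C (fun s => δ s lam) (fun s => Δ s lam) (ξ lam)) :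
    ∃ K > 0, ∃ c : Side → ℝ, (∀ s, 0 < c s) ∧ ∀ᶠ lam in atTop,
      l2norm (fun x => ((iteratedDeriv 2 (ξ lam) x : ℝ) : ℂ) * ansatz V n lam x)
        ≤ K * (Real.exp (-c .minus * E .minus lam) + Real.exp (-c .plus * E .plus lam)) ∧
      l2norm (fun x => ((iteratedDeriv 1 (ξ lam) x : ℝ) : ℂ) *
          (logDer V n lam x * ansatz V n lam x))
        ≤ K * (Real.exp (-c .minus * E .minus lam) + Real.exp (-c .plus * E .plus lam)) := by
  choose K hK c hc ht using fun s => (h s).transition hV C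
  have hKle : ∀ s lam, K s * Real.exp (-c s * E s lam)
      ≤ (K .minus + K .plus) * Real.exp (-c s * E s lam) := fun s lam => by
    gcongr
    cases s
    · linarith [hK .plus]
    · linarith [hK .minus]
  refine ⟨K .minus + K .plus, add_pos (hK _) (hK _), c, hc, ?_⟩
  filter_upwards [hξ, Side.eventually_forall ht, Side.eventually_forall fun s => (h s).width_le,
    Side.eventually_forall fun s => (h s).tendsto_delta.eventually_ge_atTop 1]
    with lam h1 h2 h3 h4
  have hpos : ∀ s, 0 < δ s lam := fun s => by linarith [h4 s]
  have hb : ∀ s, 0 ≤ K s * Real.exp (-c s * E s lam) := fun s =>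
    mul_nonneg (hK s).le (Real.exp_pos _).le
  have hsum := add_le_add (hKle .minus lam) (hKle .plus lam)
  rw [← mul_add] at hsum
  constructor
  · refine (h1.l2norm_le hpos h3 (by simp) hb fun s => ?_).trans hsum
    filter_upwards [h2 s] with t h5 h6 using (h5 h6).1
  · refine (h1.l2norm_le hpos h3 (by simp) hb fun s => ?_).trans hsum
    filter_upwards [h2 s] with t h5 h6 using (h5 h6).2

theorem exists_remainder_bound (hV : Admissible (n + 1) V ν ε₁)
    (h : ∀ s : Side, SideControl n (fun t => V (s.sgn * t)) s.sgn (ν s) (δ s) (Δ s) (E s) (B s)) :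
    ∃ A > 0, ∀ᶠ lam in atTop, ∀ᵐ x, x ∈ Icc (-δ .minus lam) (δ .plus lam) →
      ‖remainder V n lam x‖ ≤ A * (B .minus lam + B .plus lam) := by
  choose A hA hb using fun s => (h s).logDer_bounds hV
  refine ⟨A .minus + A .plus, add_pos (hA _) (hA _), ?_⟩
  filter_upwards [Side.eventually_forall hb, Side.eventually_forall fun s => (h s).errBound_nonneg]
    with lam h1 h2
  have h3 := Side.minus.ae_comp_sgn_mul (h1 .minus)
  have h4 := Side.plus.ae_comp_sgn_mul (h1 .plus)
  have e1 := mul_nonneg (hA .minus).le (h2 .plus)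
  have e2 := mul_nonneg (hA .plus).le (h2 .minus)
  have e3 := mul_nonneg (hA .minus).le (h2 .minus)
  have e4 := mul_nonneg (hA .plus).le (h2 .plus)
  filter_upwards [h3, h4] with x h5 h6 hx
  rw [Side.sgn_mul_cancel] at h5 h6
  rcases le_total x 0 with h0 | h0
  · have := (h5 (by simp only [Side.sgn]; exact ⟨by linarith, by linarith [hx.1]⟩)).2.2
    rw [remainder]
    linarith
  · have := (h6 (by simp only [Side.sgn, one_mul]; exact ⟨h0, hx.2⟩)).2.2
    rw [remainder]
    linarith

/-- On [0,1] the cut-off equals 1 and |g| is bounded below, so dividing by ‖f‖ costs only a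
constant. -/
theorem exists_le_l2norm_pseudomode (hV : Admissible (n + 1) V ν ε₁)
    (h : ∀ s : Side, SideControl n (fun t => V (s.sgn * t)) s.sgn (ν s) (δ s) (Δ s) (E s) (B s))
    (hξ : ∀ᶠ lam in atTop, IsCutoff C (fun s => δ s lam) (fun s => Δ s lam) (ξ lam)) :
    ∃ m > 0, ∀ᶠ lam in atTop, m ≤ l2norm (pseudomode V n ξ lam) := by
  obtain ⟨A, hA, c, -, hg⟩ := (h .plus).norm_ansatz hV
  refine ⟨A⁻¹, inv_pos.2 hA, ?_⟩
  filter_upwards [hg, hξ, slitCutoff_of_isCutoff h hξ,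
    Side.eventually_forall fun s => (h s).width_le,
    Side.eventually_forall fun s => (h s).tendsto_delta.eventually_ge_atTop 2]
    with lam h1 h2 h3 h4 h5
  refine le_l2norm (h3.memLp hV) (inv_pos.2 hA).le fun t ht => ?_
  have h6 := h1.2 t ht
  simp only [Side.sgn, one_mul] at h6
  rw [h2.eq_one t ⟨by linarith [ht.1, h4 .minus, h5 .minus], by linarith [ht.2, h4 .plus, h5 .plus]⟩]
  simpa using h6

/-- The pseudomode lies in the domain, its cut-off error is exponentially small, and the defect is
the cut-off error up to the size of the transport remainder. -/
theorem pseudomode_estimate (hV : Admissible (n + 1) V ν ε₁)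
    (h : ∀ s : Side, SideControl n (fun t => V (s.sgn * t)) s.sgn (ν s) (δ s) (Δ s) (E s) (B s))
    (hξ : ∀ᶠ lam in atTop, IsCutoff C (fun s => δ s lam) (fun s => Δ s lam) (ξ lam)) :
    (∀ᶠ lam in atTop, MemDomain V (pseudomode V n ξ lam) ∧ 0 < l2norm (pseudomode V n ξ lam)) ∧
    ∃ K > 0, ∃ c : Side → ℝ, (∀ s, 0 < c s) ∧ (∀ᶠ lam in atTop, |cutoffError V n ξ lam|
        ≤ K * (Real.exp (-c .minus * E .minus lam) + Real.exp (-c .plus * E .plus lam))) ∧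
      ∀ᶠ lam in atTop, |quotient V (pseudomode V n ξ lam) lam - cutoffError V n ξ lam|
        ≤ K * (B .minus lam + B .plus lam) := by
  obtain ⟨K, hK, c, hc, ht⟩ := exists_transition_bound hV h hξ
  obtain ⟨A, hA, hR⟩ := exists_remainder_bound hV h
  obtain ⟨m, hm, hf⟩ := exists_le_l2norm_pseudomode hV h hξ
  have hslit := slitCutoff_of_isCutoff h hξ
  have hκ : ∀ᶠ lam in atTop, 0 ≤ cutoffError V n ξ lam ∧ cutoffError V n ξ lam
      ≤ 2 * K / m * (Real.exp (-c .minus * E .minus lam) + Real.exp (-c .plus * E .plus lam)) ∧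
      cutoffError V n ξ lam * l2norm (pseudomode V n ξ lam) =
        l2norm (fun x => ((iteratedDeriv 2 (ξ lam) x : ℝ) : ℂ) * ansatz V n lam x) +
        l2norm (fun x => ((iteratedDeriv 1 (ξ lam) x : ℝ) : ℂ) *
          (logDer V n lam x * ansatz V n lam x)) := by
    filter_upwards [ht, hf, hslit] with lam h1 h2 h3
    have hpos : 0 < l2norm (pseudomode V n ξ lam) := hm.trans_le h2
    have e : l2norm (fun x => ((deriv (ξ lam) x : ℝ) : ℂ) * deriv (ansatz V n lam) x)
        = l2norm (fun x => ((iteratedDeriv 1 (ξ lam) x : ℝ) : ℂ) *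
          (logDer V n lam x * ansatz V n lam x)) := by
      simp_rw [h3.deriv_mul_deriv_ansatz hV]
      rw [l2norm, l2norm]
      congr 1
      exact eLpNorm_neg (f := fun x => ((iteratedDeriv 1 (ξ lam) x : ℝ) : ℂ) *
          (logDer V n lam x * ansatz V n lam x)) 2 volume
    rw [cutoffError, e]
    refine ⟨div_nonneg (add_nonneg (l2norm_nonneg _) (l2norm_nonneg _)) (l2norm_nonneg _), ?_,
      div_mul_cancel₀ _ hpos.ne'⟩
    set S := Real.exp (-c .minus * E .minus lam) + Real.exp (-c .plus * E .plus lam) with hS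
    have hS0 : 0 ≤ S := by positivity
    calc _ ≤ (K * S + K * S) / m := by
          refine div_le_div₀ (by positivity) (add_le_add h1.1 h1.2) hm h2
      _ = _ := by ring
  choose D hD hexp using fun s => (h s).exp_le_errBound (hc s)
  refine ⟨?_, 2 * K / m * (D .minus + D .plus) + A + 2 * K / m, ?_, c, hc, ?_, ?_⟩
  · filter_upwards [hslit, hR, hf] with lam h1 h2 h3
    exact ⟨⟨h1.memLp hV, ⟨_, h1.isWeakDeriv_two hV⟩, (h1.memLp_schrodinger_sub hV h2).2⟩,
      hm.trans_le h3⟩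
  · have := hD .minus
    have := hD .plus
    positivity
  · filter_upwards [hκ] with lam h1
    rw [abs_of_nonneg h1.1]
    refine h1.2.1.trans (mul_le_mul_of_nonneg_right ?_ (by positivity))
    have : 0 ≤ 2 * K / m * (D .minus + D .plus) := by
      have := hD .minus
      have := hD .plus
      positivity
    linarith
  · filter_upwards [hκ, hslit, hR, hf, Side.eventually_forall hexp,
      Side.eventually_forall fun s => (h s).errBound_nonneg] with lam h1 h2 h3 h4 h5 h6
    obtain ⟨hκ0, hκ1, hκ2⟩ := h1
    have hpos : 0 < l2norm (pseudomode V n ξ lam) := hm.trans_le h4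
    set b := B .minus lam + B .plus lam with hb
    have hb0 : 0 ≤ b := add_nonneg (h6 _) (h6 _)
    have hm2 := h2.memLp_mul 2 fun x hx => h2.lipAt_ansatz hV hx
    have hm1 := h2.memLp_mul 1 fun x hx => h2.lipAt_logDer_mul_ansatz hV hx
    have hm0 := (h2.memLp_schrodinger_sub hV h3).1
    have hfm : MemLp (pseudomode V n ξ lam) 2 volume := h2.memLp hV
    -- The commutator contains 2ξ'g', so the natural estimate has 2κ in place of κ.
    have hq : l2norm (fun x => schrodinger V (pseudomode V n ξ lam) x
          - lam * pseudomode V n ξ lam x)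
        ≤ (2 * cutoffError V n ξ lam + A * b) * l2norm (pseudomode V n ξ lam) := by
      refine (l2norm_congr_ae (h2.schrodinger_sub hV)).trans_le ?_
      refine (l2norm_add_le (hm2.neg.add (hm1.const_mul 2)) hm0).trans ?_
      refine (add_le_add_left (l2norm_add_le hm2.neg (hm1.const_mul 2)) _).trans ?_
      have e2 : l2norm (-fun x => ((iteratedDeriv 2 (ξ lam) x : ℝ) : ℂ) * ansatz V n lam x)
          ≤ 1 * l2norm (fun x => ((iteratedDeriv 2 (ξ lam) x : ℝ) : ℂ) * ansatz V n lam x) :=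
        l2norm_le_mul hm2 zero_le_one (ae_of_all _ fun x => by simp)
      have e1 := l2norm_le_mul (u := fun x => 2 * (((iteratedDeriv 1 (ξ lam) x : ℝ) : ℂ) *
          (logDer V n lam x * ansatz V n lam x))) hm1 zero_le_two (ae_of_all _ fun x => by simp)
      have e0 : l2norm (fun x => remainder V n lam x * ((ξ lam x : ℂ) * ansatz V n lam x))
          ≤ A * b * l2norm (pseudomode V n ξ lam) := by
        refine l2norm_le_mul hfm (by positivity) ?_
        filter_upwards [h3] with x hx
        rw [norm_mul]
        by_cases hmem : x ∈ Icc (-δ .minus lam) (δ .plus lam)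
        · exact mul_le_mul_of_nonneg_right (hx hmem) (norm_nonneg _)
        · have : ξ lam x = 0 := (h2.eventually_eq_zero hmem).eq_of_nhds
          simp [pseudomode, this]
      have := l2norm_nonneg (fun x => ((iteratedDeriv 2 (ξ lam) x : ℝ) : ℂ) * ansatz V n lam x)
      linarith
    have hq1 : quotient V (pseudomode V n ξ lam) lam ≤ 2 * cutoffError V n ξ lam + A * b := by
      rw [quotient, div_le_iff₀ hpos]
      exact hq
    have hq0 : 0 ≤ quotient V (pseudomode V n ξ lam) lam :=
      div_nonneg (l2norm_nonneg _) (l2norm_nonneg _)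
    -- The difference lies between -κ and κ + A b, so a bound of κ by a multiple of b closes the
    -- estimate.
    have hκb : cutoffError V n ξ lam ≤ 2 * K / m * (D .minus + D .plus) * b := by
      have hKm : 0 ≤ 2 * K / m := by positivity
      refine hκ1.trans ?_
      rw [mul_assoc]
      refine mul_le_mul_of_nonneg_left ?_ hKm
      have e1 := mul_nonneg (hD .minus).le (h6 .plus)
      have e2 := mul_nonneg (hD .plus).le (h6 .minus)
      linarith [h5 .minus, h5 .plus, hb]
    have hAb : 0 ≤ A * b := by positivity
    have hKb : 0 ≤ 2 * K / m * b := by positivity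
    rw [abs_le]
    constructor <;> linarith

end
end JWKB

/-! ### Assembly of the theorem from the estimates at the two ends -/

theorem mainTheorem1 (N n : ℕ) (hn : n + 1 = N) (V : ℝ → ℂ) (ν : JWKB.Side → ℝ) (ε₁ ε₂ : ℝ)
    (hV : JWKB.Admissible N V ν ε₁)
    (hε₂ : ∀ s : JWKB.Side, JWKB.BoundedAt s V → 0 < ε₂ ∧ ε₂ < 1 - ν s)
    (ξ : ℝ → ℝ → ℝ)
    (hξ : ∃ C : ℝ, ∀ᶠ lam in atTop,
      JWKB.IsCutoff C (JWKB.delta V ν ε₁ ε₂ lam) (JWKB.width V ν ε₁ ε₂ lam) (ξ lam)) :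
    (∀ s : JWKB.Side, Tendsto (fun lam => JWKB.delta V ν ε₁ ε₂ lam s) atTop atTop) ∧
    (∀ᶠ lam in atTop, JWKB.MemDomain V (JWKB.pseudomode V n ξ lam) ∧
      0 < JWKB.l2norm (JWKB.pseudomode V n ξ lam)) ∧
    Tendsto (JWKB.cutoffError V n ξ) atTop (𝓝 0) ∧
    ∃ κ σ : JWKB.Side → ℝ → ℝ,
      (∀ᶠ lam in atTop, JWKB.cutoffError V n ξ lam = κ .minus lam + κ .plus lam) ∧
      (∀ᶠ lam in atTop, JWKB.quotient V (JWKB.pseudomode V n ξ lam) lam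
        = JWKB.cutoffError V n ξ lam + (σ .minus lam + σ .plus lam)) ∧
      ∀ s : JWKB.Side,
        (¬ JWKB.BoundedAt s V →
          (∃ c > 0, κ s =O[atTop] fun lam =>
            Real.exp (-c * JWKB.delta V ν ε₁ ε₂ lam s ^ (ν s + 1 + ε₁))) ∧
          (ν s < 0 → σ s =O[atTop] fun lam => lam ^ (-((n : ℝ) + 1) / 2) *
            JWKB.supWeighted V s (JWKB.delta V ν ε₁ ε₂ lam s) (((n : ℝ) + 1) * ν s)) ∧
          (0 ≤ ν s → σ s =O[atTop] fun lam =>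
            JWKB.delta V ν ε₁ ε₂ lam s ^ (((n : ℝ) + 1) * ν s) * lam ^ ((1 - (n : ℝ)) / 2))) ∧
        (JWKB.BoundedAt s V →
          (∃ c > 0, κ s =O[atTop] fun lam => Real.exp (-c * lam ^ (ε₂ / 2))) ∧
          (ν s < 0 → σ s =O[atTop] fun lam => lam ^ (-((n : ℝ) + 1) / 2)) ∧
          (0 ≤ ν s → σ s =O[atTop] fun lam =>
            lam ^ (-(((n : ℝ) + 1) / 2) * (1 - (1 + ε₂) * ν s)))) := by
  subst hn
  obtain ⟨C, hξ⟩ := hξ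
  have h := fun s : JWKB.Side => hV.sideControl s (hε₂ s)
  obtain ⟨hdom, K, hK, c, hc, hκ, hσ⟩ := JWKB.pseudomode_estimate
    (δ := fun s lam => JWKB.delta V ν ε₁ ε₂ lam s)
    (Δ := fun s lam => JWKB.width V ν ε₁ ε₂ lam s)
    (E := JWKB.rate V ν ε₁ ε₂) (B := JWKB.errBound n V ν ε₁ ε₂) hV h hξ
  have hexp : ∀ s, Tendsto (fun lam => Real.exp (-c s * JWKB.rate V ν ε₁ ε₂ s lam))
      atTop (𝓝 0) := fun s => by
    refine Real.tendsto_exp_atBot.comp ?_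
    exact (h s).tendsto_rate.const_mul_atTop_of_neg (neg_neg_of_pos (hc s))
  obtain ⟨κ, hκ1, hκ2⟩ := JWKB.exists_split
    (A := fun s lam => Real.exp (-c s * JWKB.rate V ν ε₁ ε₂ s lam))
    (fun s => Eventually.of_forall fun lam => (Real.exp_pos _).le) hκ
  -- The quantity split here is the quotient minus κ, so the stated decomposition holds exactly and
  -- not merely up to an error.
  obtain ⟨σ, hσ1, hσ2⟩ := JWKB.exists_split (A := JWKB.errBound n V ν ε₁ ε₂)
    (fun s => (h s).errBound_nonneg) hσ
  refine ⟨fun s => (h s).tendsto_delta, hdom, ?_, κ, σ, hκ1, ?_, fun s => ⟨fun hs => ?_, fun hs => ?_⟩⟩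
  · refine squeeze_zero_norm' hκ ?_
    simpa using ((hexp .minus).add (hexp .plus)).const_mul K
  · filter_upwards [hσ1] with lam h1
    linarith
  · have e : JWKB.rate V ν ε₁ ε₂ s = fun lam => JWKB.delta V ν ε₁ ε₂ lam s ^ (ν s + 1 + ε₁) := by
      funext lam; rw [JWKB.rate, if_neg hs]
    refine ⟨⟨c s, hc s, ?_⟩, fun hν => ?_, fun hν => ?_⟩
    · have := hκ2 s
      rwa [e] at this
    · refine (hσ2 s).congr_right fun lam => ?_
      rw [JWKB.errBound, if_neg hs, if_pos hν]
    · refine (hσ2 s).congr_right fun lam => ?_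
      rw [JWKB.errBound, if_neg hs, if_neg hν.not_gt]
  · have e : JWKB.rate V ν ε₁ ε₂ s = fun lam => lam ^ (ε₂ / 2) := by
      funext lam; rw [JWKB.rate, if_pos hs]
    refine ⟨⟨c s, hc s, ?_⟩, fun hν => ?_, fun hν => ?_⟩
    · have := hκ2 s
      rwa [e] at this
    · refine (hσ2 s).congr_right fun lam => ?_
      rw [JWKB.errBound, if_pos hs, if_pos hν]
    · refine (hσ2 s).congr_right fun lam => ?_
      rw [JWKB.errBound, if_pos hs, if_neg hν.not_gt]
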